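/- Let $d\ge 1$, $\alpha,\varepsilon\in(0,1)$, and let $Q_X\ne Q_Y$ be fixed Borel probability measures on $\mathbb{R}^d$ with finite second moments. Call a probability measure $P$ on $\mathbb{R}^d$ *admissible* if, for almost every $\beta$ in the unit sphere $\mathbb{S}^{d-1}$ (uniform measure), $\beta^\top Z$ with $Z\sim P$ has a continuous distribution function; assume $Q_X,Q_Y$ are admissible. For a probability measure $G$ put $P_X=(1-\varepsilon)Q_X+\varepsilon G$ and $P_Y=(1-\varepsilon)Q_Y+\varepsilon G$, and let $X_1,\dots,X_m\sim P_X$ and $Y_1,\dots,Y_n\sim P_Y$ be independent samples of i.i.d. observations. Let $$U_{\mathrm{CvM}}=\frac{1}{m(m-1)n(n-1)}\sum_{i_1\ne i_2}\sum_{j_1\ne j_2}\Big\{\tfrac13-\tfrac1{2\pi}\mathsf{Ang}(X_{i_1}-Y_{j_1},X_{i_2}-Y_{j_1})-\tfrac1{2\pi}\mathsf{Ang}(Y_{j_1}-X_{i_1},Y_{j_2}-X_{i_1})\Big\},$$ $$U_{\mathrm{Energy}}=\frac{2}{mn}\sum_{i,j}\|X_i-Y_j\|-\frac{1}{m(m-1)}\sum_{i_1\ne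 i_2}\|X_{i_1}-X_{i_2}\|-\frac{1}{n(n-1)}\sum_{j_1\ne j_2}\|Y_{j_1}-Y_{j_2}\|,$$ where $\mathsf{Ang}(u,v)=\arccos\{u^\top v/(\|u\|\|v\|)\}$. For either statistic $T$, let $Z=(X_1,\dots,X_m,Y_1,\dots,Y_n)$, let $T(Z_\varpi)$ be the statistic computed from the samples $Z_{\varpi(1)},\dots,Z_{\varpi(m)}$ and $Z_{\varpi(m+1)},\dots,Z_{\varpi(m+n)}$ for a permutation $\varpi\in\mathcal S_{m+n}$, and let $$c_\alpha(T)=\inf\Big\{t\in\mathbb{R}:1-\alpha\le\tfrac{1}{(m+n)!}\sum_{\varpi\in\mathcal S_{m+n}}\mathbf 1\big(T(Z_\varpi)\le t\big)\Big\}$$ be the permutation critical value. Put $\phi_{\mathrm{CvM}}=\mathbf 1\{U_{\mathrm{CvM}}>c_\alpha(U_{\mathrm{CvM}})\}$ and $\phi_{\mathrm{Energy}}=\mathbf 1\{U_{\mathrm{Energy}}>c_\alpha(U_{\mathrm{Energy}})\}$, and write $\mathbb{E}_{G}$ for expectation in this model. **Theorem (Robustness under contaminations).** 1. There is a sequence $(G_N)_{N}$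 of admissible probability measures such that, along all sequences of sample sizes $(m,n)$ with $N=m+n\to\infty$, $m/N\to\vartheta_X\in(0,1)$ and $n/N\to\vartheta_Y\in(0,1)$, the energy test is asymptotically powerless: $\limsup\,\mathbb{E}_{G_N}[\phi_{\mathrm{Energy}}]\le\alpha$. In particular, along all such sequences, $\limsup\,\inf_{G}\mathbb{E}_{G}[\phi_{\mathrm{Energy}}]\le\alpha$, where the infimum is over all admissible $G$. 2. The CvM test is asymptotically powerful uniformly over all admissible $G$: $\lim_{m,n\to\infty}\inf_{G}\mathbb{E}_{G}[\phi_{\mathrm{CvM}}]=1$, the infimum being over all admissible $G$, with no condition on the ratio $m/n$. -/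

import Mathlib

open MeasureTheory Filter Topology
open scoped ENNReal

noncomputable section

/-- The `ε`-contamination `(1 - ε) Q + ε G` of the distribution `Q` by the distribution `G`. -/
def contaminate {d : ℕ} (ε : ℝ) (Q G : Measure (EuclideanSpace ℝ (Fin d))) :
    Measure (EuclideanSpace ℝ (Fin d)) :=
  ENNReal.ofReal (1 - ε) • Q + ENNReal.ofReal ε • G

/-- For almost every direction `β` on the unit sphere (with respect to the surface measure), the
projection `βᵀ X` of `X ∼ P` has a continuous distribution function. -/
def ProjContinuous {d : ℕ} (P : Measure (EuclideanSpace ℝ (Fin d))) : Prop :=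
  ∀ᵐ β : Metric.sphere (0 : EuclideanSpace ℝ (Fin d)) 1
      ∂(volume : Measure (EuclideanSpace ℝ (Fin d))).toSphere,
    Continuous fun t : ℝ => P.real {x | inner ℝ (β : EuclideanSpace ℝ (Fin d)) x ≤ t}

/-- The kernel of order two of the multivariate Cramér-von Mises statistic. -/
def hCvM {d : ℕ} (x₁ x₂ y₁ y₂ : EuclideanSpace ℝ (Fin d)) : ℝ :=
  1 / 3 - 1 / (2 * Real.pi) * InnerProductGeometry.angle (x₁ - y₁) (x₂ - y₁)
    - 1 / (2 * Real.pi) * InnerProductGeometry.angle (y₁ - x₁) (y₂ - x₁)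

/-- The U-statistic `U_CvM`; the sums run over ordered pairs of distinct indices. -/
def UCvM {d m n : ℕ} (X : Fin m → EuclideanSpace ℝ (Fin d))
    (Y : Fin n → EuclideanSpace ℝ (Fin d)) : ℝ :=
  1 / (((m : ℝ) * ((m : ℝ) - 1)) * ((n : ℝ) * ((n : ℝ) - 1))) *
    ∑ i ∈ (Finset.univ : Finset (Fin m)).offDiag, ∑ j ∈ (Finset.univ : Finset (Fin n)).offDiag,
      hCvM (X i.1) (X i.2) (Y j.1) (Y j.2)

/-- The energy statistic `U_Energy` in its U-statistic form. -/
def UEnergy {d m n : ℕ} (X : Fin m → EuclideanSpace ℝ (Fin d))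
    (Y : Fin n → EuclideanSpace ℝ (Fin d)) : ℝ :=
  2 / ((m : ℝ) * (n : ℝ)) * ∑ i : Fin m, ∑ j : Fin n, ‖X i - Y j‖
    - 1 / ((m : ℝ) * ((m : ℝ) - 1)) *
        ∑ i ∈ (Finset.univ : Finset (Fin m)).offDiag, ‖X i.1 - X i.2‖
    - 1 / ((n : ℝ) * ((n : ℝ) - 1)) *
        ∑ j ∈ (Finset.univ : Finset (Fin n)).offDiag, ‖Y j.1 - Y j.2‖

/-- The value `T(Z_σ)` of a two-sample statistic on the permuted pooled sample: with
`Z = (X₁, …, X_m, Y₁, …, Y_n)`, the first sample is `Z_{σ(1)}, …, Z_{σ(m)}` and the second one is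
`Z_{σ(m+1)}, …, Z_{σ(m+n)}`. -/
def permStat {d m n : ℕ}
    (T : (Fin m → EuclideanSpace ℝ (Fin d)) → (Fin n → EuclideanSpace ℝ (Fin d)) → ℝ)
    (X : Fin m → EuclideanSpace ℝ (Fin d)) (Y : Fin n → EuclideanSpace ℝ (Fin d))
    (σ : Equiv.Perm (Fin (m + n))) : ℝ :=
  T (fun i => Fin.append X Y (σ (Fin.castAdd n i)))
    (fun j => Fin.append X Y (σ (Fin.natAdd m j)))

/-- The level `α` permutation critical value: the `1 - α` quantile of the permutation
distribution of `T`. -/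
def permCriticalValue {d m n : ℕ}
    (T : (Fin m → EuclideanSpace ℝ (Fin d)) → (Fin n → EuclideanSpace ℝ (Fin d)) → ℝ) (α : ℝ)
    (X : Fin m → EuclideanSpace ℝ (Fin d)) (Y : Fin n → EuclideanSpace ℝ (Fin d)) : ℝ :=
  sInf {t : ℝ | 1 - α ≤ 1 / (Nat.factorial (m + n) : ℝ) *
    ∑ σ : Equiv.Perm (Fin (m + n)), if permStat T X Y σ ≤ t then (1 : ℝ) else 0}

/-- The power `𝔼[φ]` of the permutation test `φ = 1(T > c_α)` for independent i.i.d. samples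
`X₁, …, X_m ∼ PX` and `Y₁, …, Y_n ∼ PY`. -/
def permTestPower {d m n : ℕ}
    (T : (Fin m → EuclideanSpace ℝ (Fin d)) → (Fin n → EuclideanSpace ℝ (Fin d)) → ℝ) (α : ℝ)
    (PX PY : Measure (EuclideanSpace ℝ (Fin d))) : ℝ≥0∞ :=
  ((Measure.pi fun _ : Fin m => PX).prod (Measure.pi fun _ : Fin n => PY))
    {S | permCriticalValue T α S.1 S.2 < T S.1 S.2}

/-- The power of the permutation energy test in the contamination model. -/
def energyPower {d : ℕ} (α ε : ℝ) (QX QY G : Measure (EuclideanSpace ℝ (Fin d)))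
    (m n : ℕ) : ℝ≥0∞ :=
  permTestPower (UEnergy (m := m) (n := n)) α (contaminate ε QX G) (contaminate ε QY G)

/-- The power of the permutation CvM test in the contamination model. -/
def cvmPower {d : ℕ} (α ε : ℝ) (QX QY G : Measure (EuclideanSpace ℝ (Fin d)))
    (m n : ℕ) : ℝ≥0∞ :=
  permTestPower (UCvM (m := m) (n := n)) α (contaminate ε QX G) (contaminate ε QY G)

/-- The conventional asymptotic regime, along sequences of sample sizes: `m + n → ∞`,
`m / (m + n) → ϑX` and `n / (m + n) → ϑY` with `ϑX, ϑY ∈ (0, 1)`. -/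
def ConventionalRegime (m n : ℕ → ℕ) : Prop :=
  ∃ ϑX ∈ Set.Ioo (0 : ℝ) 1, ∃ ϑY ∈ Set.Ioo (0 : ℝ) 1,
    Tendsto (fun k => m k + n k) atTop atTop ∧
    Tendsto (fun k => (m k : ℝ) / ((m k : ℝ) + (n k : ℝ))) atTop (𝓝 ϑX) ∧
    Tendsto (fun k => (n k : ℝ) / ((m k : ℝ) + (n k : ℝ))) atTop (𝓝 ϑY)

end

/-! The two tests react differently to a common contaminant because the CvM kernel is bounded, while
the energy kernel grows with distance.

CvM test. A random hyperplane separates two vectors with probability angle/π (`sepProb_eq_angle`),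
so the mean of the angle kernel is, up to a constant, an integrated product of projected
distribution functions. Since the angles of a triangle sum to π, the mean of `hCvM` is then a
squared L² distance between projected distribution functions (`meanKer_add_eq_sqGap`). The
contaminant cancels in the difference of these functions, and the integrating law dominates `1 - ε`
times the clean one. Hence the mean is at least `(1 - ε) ^ 3` times a constant independent of `G`,
which is positive by a Cramér–Wold argument (`sqGap_pos`). The triangle identity also makes kernel
terms with disjoint indices uncorrelated under random permutation of any distinct points
(`sum_perm_quadTerm_mul`). So the permutation second moment and the sampling variance are both at
most `4 / m + 4 / n`, whatever the laws, and two Chebyshev bounds give the explicit power bound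
`one_le_permTestPower_UCvM_add`.

Energy test. Let `G_N` be uniform on a unit ball at a huge distance `R_N`. After division by `R_N`,
the pooled sample looks like a two-point configuration that records only which observations are
contaminated. The energy of such a configuration takes values in a lattice, so for large `R_N` the
rank of the statistic among its permutations is governed by these indicators
(`pairEnergy_le_of_lt`). The indicators are i.i.d. Bernoulli with the same parameter in both
samples, hence exchangeable, and a rank test on them has level `α` up to ties
(`card_filter_rank_le`). Ties are negligible: the two-point energy is quadratic in the number of
contaminated points in the first sample, and this number is hypergeometric under permutation, with
atoms tending to zero (`permLevel_anticoncentration`). -/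

/-! ### A rotation invariant random direction and the angle formula -/

/-- The uniform distribution on the unit ball. -/
noncomputable def ballProb (d : ℕ) : Measure (EuclideanSpace ℝ (Fin d)) :=
  (volume (Metric.ball (0 : EuclideanSpace ℝ (Fin d)) 1))⁻¹ •
    volume.restrict (Metric.ball (0 : EuclideanSpace ℝ (Fin d)) 1)

instance (d : ℕ) : IsProbabilityMeasure (ballProb d) := by
  constructor
  rw [ballProb, Measure.smul_apply, Measure.restrict_apply_univ, smul_eq_mul]
  exact ENNReal.inv_mul_cancel (Metric.measure_ball_pos _ _ one_pos).ne' measure_ball_lt_top.ne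

theorem ballProb_absolutelyContinuous (d : ℕ) : ballProb d ≪ volume :=
  (Measure.smul_absolutelyContinuous).trans Measure.restrict_le_self.absolutelyContinuous

theorem measurePreserving_ballProb {d : ℕ}
    (L : EuclideanSpace ℝ (Fin d) ≃ₗᵢ[ℝ] EuclideanSpace ℝ (Fin d)) :
    MeasurePreserving L (ballProb d) (ballProb d) := by
  have h := (L.measurePreserving).restrict_preimage
    (s := Metric.ball (0 : EuclideanSpace ℝ (Fin d)) 1) Metric.isOpen_ball.measurableSet
  have hpre : L ⁻¹' Metric.ball (0 : EuclideanSpace ℝ (Fin d)) 1 = Metric.ball 0 1 := by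
    ext x; simp
  rw [hpre] at h
  exact h.smul_measure _

theorem volume_inner_eq {d : ℕ} {u : EuclideanSpace ℝ (Fin d)} (hu : u ≠ 0) (t : ℝ) :
    volume {x : EuclideanSpace ℝ (Fin d) | inner ℝ u x = t} = 0 := by
  have huu : inner ℝ u u ≠ 0 := inner_self_ne_zero.mpr hu
  let A : AffineSubspace ℝ (EuclideanSpace ℝ (Fin d)) :=
    AffineSubspace.mk' (((inner ℝ u u)⁻¹ * t) • u) (ℝ ∙ u)ᗮ
  have hA : (A : Set (EuclideanSpace ℝ (Fin d))) = {x | inner ℝ u x = t} := by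
    ext x
    simp only [A, SetLike.mem_coe, AffineSubspace.mem_mk', vsub_eq_sub, Set.mem_ofPred_eq,
      Submodule.mem_orthogonal_singleton_iff_inner_right, inner_sub_right, inner_smul_right]
    field_simp
    rw [sub_eq_zero]
  rw [← hA]
  refine Measure.addHaar_affineSubspace _ _ fun h => ?_
  have h1 : ∀ x : EuclideanSpace ℝ (Fin d), inner ℝ u x = t := fun x => by
    have : x ∈ (A : Set (EuclideanSpace ℝ (Fin d))) := by rw [h]; trivial
    rwa [hA] at this
  have h0 := h1 0
  rw [inner_zero_right] at h0
  exact huu (by rw [h1 u, h0])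

theorem ballProb_inner_eq_zero {d : ℕ} {u : EuclideanSpace ℝ (Fin d)} (hu : u ≠ 0) :
    ballProb d {β | inner ℝ β u = 0} = 0 := by
  refine ballProb_absolutelyContinuous d ?_
  simp_rw [real_inner_comm u]
  exact volume_inner_eq hu 0

/-- The probability that the hyperplane orthogonal to a random direction separates `u` from `v`. -/
noncomputable def sepProb {d : ℕ} (u v : EuclideanSpace ℝ (Fin d)) : ℝ :=
  (ballProb d).real {β | inner ℝ β u * inner ℝ β v < 0}

theorem measurableSet_sep {d : ℕ} (u v : EuclideanSpace ℝ (Fin d)) :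
    MeasurableSet {β : EuclideanSpace ℝ (Fin d) | inner ℝ β u * inner ℝ β v < 0} :=
  measurableSet_lt (by fun_prop) measurable_const

theorem sepProb_isometry {d : ℕ}
    (L : EuclideanSpace ℝ (Fin d) ≃ₗᵢ[ℝ] EuclideanSpace ℝ (Fin d))
    (u v : EuclideanSpace ℝ (Fin d)) : sepProb (L u) (L v) = sepProb u v := by
  unfold sepProb
  rw [← (measurePreserving_ballProb L).measureReal_preimage
    (measurableSet_sep _ _).nullMeasurableSet]
  congr 1
  ext β
  simp [LinearIsometryEquiv.inner_map_map]

/-- The separation probability depends only on the Gram matrix: a pair of vectors is carried to any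
pair with the same Gram matrix by two reflections. The first sends `a` to `a'`; the second sends the
image of `b` to `b'` and fixes `a'`, because equal inner products make `a'` orthogonal to the axis
of reflection. -/
theorem sepProb_congr {d : ℕ} {a b a' b' : EuclideanSpace ℝ (Fin d)} (ha : ‖a‖ = ‖a'‖)
    (hb : ‖b‖ = ‖b'‖) (hab : inner ℝ a b = inner ℝ a' b') : sepProb a b = sepProb a' b' := by
  let L := (ℝ ∙ (a - a'))ᗮ.reflection
  have hL : L a = a' := Submodule.reflection_sub ha
  let M := (ℝ ∙ (L b - b'))ᗮ.reflection
  have hM : M (L b) = b' := Submodule.reflection_sub (by rw [LinearIsometryEquiv.norm_map, hb])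
  have hMa : M a' = a' := by
    refine Submodule.reflection_mem_subspace_eq_self ?_
    rw [Submodule.mem_orthogonal_singleton_iff_inner_left, inner_sub_right, ← hab, ← hL,
      LinearIsometryEquiv.inner_map_map, sub_self]
  rw [← sepProb_isometry L, hL, ← sepProb_isometry M, hMa, hM]

theorem sepProb_smul {d : ℕ} (a b : EuclideanSpace ℝ (Fin d)) {r s : ℝ} (hr : 0 < r)
    (hs : 0 < s) : sepProb (r • a) (s • b) = sepProb a b := by
  unfold sepProb
  congr 1
  ext β
  simp only [inner_smul_right, Set.mem_ofPred_eq]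
  rw [show r * inner ℝ β a * (s * inner ℝ β b) = (r * s) * (inner ℝ β a * inner ℝ β b) by ring]
  have := mul_pos hr hs
  exact ⟨fun h => by by_contra h'; push Not at h'; nlinarith [mul_nonneg this.le h'],
    fun h => mul_neg_of_pos_of_neg this h⟩

theorem ae_inner_ne_zero {d : ℕ} {u : EuclideanSpace ℝ (Fin d)} (hu : u ≠ 0) :
    ∀ᵐ β ∂(ballProb d), inner ℝ β u ≠ 0 := by
  have := ballProb_inner_eq_zero hu
  rw [ae_iff]
  simpa using this

theorem sepProb_self_neg {d : ℕ} {u : EuclideanSpace ℝ (Fin d)} (hu : u ≠ 0) :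
    sepProb u (-u) = 1 := by
  unfold sepProb
  rw [show (1 : ℝ) = (ballProb d).real Set.univ by simp]
  refine measureReal_congr ?_
  filter_upwards [ae_inner_ne_zero hu] with β hβ
  refine propext ⟨fun _ => trivial, fun _ => ?_⟩
  change inner ℝ β u * inner ℝ β (-u) < 0
  rw [inner_neg_right]
  nlinarith [mul_self_pos.mpr hβ]

/-- The hypothesis says that `b` lies between `a` and `c`. A hyperplane in general position
separating `a` from `c` must then separate `b` from exactly one of them. -/
theorem sepProb_add {d : ℕ} {a b c : EuclideanSpace ℝ (Fin d)} (ha : a ≠ 0) (hb : b ≠ 0)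
    (hc : c ≠ 0) (h : ∀ β : EuclideanSpace ℝ (Fin d), 0 < inner ℝ β a → 0 < inner ℝ β c →
      0 < inner ℝ β b) : sepProb a c = sepProb a b + sepProb b c := by
  unfold sepProb
  rw [← measureReal_union _ (measurableSet_sep _ _)]
  · refine measureReal_congr ?_
    filter_upwards [ae_inner_ne_zero ha, ae_inner_ne_zero hb, ae_inner_ne_zero hc]
      with β h1 h2 h3
    have hp := h β
    have hn := h (-β)
    simp only [inner_neg_left] at hn
    refine propext ?_
    change inner ℝ β a * inner ℝ β c < 0 ↔
      (inner ℝ β a * inner ℝ β b < 0 ∨ inner ℝ β b * inner ℝ β c < 0)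
    simp only [mul_neg_iff]
    rcases lt_or_gt_of_ne h1 with h1 | h1 <;> rcases lt_or_gt_of_ne h2 with h2 | h2 <;>
      rcases lt_or_gt_of_ne h3 with h3 | h3 <;>
      simp_all [not_lt_of_gt]
  · rw [Set.disjoint_left]
    rintro β (h1 : inner ℝ β a * inner ℝ β b < 0) (h2 : inner ℝ β b * inner ℝ β c < 0)
    have hp := h β
    have hn := h (-β)
    simp only [inner_neg_left] at hn
    rcases mul_neg_iff.mp h1 with ⟨h3, h4⟩ | ⟨h3, h4⟩ <;>
      rcases mul_neg_iff.mp h2 with ⟨h5, h6⟩ | ⟨h5, h6⟩ <;> try linarith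
    · linarith [hp h3 h6]
    · linarith [hn (by linarith) (by linarith)]

/-- A nonnegative additive function on `[0, π]` is linear. -/
theorem additive_on_Icc_linear {φ : ℝ → ℝ} {T : ℝ} (hT : 0 < T) (h0 : ∀ s, 0 ≤ φ s)
    (hadd : ∀ s t, 0 ≤ s → 0 ≤ t → s + t ≤ T → φ (s + t) = φ s + φ t) {x : ℝ} (hx0 : 0 ≤ x)
    (hxT : x ≤ T) : φ x = φ T * (x / T) := by
  -- Nonnegativity and additivity give monotonicity, which replaces continuity in Cauchy's
  -- functional equation.
  have hmono : ∀ s t, 0 ≤ s → s ≤ t → t ≤ T → φ s ≤ φ t := by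
    intro s t hs hst ht
    have := hadd s (t - s) hs (by linarith) (by linarith)
    rw [add_sub_cancel] at this
    linarith [h0 (t - s)]
  have hmul : ∀ (k : ℕ) (s : ℝ), 0 ≤ s → k * s ≤ T → φ (k * s) = k * φ s := by
    intro k s hs
    induction k with
    | zero =>
      intro _
      have := hadd 0 0 le_rfl le_rfl (by linarith)
      simp only [add_zero] at this
      simp only [Nat.cast_zero, zero_mul]
      linarith
    | succ k ih =>
      intro hk
      push_cast at hk ⊢
      rw [show ((k : ℝ) + 1) * s = k * s + s by ring] at hk ⊢
      rw [hadd _ _ (by positivity) hs hk, ih (by linarith)]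
      ring
  -- Squeeze `x` between neighbouring multiples of `T / n`, on which `φ` is known; the error is one
  -- grid step of `φ`.
  have key : ∀ n : ℕ, 0 < n → |φ x - φ T * (x / T)| ≤ φ T * (1 / n) := by
    intro n hn
    have hn' : (0 : ℝ) < n := by exact_mod_cast hn
    have hunit : φ (T / n) = φ T / n := by
      have := hmul n (T / n) (by positivity) (by rw [mul_div_cancel₀ _ hn'.ne'])
      rw [mul_div_cancel₀ _ hn'.ne'] at this
      rw [this]; field_simp
    have hfl := Nat.floor_le (show 0 ≤ x * n / T by positivity)
    have hfl2 := Nat.lt_floor_add_one (x * n / T)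
    set k := ⌊x * n / T⌋₊
    have hlow : k * (T / n) ≤ x := by
      rw [le_div_iff₀ hT] at hfl
      rw [mul_div_assoc', div_le_iff₀ hn']; exact hfl
    have hup : x < (k + 1) * (T / n) := by
      rw [div_lt_iff₀ hT] at hfl2
      rw [mul_div_assoc', lt_div_iff₀ hn']; exact hfl2
    have hlo := hmono _ _ (by positivity) hlow hxT
    rw [hmul k _ (by positivity) (hlow.trans hxT), hunit] at hlo
    have hhi : φ x ≤ (k + 1) * (φ T / n) := by
      by_cases hk : ((k + 1 : ℕ) : ℝ) * (T / n) ≤ T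
      · have := hmono x _ hx0 (by push_cast; exact hup.le) hk
        rw [hmul _ _ (by positivity) hk, hunit] at this
        push_cast at this; exact this
      · push_cast at hk
        have h1 : (n : ℝ) ≤ k + 1 := by
          rw [not_le, mul_div_assoc', lt_div_iff₀ hn', mul_comm] at hk
          exact (lt_of_mul_lt_mul_right hk hT.le).le
        calc φ x ≤ φ T := hmono _ _ hx0 hxT le_rfl
          _ = n * (φ T / n) := by field_simp
          _ ≤ _ := by
            have := h0 T
            gcongr
    have e1 : φ T * (x / T) ≥ k * (φ T / n) := by
      have : (k : ℝ) / n ≤ x / T := by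
        rw [div_le_div_iff₀ hn' hT]; rw [le_div_iff₀ hT] at hfl; exact hfl
      calc k * (φ T / n) = φ T * (k / n) := by ring
        _ ≤ _ := by gcongr; exact h0 T
    have e2 : φ T * (x / T) ≤ (k + 1) * (φ T / n) := by
      have : x / T ≤ ((k : ℝ) + 1) / n := by
        rw [div_le_div_iff₀ hT hn']; rw [div_lt_iff₀ hT] at hfl2; exact hfl2.le
      calc φ T * (x / T) ≤ φ T * ((k + 1) / n) := by gcongr; exact h0 T
        _ = _ := by ring
    have e3 : (k + 1) * (φ T / n) = k * (φ T / n) + φ T * (1 / n) := by ring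
    rw [abs_le]; constructor <;> linarith
  have hlim : Tendsto (fun n : ℕ => φ T * (1 / (n : ℝ))) atTop (𝓝 (φ T * 0)) :=
    tendsto_one_div_atTop_nhds_zero_nat.const_mul _
  rw [mul_zero] at hlim
  have : |φ x - φ T * (x / T)| ≤ 0 :=
    ge_of_tendsto hlim (eventually_atTop.mpr ⟨1, fun n hn => key n hn⟩)
  linarith [abs_nonpos_iff.mp this]

-- Along a unit circle arc `w` from `u` towards `v`, the probability of separating `w 0` from `w t`
-- is additive in `t` on `[0, π]` by rotation invariance, and equals 1 at `π`. It is therefore `t /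
-- π`.
open InnerProductGeometry in
theorem sepProb_eq_angle {d : ℕ} {u v : EuclideanSpace ℝ (Fin d)} (hu : u ≠ 0) (hv : v ≠ 0) :
    sepProb u v = angle u v / Real.pi := by
  have hpi := Real.pi_pos
  by_cases h0 : angle u v = 0
  · obtain ⟨-, r, hr, rfl⟩ := angle_eq_zero_iff.mp h0
    rw [h0, zero_div]
    unfold sepProb
    convert measureReal_empty (μ := ballProb d)
    ext β
    simp only [inner_smul_right, Set.mem_ofPred_eq, Set.mem_empty_iff_false, iff_false, not_lt]
    rw [mul_left_comm]
    exact mul_nonneg hr.le (mul_self_nonneg _)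
  by_cases h1 : angle u v = Real.pi
  · obtain ⟨-, r, hr, rfl⟩ := angle_eq_pi_iff.mp h1
    rw [h1, div_self hpi.ne', ← sepProb_self_neg hu, ← sepProb_smul u (-u) one_pos (neg_pos.mpr hr)]
    simp
  have hs : 0 < Real.sin (angle u v) :=
    Real.sin_pos_of_pos_of_lt_pi (lt_of_le_of_ne (angle_nonneg u v) (Ne.symm h0))
      (lt_of_le_of_ne (angle_le_pi u v) h1)
  set θ := angle u v with hθ
  have hun : 0 < ‖u‖ := norm_pos_iff.mpr hu
  have hvn : 0 < ‖v‖ := norm_pos_iff.mpr hv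
  set e₁ : EuclideanSpace ℝ (Fin d) := ‖u‖⁻¹ • u with he₁
  set v' : EuclideanSpace ℝ (Fin d) := ‖v‖⁻¹ • v with hv'
  have huv : inner ℝ u v = Real.cos θ * (‖u‖ * ‖v‖) := (cos_angle_mul_norm_mul_norm u v).symm
  have n1 : inner ℝ e₁ e₁ = (1 : ℝ) := by
    rw [he₁, inner_smul_left, inner_smul_right, real_inner_self_eq_norm_sq]
    simp; field_simp
  have n2 : inner ℝ v' v' = (1 : ℝ) := by
    rw [hv', inner_smul_left, inner_smul_right, real_inner_self_eq_norm_sq]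
    simp; field_simp
  have n3 : inner ℝ e₁ v' = Real.cos θ := by
    rw [he₁, hv', inner_smul_left, inner_smul_right, huv]
    simp; field_simp
  clear_value e₁ v' θ
  -- Gram–Schmidt in the plane of `u` and `v`; the excluded angles 0 and π are those where the sine
  -- vanishes.
  set e₂ : EuclideanSpace ℝ (Fin d) := (Real.sin θ)⁻¹ • (v' - Real.cos θ • e₁) with he₂
  have o1 : inner ℝ e₁ e₂ = (0 : ℝ) := by
    rw [he₂, inner_smul_right, inner_sub_right, inner_smul_right, n1, n3]; ring
  have o2 : inner ℝ e₂ e₂ = (1 : ℝ) := by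
    rw [he₂, inner_smul_right, inner_smul_left, inner_sub_left, inner_sub_right, inner_sub_right,
      inner_smul_right, inner_smul_left, inner_smul_left, inner_smul_right, n1, n2, n3,
      real_inner_comm, n3]
    simp only [conj_trivial]
    field_simp
    nlinarith [Real.sin_sq_add_cos_sq θ]
  clear_value e₂
  have o3 : inner ℝ e₂ e₁ = (0 : ℝ) := by rw [real_inner_comm, o1]
  let w : ℝ → EuclideanSpace ℝ (Fin d) := fun t => Real.cos t • e₁ + Real.sin t • e₂
  have hw : ∀ s t, inner ℝ (w s) (w t) = Real.cos (t - s) := by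
    intro s t
    simp only [w, inner_add_left, inner_add_right, inner_smul_left, inner_smul_right, n1, o1, o2,
      o3, conj_trivial, Real.cos_sub]
    ring
  have hwn : ∀ s, ‖w s‖ = 1 := by
    intro s
    have := hw s s
    rw [sub_self, Real.cos_zero, real_inner_self_eq_norm_sq] at this
    nlinarith [norm_nonneg (w s)]
  have hw0 : ∀ s, w s ≠ 0 := fun s h => by
    have := hwn s; rw [h, norm_zero] at this; exact zero_ne_one this
  have hwπ : w Real.pi = - w 0 := by simp [w]
  have hrot : ∀ s t, sepProb (w s) (w t) = sepProb (w 0) (w (t - s)) := fun s t =>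
    sepProb_congr (by rw [hwn, hwn]) (by rw [hwn, hwn]) (by rw [hw, hw, sub_zero])
  have hmain := additive_on_Icc_linear (φ := fun t => sepProb (w 0) (w t)) hpi
    (fun s => measureReal_nonneg) (by
      intro s t hs ht hst
      have e : sepProb (w 0) (w t) = sepProb (w s) (w (s + t)) := by
        rw [hrot s (s + t), add_sub_cancel_left]
      rw [e]
      refine sepProb_add (hw0 _) (hw0 _) (hw0 _) fun β h1 h2 => ?_
      -- The law of sines places `w s` in the cone spanned by `w 0` and `w (s + t)`, as
      -- `sepProb_add` requires.
      have hlin : Real.sin (s + t) • w s = Real.sin t • w 0 + Real.sin s • w (s + t) := by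
        simp only [w, Real.cos_zero, Real.sin_zero, Real.sin_add, Real.cos_add]
        match_scalars
        · have := Real.sin_sq_add_cos_sq s
          linear_combination (Real.sin t) * this
        · ring
      rcases hst.lt_or_eq with hlt | heq
      · have hss : 0 ≤ Real.sin s := Real.sin_nonneg_of_nonneg_of_le_pi hs (by linarith)
        have hst' : 0 ≤ Real.sin t := Real.sin_nonneg_of_nonneg_of_le_pi ht (by linarith)
        rcases hs.eq_or_lt with rfl | hs'
        · exact h1
        have hsum : 0 < Real.sin (s + t) := Real.sin_pos_of_pos_of_lt_pi (by linarith) hlt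
        have hsp : 0 < Real.sin s := Real.sin_pos_of_pos_of_lt_pi hs' (by linarith)
        have hi := congrArg (fun x => inner ℝ β x) hlin
        simp only [inner_add_right, inner_smul_right] at hi
        by_contra hneg
        push Not at hneg
        nlinarith [mul_nonneg hst' h1.le, mul_pos hsp h2, mul_nonneg hsum.le (neg_nonneg.mpr hneg)]
      -- For `s + t = π` the endpoints are antipodal and no open half-space contains both.
      · rw [heq, hwπ, inner_neg_right] at h2
        linarith) (angle_nonneg u v) (angle_le_pi u v)
  have hπ1 : sepProb (w 0) (w Real.pi) = 1 := by rw [hwπ]; exact sepProb_self_neg (hw0 0)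
  simp only [hπ1, one_mul] at hmain
  rw [← hθ] at hmain
  rw [← hmain]
  have hw0e : w 0 = ‖u‖⁻¹ • u := by simp [w, he₁]
  have hwθ : w θ = ‖v‖⁻¹ • v := by
    simp only [w, he₂]
    rw [← hv', smul_smul, mul_inv_cancel₀ hs.ne', one_smul]
    abel
  rw [hw0e, hwθ, sepProb_smul u v (inv_pos.mpr hun) (inv_pos.mpr hvn)]

open InnerProductGeometry in
/-- A random half-space contains both of two nonzero vectors with probability
`1 / 2 - angle u v / (2 π)`. -/
theorem ballProb_halfspaces {d : ℕ} {u v : EuclideanSpace ℝ (Fin d)} (hu : u ≠ 0) (hv : v ≠ 0) :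
    (ballProb d).real {β | inner ℝ β u ≤ 0 ∧ inner ℝ β v ≤ 0} =
      1 / 2 - 1 / (2 * Real.pi) * angle u v := by
  set A := {β : EuclideanSpace ℝ (Fin d) | inner ℝ β u ≤ 0 ∧ inner ℝ β v ≤ 0} with hA
  have hAm : MeasurableSet A :=
    (measurableSet_le (f := fun β : EuclideanSpace ℝ (Fin d) => inner ℝ β u) (by fun_prop)
      measurable_const).inter (measurableSet_le (f := fun β : EuclideanSpace ℝ (Fin d) =>
        inner ℝ β v) (by fun_prop) measurable_const)
  have hneg : (ballProb d).real ((LinearIsometryEquiv.neg ℝ) ⁻¹' A) = (ballProb d).real A :=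
    (measurePreserving_ballProb (LinearIsometryEquiv.neg ℝ)).measureReal_preimage
      hAm.nullMeasurableSet
  have hcompl := measureReal_compl (μ := ballProb d) (measurableSet_sep u v)
  -- If `u` and `v` are not separated, then `β` or `-β` lies in `A`. The two events have equal
  -- probability and overlap only where `β` is orthogonal to `u` (and `v`), a null set.
  have hunion : (ballProb d).real {β | inner ℝ β u * inner ℝ β v < 0}ᶜ =
      (ballProb d).real ((LinearIsometryEquiv.neg ℝ) ⁻¹' A) + (ballProb d).real A := by
    rw [← measureReal_union₀ hAm.nullMeasurableSet]
    · refine congrArg _ ?_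
      ext β
      simp only [hA, Set.mem_compl_iff, Set.mem_ofPred_eq, not_lt, Set.mem_union, Set.mem_preimage,
        LinearIsometryEquiv.coe_neg, inner_neg_left, Left.neg_nonpos_iff]
      exact mul_nonneg_iff
    · refine measure_mono_null (fun β hβ => ?_) (ballProb_inner_eq_zero hu)
      simp only [hA, Set.mem_inter_iff, Set.mem_preimage, Set.mem_ofPred_eq,
        LinearIsometryEquiv.coe_neg, inner_neg_left, Left.neg_nonpos_iff] at hβ
      exact le_antisymm hβ.2.1 hβ.1.1
  have hsep := sepProb_eq_angle hu hv
  unfold sepProb at hsep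
  rw [hunion, hneg, hsep, probReal_univ] at hcompl
  have : 1 / (2 * Real.pi) * angle u v = angle u v / Real.pi / 2 := by
    field_simp
  rw [this]
  linarith

/-! ### The population Cramér-von Mises discrepancy -/

/-- Euclidean space of dimension `d`. -/
abbrev Eucl (d : ℕ) : Type := EuclideanSpace ℝ (Fin d)

section Mean

theorem ae_fst_ne_snd {d : ℕ} (μ₁ μ₂ : Measure (Eucl d)) [SFinite μ₂]
    [NullSingletonClass μ₂] : ∀ᵐ q ∂(μ₁.prod μ₂), q.1 ≠ q.2 := by
  rw [Measure.ae_prod_iff_ae_ae]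
  · exact ae_of_all _ fun x => by rw [ae_iff]; simp
  · exact (measurableSet_eq_fun measurable_fst measurable_snd).compl

variable {d : ℕ}

/-- The centred angle kernel at the vertex `c`. -/
noncomputable def angKer (c a b : Eucl d) : ℝ :=
  1 / 6 - 1 / (2 * Real.pi) * InnerProductGeometry.angle (a - c) (b - c)

theorem hCvM_eq (x₁ x₂ y₁ y₂ : Eucl d) :
    hCvM x₁ x₂ y₁ y₂ = angKer y₁ x₁ x₂ + angKer x₁ y₁ y₂ := by
  simp only [hCvM, angKer]; ring

theorem angKer_comm (c a b : Eucl d) : angKer c a b = angKer c b a := by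
  simp only [angKer, InnerProductGeometry.angle_comm]

theorem angKer_mem (c a b : Eucl d) : -(1 / 3) ≤ angKer c a b ∧
    angKer c a b ≤ 1 / 6 := by
  have h0 := InnerProductGeometry.angle_nonneg (a - c) (b - c)
  have h1 := InnerProductGeometry.angle_le_pi (a - c) (b - c)
  have hpi := Real.pi_pos
  have h2 : 1 / (2 * Real.pi) * InnerProductGeometry.angle (a - c) (b - c) ≤ 1 / 2 := by
    rw [one_div, inv_mul_le_iff₀ (by positivity)]; linarith
  have h3 : 0 ≤ 1 / (2 * Real.pi) * InnerProductGeometry.angle (a - c) (b - c) := by positivity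
  unfold angKer
  constructor <;> linarith

theorem abs_angKer_le (c a b : Eucl d) : |angKer c a b| ≤ 1 / 3 := by
  have := angKer_mem c a b
  rw [abs_le]; constructor <;> linarith

theorem measurable_angKer : Measurable fun p : (Eucl d) × (Eucl d) × (Eucl d) =>
    angKer p.1 p.2.1 p.2.2 := by
  unfold angKer InnerProductGeometry.angle
  have : Measurable fun p : (Eucl d) × (Eucl d) × (Eucl d) =>
      inner ℝ (p.2.1 - p.1) (p.2.2 - p.1) / (‖p.2.1 - p.1‖ * ‖p.2.2 - p.1‖) := by
    fun_prop
  exact ((Real.continuous_arccos.measurable.comp this).const_mul _).const_sub _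

theorem integrable_angKer (μ : Measure ((Eucl d) × (Eucl d) × (Eucl d))) [IsFiniteMeasure μ] :
    Integrable (fun p : (Eucl d) × (Eucl d) × (Eucl d) => angKer p.1 p.2.1 p.2.2) μ :=
  Integrable.of_bound measurable_angKer.aestronglyMeasurable (1 / 3)
    (ae_of_all _ fun _ => abs_angKer_le _ _ _)

/-- The angles of a triangle add up to `π`. -/
theorem angKer_cyclic {a b c : Eucl d} (hab : a ≠ b) : angKer c a b + angKer a b c + angKer b c a = 0 := by
  -- Degenerate triangles with `c = a` or `c = b` are covered: an angle with the zero vector is π/2,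
  -- so the sum is still π. Only `a ≠ b` matters.
  have h := EuclideanGeometry.angle_add_angle_add_angle_eq_pi c hab.symm
  simp only [EuclideanGeometry.angle, vsub_eq_sub] at h
  have hpi := Real.pi_pos
  rw [InnerProductGeometry.angle_comm (c - a), InnerProductGeometry.angle_comm (a - b),
    InnerProductGeometry.angle_comm (b - c)] at h
  unfold angKer
  field_simp
  linarith

/-- The mean of the angle kernel with vertex distributed as `μ₃`. -/
noncomputable def meanKer (μ₁ μ₂ μ₃ : Measure (Eucl d)) : ℝ :=
  ∫ p, angKer p.1 p.2.1 p.2.2 ∂(μ₃.prod (μ₁.prod μ₂))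

variable (μ₁ μ₂ μ₃ : Measure (Eucl d)) [IsProbabilityMeasure μ₁]
  [IsProbabilityMeasure μ₂] [IsProbabilityMeasure μ₃]

theorem meanKer_comm : meanKer μ₁ μ₂ μ₃ = meanKer μ₂ μ₁ μ₃ := by
  unfold meanKer
  have h : MeasurePreserving (Prod.map id Prod.swap) (μ₃.prod (μ₂.prod μ₁))
      (μ₃.prod (μ₁.prod μ₂)) :=
    (MeasurePreserving.id μ₃).prod (Measure.measurePreserving_swap)
  rw [← h.map_eq, integral_map h.measurable.aemeasurable
    measurable_angKer.aestronglyMeasurable]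
  refine integral_congr_ae (ae_of_all _ fun p => ?_)
  exact angKer_comm _ _ _

theorem measurePreserving_rotate : MeasurePreserving
    (fun p : (Eucl d) × (Eucl d) × (Eucl d) => (p.2.1, p.2.2, p.1)) (μ₃.prod (μ₁.prod μ₂))
      (μ₁.prod (μ₂.prod μ₃)) :=
  (measurePreserving_prodAssoc μ₁ μ₂ μ₃).comp Measure.measurePreserving_swap

theorem meanKer_rotate : meanKer μ₂ μ₃ μ₁ =
    ∫ p, angKer p.2.1 p.2.2 p.1 ∂(μ₃.prod (μ₁.prod μ₂)) := by
  unfold meanKer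
  have h := measurePreserving_rotate μ₁ μ₂ μ₃
  rw [← h.map_eq, integral_map h.measurable.aemeasurable
    measurable_angKer.aestronglyMeasurable]

theorem meanKer_rotate' : meanKer μ₃ μ₁ μ₂ =
    ∫ p, angKer p.2.2 p.1 p.2.1 ∂(μ₃.prod (μ₁.prod μ₂)) := by
  rw [meanKer_rotate μ₂ μ₃ μ₁]
  have h := measurePreserving_rotate μ₁ μ₂ μ₃
  rw [← h.map_eq, integral_map h.measurable.aemeasurable]
  exact (measurable_angKer.comp (g := fun p : (Eucl d) × (Eucl d) × (Eucl d) =>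
    angKer p.1 p.2.1 p.2.2) (f := fun p : (Eucl d) × (Eucl d) × (Eucl d) => (p.2.1, p.2.2, p.1))
    (by fun_prop)).aestronglyMeasurable

theorem meanKer_cyclic [NullSingletonClass μ₂] :
    meanKer μ₁ μ₂ μ₃ + meanKer μ₂ μ₃ μ₁ + meanKer μ₃ μ₁ μ₂ = 0 := by
  rw [meanKer_rotate μ₁ μ₂ μ₃, meanKer_rotate' μ₁ μ₂ μ₃, meanKer]
  have hm1 : Measurable fun p : (Eucl d) × (Eucl d) × (Eucl d) => angKer p.2.1 p.2.2 p.1 :=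
    measurable_angKer.comp (f := fun p : (Eucl d) × (Eucl d) × (Eucl d) => (p.2.1, p.2.2, p.1))
      (by fun_prop)
  have hm2 : Measurable fun p : (Eucl d) × (Eucl d) × (Eucl d) => angKer p.2.2 p.1 p.2.1 :=
    measurable_angKer.comp (f := fun p : (Eucl d) × (Eucl d) × (Eucl d) => (p.2.2, p.1, p.2.1))
      (by fun_prop)
  have i1 : Integrable (fun p : (Eucl d) × (Eucl d) × (Eucl d) => angKer p.2.1 p.2.2 p.1)
      (μ₃.prod (μ₁.prod μ₂)) := Integrable.of_bound hm1.aestronglyMeasurable (1 / 3)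
    (ae_of_all _ fun _ => abs_angKer_le _ _ _)
  have i2 : Integrable (fun p : (Eucl d) × (Eucl d) × (Eucl d) => angKer p.2.2 p.1 p.2.1)
      (μ₃.prod (μ₁.prod μ₂)) := Integrable.of_bound hm2.aestronglyMeasurable (1 / 3)
    (ae_of_all _ fun _ => abs_angKer_le _ _ _)
  have i0 := integrable_angKer (μ₃.prod (μ₁.prod μ₂))
  have i01 : Integrable (fun p : (Eucl d) × (Eucl d) × (Eucl d) =>
    angKer p.1 p.2.1 p.2.2 + angKer p.2.1 p.2.2 p.1) (μ₃.prod (μ₁.prod μ₂)) := i0.add i1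
  rw [← integral_add i0 i1, ← integral_add i01 i2]
  refine integral_eq_zero_of_ae ?_
  filter_upwards [Measure.quasiMeasurePreserving_snd.ae (ae_fst_ne_snd μ₁ μ₂)] with p hp
  exact angKer_cyclic hp

/-- The distribution function of the projection on `β`, evaluated at the projection of `c`. -/
noncomputable def projCdf (μ : Measure (Eucl d))
    (β c : Eucl d) : ℝ :=
  μ.real {a | inner ℝ β a ≤ inner ℝ β c}

theorem measurable_projCdf : Measurable fun p : (Eucl d) × (Eucl d) => projCdf μ₁ p.1 p.2 := by
  unfold projCdf
  have hs : MeasurableSet {q : ((Eucl d) × (Eucl d)) × (Eucl d) | inner ℝ q.1.1 q.2 ≤ inner ℝ q.1.1 q.1.2} :=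
    measurableSet_le (by fun_prop) (by fun_prop)
  exact (measurable_measure_prodMk_left hs).ennreal_toReal

theorem projCdf_mem (β c : Eucl d) : 0 ≤ projCdf μ₁ β c ∧ projCdf μ₁ β c ≤ 1 :=
  ⟨measureReal_nonneg, measureReal_le_one⟩

theorem integrable_projCdf_mul (μ : Measure ((Eucl d) × (Eucl d))) [IsFiniteMeasure μ] :
    Integrable (fun p : (Eucl d) × (Eucl d) => projCdf μ₁ p.2 p.1 * projCdf μ₂ p.2 p.1) μ := by
  refine Integrable.of_bound (C := 1) ?_ (ae_of_all _ fun p => ?_)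
  · exact (((measurable_projCdf μ₁).comp measurable_swap).mul
      ((measurable_projCdf μ₂).comp measurable_swap)).aestronglyMeasurable
  · have h1 := projCdf_mem μ₁ p.2 p.1
    have h2 := projCdf_mem μ₂ p.2 p.1
    rw [Real.norm_eq_abs, abs_of_nonneg (mul_nonneg h1.1 h2.1)]
    exact mul_le_one₀ h1.2 h2.1 h2.2

/-- `angKer c a b + 1 / 3` is the probability that a random direction places both `a` and `b` weakly
below `c`. By Fubini, for fixed `β` the two events are independent, which yields the product of
distribution functions. -/
theorem integral_angKer_vertex [NullSingletonClass μ₁] [NullSingletonClass μ₂] (c : Eucl d) :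
    ∫ q, (angKer c q.1 q.2 + 1 / 3) ∂(μ₁.prod μ₂) =
      ∫ β, projCdf μ₁ β c * projCdf μ₂ β c ∂(ballProb d) := by
  let I : (Eucl d) → (Eucl d) → ℝ := fun β a => {a | inner ℝ β a ≤ inner ℝ β c}.indicator 1 a
  have hs : ∀ β : Eucl d, MeasurableSet {a : Eucl d | inner ℝ β a ≤ inner ℝ β c} := fun β =>
    measurableSet_le (by fun_prop) (by fun_prop)
  have hI : ∀ (β : Eucl d) (μ : Measure (Eucl d)), ∫ a, I β a ∂μ = projCdf μ β c := fun β μ =>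
    integral_indicator_one (hs β)
  have hIm : Measurable fun q : (Eucl d) × (Eucl d) => I q.1 q.2 := by
    have : MeasurableSet {q : (Eucl d) × (Eucl d) | inner ℝ q.1 q.2 ≤ inner ℝ q.1 c} :=
      measurableSet_le (by fun_prop) (by fun_prop)
    exact (measurable_one.indicator this : Measurable ({q : (Eucl d) × (Eucl d) |
      inner ℝ q.1 q.2 ≤ inner ℝ q.1 c}.indicator (1 : (Eucl d) × (Eucl d) → ℝ)))
  have hIb : ∀ β a, |I β a| ≤ 1 := fun β a => by
    simp only [I, Set.indicator]; split_ifs <;> simp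
  have hint : Integrable (fun r : (Eucl d) × ((Eucl d) × (Eucl d)) => I r.1 r.2.1 * I r.1 r.2.2)
      ((ballProb d).prod (μ₁.prod μ₂)) := by
    refine Integrable.of_bound (C := 1) ?_ (ae_of_all _ fun p => ?_)
    · exact ((hIm.comp (f := fun r : (Eucl d) × ((Eucl d) × (Eucl d)) => (r.1, r.2.1)) (by fun_prop)).mul
        (hIm.comp (f := fun r : (Eucl d) × ((Eucl d) × (Eucl d)) => (r.1, r.2.2))
        (by fun_prop))).aestronglyMeasurable
    · rw [norm_mul]
      exact mul_le_one₀ (hIb _ _) (norm_nonneg _) (hIb _ _)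
  have hswap := integral_integral_swap (f := fun β (q : (Eucl d) × (Eucl d)) => I β q.1 * I β q.2) hint
  simp_rw [integral_prod_mul, hI] at hswap
  rw [hswap]
  have h1 : ∀ᵐ q ∂(μ₁.prod μ₂), q.1 ≠ c :=
    Measure.quasiMeasurePreserving_fst.ae (p := fun x => x ≠ c) (by rw [ae_iff]; simp)
  have h2 : ∀ᵐ q ∂(μ₁.prod μ₂), q.2 ≠ c :=
    Measure.quasiMeasurePreserving_snd.ae (p := fun x => x ≠ c) (by rw [ae_iff]; simp)
  refine integral_congr_ae ?_
  filter_upwards [h1, h2] with q h1 h2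
  have hw := ballProb_halfspaces (sub_ne_zero.mpr h1) (sub_ne_zero.mpr h2)
  have hset : MeasurableSet {β : Eucl d | inner ℝ β (q.1 - c) ≤ 0 ∧ inner ℝ β (q.2 - c) ≤ 0} :=
    (measurableSet_le (f := fun β : Eucl d => inner ℝ β (q.1 - c)) (by fun_prop)
      measurable_const).inter (measurableSet_le (f := fun β : Eucl d =>
        inner ℝ β (q.2 - c)) (by fun_prop) measurable_const)
  rw [← integral_indicator_one hset] at hw
  simp only [angKer]
  rw [show ∀ x : ℝ, 1 / 6 - x + 1 / 3 = 1 / 2 - x by intro x; ring, ← hw]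
  refine integral_congr_ae (ae_of_all _ fun β => ?_)
  simp only [I, Set.indicator, Set.mem_ofPred_eq, inner_sub_right, sub_nonpos, Pi.one_apply]
  split_ifs <;> simp_all

/-- The mean of the angle kernel in terms of projected distribution functions. -/
theorem meanKer_eq [NullSingletonClass μ₁] [NullSingletonClass μ₂] : meanKer μ₁ μ₂ μ₃ + 1 / 3 =
    ∫ p, projCdf μ₁ p.2 p.1 * projCdf μ₂ p.2 p.1 ∂(μ₃.prod (ballProb d)) := by
  rw [integral_prod _ (integrable_projCdf_mul μ₁ μ₂ _)]
  simp_rw [← integral_angKer_vertex μ₁ μ₂]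
  rw [← integral_prod (μ := μ₃) (ν := μ₁.prod μ₂)
    (fun p : (Eucl d) × (Eucl d) × (Eucl d) => angKer p.1 p.2.1 p.2.2 + 1 / 3)
    ((integrable_angKer _).add (integrable_const _)),
    integral_add (integrable_angKer _) (integrable_const _)]
  simp [meanKer]

/-- The squared distance of projected distribution functions, integrated against `μ₃`. -/
noncomputable def sqGap (μ₁ μ₂ μ₃ : Measure (Eucl d)) : ℝ :=
  ∫ p, (projCdf μ₁ p.2 p.1 - projCdf μ₂ p.2 p.1) ^ 2 ∂(μ₃.prod (ballProb d))

theorem integrable_sqGap (μ : Measure ((Eucl d) × (Eucl d))) [IsFiniteMeasure μ] : Integrable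
    (fun p : (Eucl d) × (Eucl d) => (projCdf μ₁ p.2 p.1 - projCdf μ₂ p.2 p.1) ^ 2) μ := by
  have h := ((integrable_projCdf_mul μ₁ μ₁ μ).sub
    ((integrable_projCdf_mul μ₁ μ₂ μ).const_mul 2)).add (integrable_projCdf_mul μ₂ μ₂ μ)
  refine h.congr (ae_of_all _ fun p => ?_)
  simp only [Pi.add_apply, Pi.sub_apply]
  ring

theorem sqGap_eq [NullSingletonClass μ₁] [NullSingletonClass μ₂] :
    sqGap μ₁ μ₂ μ₃ = meanKer μ₁ μ₁ μ₃ - 2 * meanKer μ₁ μ₂ μ₃ + meanKer μ₂ μ₂ μ₃ := by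
  have h1 := meanKer_eq μ₁ μ₁ μ₃
  have h2 := meanKer_eq μ₁ μ₂ μ₃
  have h3 := meanKer_eq μ₂ μ₂ μ₃
  have hi1 := integrable_projCdf_mul μ₁ μ₁ (μ₃.prod (ballProb d))
  have hi2 := integrable_projCdf_mul μ₁ μ₂ (μ₃.prod (ballProb d))
  have hi3 := integrable_projCdf_mul μ₂ μ₂ (μ₃.prod (ballProb d))
  have h := integral_add (hi1.sub (hi2.const_mul 2)) hi3
  simp only [Pi.sub_apply] at h
  rw [integral_sub hi1 (hi2.const_mul 2), integral_const_mul, ← h1, ← h2, ← h3] at h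
  unfold sqGap
  rw [show meanKer μ₁ μ₁ μ₃ - 2 * meanKer μ₁ μ₂ μ₃ + meanKer μ₂ μ₂ μ₃ =
    meanKer μ₁ μ₁ μ₃ + 1 / 3 - 2 * (meanKer μ₁ μ₂ μ₃ + 1 / 3) + (meanKer μ₂ μ₂ μ₃ + 1 / 3) by ring,
    ← h]
  refine integral_congr_ae (ae_of_all _ fun p => ?_)
  ring

/-- The mean of the Cramér-von Mises kernel is a squared distance of projected distribution
functions. -/
theorem meanKer_add_eq_sqGap [NullSingletonClass μ₁] [NullSingletonClass μ₂] :
    meanKer μ₁ μ₁ μ₂ + meanKer μ₂ μ₂ μ₁ = (sqGap μ₁ μ₂ μ₁ + sqGap μ₁ μ₂ μ₂) / 2 := by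
  -- Write `Kabc` for the mean with vertex law `c`. The cyclic identity gives `K111 = K222 = 0`,
  -- `K112 = -2 K121` and `K221 = -2 K122`, so the cross terms of the two squared gaps double `K112`
  -- and `K221`.
  have h1 := meanKer_cyclic μ₁ μ₁ μ₁
  have h2 := meanKer_cyclic μ₂ μ₂ μ₂
  have h3 := meanKer_cyclic μ₁ μ₁ μ₂
  have h4 := meanKer_cyclic μ₁ μ₂ μ₂
  rw [sqGap_eq, sqGap_eq]
  have h5 := meanKer_comm μ₂ μ₁ μ₁
  have h6 := meanKer_comm μ₂ μ₁ μ₂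
  linarith

end Mean

/-! ### Contamination and positivity of the discrepancy -/

section Contamination

variable {d : ℕ}

theorem isProbabilityMeasure_contaminate {ε : ℝ} (hε : ε ∈ Set.Ioo (0 : ℝ) 1)
    (Q G : Measure (Eucl d)) [IsProbabilityMeasure Q] [IsProbabilityMeasure G] :
    IsProbabilityMeasure (contaminate ε Q G) := by
  constructor
  simp only [contaminate, Measure.coe_add, Measure.coe_smul, Pi.add_apply, Pi.smul_apply,
    measure_univ, smul_eq_mul, mul_one]
  rw [← ENNReal.ofReal_add (by linarith [hε.2]) hε.1.le]
  simp

theorem nullSingletonClass_contaminate {ε : ℝ} (Q G : Measure (Eucl d)) [NullSingletonClass Q]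
    [NullSingletonClass G] : NullSingletonClass (contaminate ε Q G) :=
  ⟨fun x => by simp [contaminate]⟩

theorem projCdf_contaminate {ε : ℝ} (hε : ε ∈ Set.Ioo (0 : ℝ) 1)
    (Q G : Measure (Eucl d)) [IsProbabilityMeasure Q] [IsProbabilityMeasure G] (β c : Eucl d) :
    projCdf (contaminate ε Q G) β c = (1 - ε) * projCdf Q β c + ε * projCdf G β c := by
  have h0 : 0 ≤ 1 - ε := by linarith [hε.2]
  simp only [projCdf, contaminate]
  have h1 : (ENNReal.ofReal (1 - ε) • Q) {a | inner ℝ β a ≤ inner ℝ β c} ≠ ∞ :=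
    ENNReal.mul_ne_top ENNReal.ofReal_ne_top (measure_ne_top _ _)
  have h2 : (ENNReal.ofReal ε • G) {a | inner ℝ β a ≤ inner ℝ β c} ≠ ∞ :=
    ENNReal.mul_ne_top ENNReal.ofReal_ne_top (measure_ne_top _ _)
  rw [measureReal_add_apply h1 h2, measureReal_ennreal_smul_apply, measureReal_ennreal_smul_apply,
    ENNReal.toReal_ofReal h0, ENNReal.toReal_ofReal hε.1.le]

/-- The common term `ε G` cancels in the difference of distribution functions, leaving a factor `1 -
ε` before squaring. -/
theorem sqGap_contaminate_left {ε : ℝ} (hε : ε ∈ Set.Ioo (0 : ℝ) 1)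
    (Q₁ Q₂ G μ : Measure (Eucl d)) [IsProbabilityMeasure Q₁] [IsProbabilityMeasure Q₂]
    [IsProbabilityMeasure G] :
    sqGap (contaminate ε Q₁ G) (contaminate ε Q₂ G) μ = (1 - ε) ^ 2 * sqGap Q₁ Q₂ μ := by
  unfold sqGap
  rw [← integral_const_mul]
  refine integral_congr_ae (ae_of_all _ fun p => ?_)
  simp only [projCdf_contaminate hε]
  ring

theorem sqGap_nonneg (μ₁ μ₂ μ₃ : Measure (Eucl d)) : 0 ≤ sqGap μ₁ μ₂ μ₃ :=
  integral_nonneg fun _ => sq_nonneg _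

/-- The gap is linear in the integrating law, and the part integrated against `G` is nonnegative. -/
theorem sqGap_contaminate_right {ε : ℝ} (hε : ε ∈ Set.Ioo (0 : ℝ) 1)
    (Q₁ Q₂ Q G : Measure (Eucl d)) [IsProbabilityMeasure Q₁] [IsProbabilityMeasure Q₂]
    [IsProbabilityMeasure Q] [IsProbabilityMeasure G] :
    (1 - ε) * sqGap Q₁ Q₂ Q ≤ sqGap Q₁ Q₂ (contaminate ε Q G) := by
  have h0 : 0 ≤ 1 - ε := by linarith [hε.2]
  have hi1 := integrable_sqGap Q₁ Q₂ (Q.prod (ballProb d))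
  have hi2 := integrable_sqGap Q₁ Q₂ (G.prod (ballProb d))
  have : sqGap Q₁ Q₂ (contaminate ε Q G) = (1 - ε) * sqGap Q₁ Q₂ Q + ε * sqGap Q₁ Q₂ G := by
    unfold sqGap contaminate
    rw [Measure.add_prod, Measure.prod_smul_left, Measure.prod_smul_left, integral_add_measure
      (hi1.smul_measure ENNReal.ofReal_ne_top) (hi2.smul_measure ENNReal.ofReal_ne_top),
      integral_smul_measure, integral_smul_measure, ENNReal.toReal_ofReal h0,
      ENNReal.toReal_ofReal hε.1.le, smul_eq_mul, smul_eq_mul]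
  rw [this]
  have := mul_nonneg hε.1.le (sqGap_nonneg Q₁ Q₂ G)
  linarith

/-- The mean of the Cramér-von Mises kernel under contamination is bounded below uniformly in the
contaminating distribution. -/
theorem mean_contaminate_ge {ε : ℝ} (hε : ε ∈ Set.Ioo (0 : ℝ) 1)
    (Q₁ Q₂ G : Measure (Eucl d)) [IsProbabilityMeasure Q₁] [IsProbabilityMeasure Q₂]
    [IsProbabilityMeasure G] [NullSingletonClass Q₁] [NullSingletonClass Q₂]
    [NullSingletonClass G] :
    (1 - ε) ^ 3 * ((sqGap Q₁ Q₂ Q₁ + sqGap Q₁ Q₂ Q₂) / 2) ≤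
      meanKer (contaminate ε Q₁ G) (contaminate ε Q₁ G) (contaminate ε Q₂ G) +
        meanKer (contaminate ε Q₂ G) (contaminate ε Q₂ G) (contaminate ε Q₁ G) := by
  have := isProbabilityMeasure_contaminate hε Q₁ G
  have := isProbabilityMeasure_contaminate hε Q₂ G
  have := nullSingletonClass_contaminate (ε := ε) Q₁ G
  have := nullSingletonClass_contaminate (ε := ε) Q₂ G
  rw [meanKer_add_eq_sqGap, sqGap_contaminate_left hε, sqGap_contaminate_left hε]
  have h1 := sqGap_contaminate_right hε Q₁ Q₂ Q₁ G
  have h2 := sqGap_contaminate_right hε Q₁ Q₂ Q₂ G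
  nlinarith [mul_le_mul_of_nonneg_left h1 (sq_nonneg (1 - ε)),
    mul_le_mul_of_nonneg_left h2 (sq_nonneg (1 - ε))]

/-- This is how admissibility enters the CvM argument. An atom would make the projected distribution
function jump in every direction, and one good direction exists because the surface measure is
nonzero for `d ≥ 1`. -/
theorem ProjContinuous.nullSingletonClass (hd : 1 ≤ d) {P : Measure (Eucl d)}
    [IsProbabilityMeasure P] (hP : ProjContinuous P) : NullSingletonClass P := by
  have : Nonempty (Fin d) := ⟨⟨0, hd⟩⟩
  have : Nontrivial (Eucl d) := inferInstance
  have : NeZero (volume : Measure (Eucl d)).toSphere := ⟨Measure.toSphere_ne_zero _⟩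
  obtain ⟨β, hβ⟩ := hP.exists
  refine ⟨fun x => ?_⟩
  set F : ℝ → ℝ := fun t : ℝ => P.real {x | inner ℝ (β : Eucl d) x ≤ t} with hF
  have hle : ∀ s < inner ℝ (β : Eucl d) x, P.real {x} ≤ F (inner ℝ (β : Eucl d) x) - F s := by
    intro s hs
    have hm : MeasurableSet {x | inner ℝ (β : Eucl d) x ≤ s} :=
      measurableSet_le (by fun_prop) measurable_const
    have hdisj : Disjoint {x} {x | inner ℝ (β : Eucl d) x ≤ s} := by
      rw [Set.disjoint_singleton_left]
      exact not_le.mpr hs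
    have hsub : {x} ∪ {x | inner ℝ (β : Eucl d) x ≤ s} ⊆
        {y | inner ℝ (β : Eucl d) y ≤ inner ℝ (β : Eucl d) x} := by
      rintro y (rfl | hy)
      · exact le_rfl (a := inner ℝ (β : Eucl d) y)
      · exact le_trans (show inner ℝ (β : Eucl d) y ≤ s from hy) hs.le
    have h1 := measureReal_union (μ := P) hdisj hm
    have h2 := measureReal_mono (μ := P) hsub
    simp only [hF]
    linarith
  have hlim : Tendsto (fun s => F (inner ℝ (β : Eucl d) x) - F s)
      (𝓝[<] (inner ℝ (β : Eucl d) x)) (𝓝 (F (inner ℝ (β : Eucl d) x) - F (inner ℝ (β : Eucl d) x))) :=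
    (hβ.tendsto _).const_sub _ |>.mono_left nhdsWithin_le_nhds
  rw [sub_self] at hlim
  have h0 : P.real {x} ≤ 0 := ge_of_tendsto hlim (eventually_nhdsWithin_of_forall hle)
  exact (measureReal_eq_zero_iff).mp (le_antisymm h0 measureReal_nonneg)

theorem continuous_measureReal_Iic (μ : Measure ℝ) [IsProbabilityMeasure μ]
    [NullSingletonClass μ] : Continuous fun t => μ.real (Set.Iic t) := by
  rw [continuous_iff_continuousAt]
  intro t
  simp_rw [← ProbabilityTheory.cdf_eq_real μ]
  refine (ProbabilityTheory.monotone_cdf μ).continuousAt_iff_leftLim_eq_rightLim.mpr ?_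
  rw [StieltjesFunction.rightLim_eq]
  have h := (ProbabilityTheory.cdf μ).measure_singleton t
  rw [ProbabilityTheory.measure_cdf, measure_singleton, eq_comm, ENNReal.ofReal_eq_zero,
    sub_nonpos] at h
  exact le_antisymm ((ProbabilityTheory.monotone_cdf μ).leftLim_le le_rfl) h

/-- Atomless distributions on the line agree if their distribution functions agree almost
everywhere. -/
theorem eq_of_cdf_ae_eq (μ ν : Measure ℝ) [IsProbabilityMeasure μ] [IsProbabilityMeasure ν]
    [NullSingletonClass μ] [NullSingletonClass ν]
    (h1 : ∀ᵐ t ∂μ, μ.real (Set.Iic t) = ν.real (Set.Iic t))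
    (h2 : ∀ᵐ t ∂ν, μ.real (Set.Iic t) = ν.real (Set.Iic t)) : μ = ν := by
  set C := {t | μ.real (Set.Iic t) = ν.real (Set.Iic t)} with hC
  have hclosed : IsClosed C :=
    isClosed_eq (continuous_measureReal_Iic μ) (continuous_measureReal_Iic ν)
  have key : ∀ (ρ : Measure ℝ) [IsProbabilityMeasure ρ], (ρ Cᶜ = 0) → ∀ s t, s ≤ t →
      Set.Ioc s t ⊆ Cᶜ → ρ.real (Set.Iic t) = ρ.real (Set.Iic s) := by
    intro ρ _ h s t hst hsub
    have hu : Set.Iic t = Set.Iic s ∪ Set.Ioc s t := (Set.Iic_union_Ioc_eq_Iic hst).symm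
    rw [hu, measureReal_union (Set.Iic_disjoint_Ioc le_rfl) measurableSet_Ioc,
      (measureReal_eq_zero_iff).mpr (measure_mono_null hsub h), add_zero]
  have hall : ∀ t, t ∈ C := by
    intro t
    by_contra ht
    by_cases hne : (C ∩ Set.Iic t).Nonempty
    -- `s` is the last point of agreement up to `t`. Neither law charges the complement of `C`, so
    -- both distribution functions are constant between `s` and `t`.
    · have hbdd : BddAbove (C ∩ Set.Iic t) := ⟨t, fun x hx => hx.2⟩
      have hs := (hclosed.inter isClosed_Iic).csSup_mem hne hbdd
      set s := sSup (C ∩ Set.Iic t)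
      have hsub : Set.Ioc s t ⊆ Cᶜ := fun x hx hxC =>
        not_le.mpr hx.1 (le_csSup hbdd ⟨hxC, hx.2⟩)
      refine ht ?_
      have hsC : μ.real (Set.Iic s) = ν.real (Set.Iic s) := hs.1
      change μ.real (Set.Iic t) = ν.real (Set.Iic t)
      rw [key μ h1 s t hs.2 hsub, key ν h2 s t hs.2 hsub, hsC]
    · have hsub : Set.Iic t ⊆ Cᶜ := fun x hx hxC => hne ⟨x, hxC, hx⟩
      refine ht ?_
      change μ.real (Set.Iic t) = ν.real (Set.Iic t)
      rw [(measureReal_eq_zero_iff).mpr (measure_mono_null hsub h1),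
        (measureReal_eq_zero_iff).mpr (measure_mono_null hsub h2)]
  refine Measure.ext_of_Iic μ ν fun t => ?_
  have := hall t
  exact (measureReal_eq_measureReal_iff).mp this

/-- Two independent draws from `Q` are almost surely distinct, and a random direction almost surely
distinguishes distinct points. So for almost every `β` the projections of the two draws do not tie,
whereas an atom of the projection would give a tie with positive probability. -/
theorem ae_nullSingletonClass_map (Q : Measure (Eucl d)) [IsProbabilityMeasure Q]
    [NullSingletonClass Q] :
    ∀ᵐ β ∂(ballProb d), NullSingletonClass (Q.map fun x => inner ℝ β x) := by
  have hm : MeasurableSet {r : (Eucl d) × ((Eucl d) × (Eucl d)) |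
      inner ℝ r.1 r.2.1 = inner ℝ r.1 r.2.2} :=
    measurableSet_eq_fun (by fun_prop) (by fun_prop)
  have hnull : ((ballProb d).prod (Q.prod Q)) {r : (Eucl d) × ((Eucl d) × (Eucl d)) |
      inner ℝ r.1 r.2.1 = inner ℝ r.1 r.2.2} = 0 := by
    rw [Measure.prod_apply_symm hm, lintegral_eq_zero_iff (measurable_measure_prodMk_right hm)]
    filter_upwards [ae_fst_ne_snd Q Q] with q hq
    rw [Pi.zero_apply, ← ballProb_inner_eq_zero (sub_ne_zero.mpr hq)]
    simp [Set.preimage, inner_sub_right, sub_eq_zero]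
  rw [Measure.measure_prod_null hm] at hnull
  filter_upwards [hnull] with β hβ
  refine ⟨fun t => ?_⟩
  have hmt : MeasurableSet {x : Eucl d | inner ℝ β x = t} :=
    measurableSet_eq_fun (by fun_prop) measurable_const
  rw [Measure.map_apply (by fun_prop) (measurableSet_singleton t)]
  have hsub : {x : Eucl d | inner ℝ β x = t} ×ˢ {x : Eucl d | inner ℝ β x = t} ⊆
      (Prod.mk β ⁻¹' {r : (Eucl d) × ((Eucl d) × (Eucl d)) |
        inner ℝ r.1 r.2.1 = inner ℝ r.1 r.2.2}) := by
    rintro ⟨x, y⟩ ⟨hx, hy⟩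
    simp_all
  have := measure_mono_null hsub hβ
  rw [Measure.prod_prod] at this
  exact mul_self_eq_zero.mp this

/-- Cramér–Wold. A vanishing gap forces the projections to have equal laws for almost every
direction, hence the characteristic functions agree almost everywhere on balls; by continuity they
agree everywhere. -/
theorem sqGap_pos {Q₁ Q₂ : Measure (Eucl d)} [IsProbabilityMeasure Q₁] [IsProbabilityMeasure Q₂]
    [NullSingletonClass Q₁] [NullSingletonClass Q₂] (hne : Q₁ ≠ Q₂) :
    0 < (sqGap Q₁ Q₂ Q₁ + sqGap Q₁ Q₂ Q₂) / 2 := by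
  have h1 := sqGap_nonneg Q₁ Q₂ Q₁
  have h2 := sqGap_nonneg Q₁ Q₂ Q₂
  by_contra hcon
  refine hne ?_
  have hae : ∀ (Q : Measure (Eucl d)) [IsProbabilityMeasure Q], sqGap Q₁ Q₂ Q = 0 →
      ∀ᵐ β ∂(ballProb d), ∀ᵐ c ∂Q, projCdf Q₁ β c = projCdf Q₂ β c := by
    intro Q _ h0
    have h := (integral_eq_zero_iff_of_nonneg (fun _ => sq_nonneg _)
      (integrable_sqGap Q₁ Q₂ (Q.prod (ballProb d)))).mp h0
    have h' : ∀ᵐ p ∂(Q.prod (ballProb d)), projCdf Q₁ p.2 p.1 = projCdf Q₂ p.2 p.1 := by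
      filter_upwards [h] with p hp
      have : (projCdf Q₁ p.2 p.1 - projCdf Q₂ p.2 p.1) ^ 2 = 0 := hp
      exact sub_eq_zero.mp (pow_eq_zero_iff two_ne_zero |>.mp this)
    rw [← Measure.prod_swap] at h'
    exact Measure.ae_ae_of_ae_prod (ae_of_ae_map measurable_swap.aemeasurable h')
  have hproj : ∀ᵐ β ∂(ballProb d), (Q₁.map fun x => inner ℝ β x) = Q₂.map fun x => inner ℝ β x := by
    filter_upwards [hae Q₁ (by linarith), hae Q₂ (by linarith), ae_nullSingletonClass_map Q₁,
      ae_nullSingletonClass_map Q₂] with β e1 e2 a1 a2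
    have hm : Measurable fun x : Eucl d => inner ℝ β x := by fun_prop
    have := Measure.isProbabilityMeasure_map (μ := Q₁) hm.aemeasurable
    have := Measure.isProbabilityMeasure_map (μ := Q₂) hm.aemeasurable
    have hcdf : ∀ (Q : Measure (Eucl d)) t,
        (Q.map fun x => inner ℝ β x).real (Set.Iic t) = Q.real {a | inner ℝ β a ≤ t} :=
      fun Q t => by
        rw [map_measureReal_apply hm measurableSet_Iic]; rfl
    have hset : MeasurableSet {t | (Q₁.map fun x => inner ℝ β x).real (Set.Iic t) =
        (Q₂.map fun x => inner ℝ β x).real (Set.Iic t)} :=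
      (isClosed_eq (continuous_measureReal_Iic _) (continuous_measureReal_Iic _)).measurableSet
    refine eq_of_cdf_ae_eq _ _ ?_ ?_
    · rw [ae_map_iff hm.aemeasurable hset]
      simpa only [hcdf, projCdf] using e1
    · rw [ae_map_iff hm.aemeasurable hset]
      simpa only [hcdf, projCdf] using e2
  have hchar : ∀ (Q : Measure (Eucl d)) (β : Eucl d) (r : ℝ),
      charFun Q (r • β) = charFun (Q.map fun x => inner ℝ β x) r := by
    intro Q β r
    have hm : Measurable fun x : Eucl d => inner ℝ β x := by fun_prop
    rw [charFun_apply, charFun_apply, integral_map hm.aemeasurable (by fun_prop)]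
    refine integral_congr_ae (ae_of_all _ fun x => ?_)
    simp [inner_smul_right, real_inner_comm, mul_comm]
  refine Measure.ext_of_charFun ?_
  funext t
  -- Directions are drawn from the unit ball; scaling by `r` makes `t` the image of an interior
  -- point.
  set r := ‖t‖ + 1 with hr
  have hr0 : 0 < r := by positivity
  have hball : ∀ᵐ β ∂(volume.restrict (Metric.ball (0 : Eucl d) 1)),
      charFun Q₁ (r • β) = charFun Q₂ (r • β) := by
    have : ∀ᵐ β ∂(ballProb d), charFun Q₁ (r • β) = charFun Q₂ (r • β) := by
      filter_upwards [hproj] with β hβ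
      rw [hchar, hchar, hβ]
    rwa [ballProb, Measure.ae_ennreal_smul_measure_iff] at this
    exact ENNReal.inv_ne_zero.mpr measure_ball_lt_top.ne
  have hcont : ∀ (Q : Measure (Eucl d)) [IsProbabilityMeasure Q],
      Continuous fun β : Eucl d => charFun Q (r • β) := fun Q _ =>
    continuous_charFun.comp (continuous_const_smul r)
  have heq := Measure.eqOn_open_of_ae_eq hball Metric.isOpen_ball (hcont Q₁).continuousOn
    (hcont Q₂).continuousOn
  have hmem : r⁻¹ • t ∈ Metric.ball (0 : Eucl d) 1 := by
    rw [mem_ball_zero_iff, norm_smul, norm_inv, Real.norm_of_nonneg hr0.le, inv_mul_lt_iff₀ hr0]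
    linarith
  have := heq hmem
  simpa [smul_smul, mul_inv_cancel₀ hr0.ne'] using this

end Contamination

/-! ### Second moments of the Cramér-von Mises statistic -/

/-! ### Counting overlapping index pairs -/

section Counting

theorem card_offDiag_fin (m : ℕ) :
    ((Finset.univ : Finset (Fin m)).offDiag.card : ℝ) = (m : ℝ) * ((m : ℝ) - 1) := by
  rw [Finset.offDiag_card, Finset.card_univ, Fintype.card_fin, Nat.cast_sub (Nat.le_mul_self m)]
  push_cast; ring

theorem sum_offDiag_ite_fst_le (m : ℕ) (hm : 1 ≤ m) (a : Fin m) :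
    ∑ i ∈ (Finset.univ : Finset (Fin m)).offDiag, (if i.1 = a then (1 : ℝ) else 0) ≤ m - 1 := by
  rw [Finset.sum_boole, ← Nat.cast_one, ← Nat.cast_sub hm, Nat.cast_le]
  have h : (Finset.univ.erase a).card = m - 1 := by
    rw [Finset.card_erase_of_mem (Finset.mem_univ _), Finset.card_univ, Fintype.card_fin]
  rw [← h]
  refine Finset.card_le_card_of_injOn Prod.snd ?_ ?_
  · rintro ⟨x, y⟩ hx
    simp only [Finset.coe_filter, Finset.mem_offDiag, Finset.mem_univ, true_and,
      Set.mem_ofPred_eq] at hx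
    simp only [Finset.coe_erase, Finset.coe_univ, Set.mem_sdiff, Set.mem_univ,
      Set.mem_singleton_iff, true_and]
    exact fun h => hx.1 (hx.2.trans h.symm)
  · rintro ⟨x, y⟩ hx ⟨x', y'⟩ hx' h
    simp only [Finset.coe_filter, Set.mem_ofPred_eq] at hx hx'
    exact Prod.ext (hx.2.trans hx'.2.symm) h

theorem sum_offDiag_ite_snd_le (m : ℕ) (hm : 1 ≤ m) (a : Fin m) :
    ∑ i ∈ (Finset.univ : Finset (Fin m)).offDiag, (if i.2 = a then (1 : ℝ) else 0) ≤ m - 1 := by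
  refine le_trans (le_of_eq ?_) (sum_offDiag_ite_fst_le m hm a)
  refine Finset.sum_nbij' Prod.swap Prod.swap ?_ ?_ ?_ ?_ ?_ <;> simp [eq_comm]

/-- The number of common entries of two pairs of indices. -/
def sharing {m : ℕ} (i i' : Fin m × Fin m) : ℝ :=
  (if i'.1 = i.1 then 1 else 0) + (if i'.1 = i.2 then 1 else 0) +
    (if i'.2 = i.1 then 1 else 0) + (if i'.2 = i.2 then 1 else 0)

theorem sharing_nonneg {m : ℕ} (i i' : Fin m × Fin m) : 0 ≤ sharing i i' := by
  unfold sharing; positivity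

theorem one_le_sharing {m : ℕ} {i i' : Fin m × Fin m}
    (h : ¬ (i'.1 ≠ i.1 ∧ i'.1 ≠ i.2 ∧ i'.2 ≠ i.1 ∧ i'.2 ≠ i.2)) : 1 ≤ sharing i i' := by
  unfold sharing
  have h0 : ∀ p : Prop, [Decidable p] → (0 : ℝ) ≤ if p then 1 else 0 := fun p _ => by
    split_ifs <;> norm_num
  by_cases h1 : i'.1 = i.1
  · rw [if_pos h1]; linarith [h0 (i'.1 = i.2), h0 (i'.2 = i.1), h0 (i'.2 = i.2)]
  by_cases h2 : i'.1 = i.2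
  · rw [if_pos h2]; linarith [h0 (i'.1 = i.1), h0 (i'.2 = i.1), h0 (i'.2 = i.2)]
  by_cases h3 : i'.2 = i.1
  · rw [if_pos h3]; linarith [h0 (i'.1 = i.1), h0 (i'.1 = i.2), h0 (i'.2 = i.2)]
  by_cases h4 : i'.2 = i.2
  · rw [if_pos h4]; linarith [h0 (i'.1 = i.1), h0 (i'.1 = i.2), h0 (i'.2 = i.1)]
  exact absurd ⟨h1, h2, h3, h4⟩ h

theorem sum_sharing_le (m : ℕ) (hm : 1 ≤ m) (i : Fin m × Fin m) :
    ∑ i' ∈ (Finset.univ : Finset (Fin m)).offDiag, sharing i i' ≤ 4 * ((m : ℝ) - 1) := by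
  unfold sharing
  simp only [Finset.sum_add_distrib]
  linarith [sum_offDiag_ite_fst_le m hm i.1, sum_offDiag_ite_fst_le m hm i.2,
    sum_offDiag_ite_snd_le m hm i.1, sum_offDiag_ite_snd_le m hm i.2]

/-- Disjointness of the indices of two summands of the statistic. -/
def IndexDisjoint {m n : ℕ} (p q : (Fin m × Fin m) × (Fin n × Fin n)) : Prop :=
  (q.1.1 ≠ p.1.1 ∧ q.1.1 ≠ p.1.2 ∧ q.1.2 ≠ p.1.1 ∧ q.1.2 ≠ p.1.2) ∧
    (q.2.1 ≠ p.2.1 ∧ q.2.1 ≠ p.2.2 ∧ q.2.2 ≠ p.2.1 ∧ q.2.2 ≠ p.2.2)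

/-- The index set of the summands of the statistic. -/
def quadIndex (m n : ℕ) : Finset ((Fin m × Fin m) × (Fin n × Fin n)) :=
  (Finset.univ : Finset (Fin m)).offDiag ×ˢ (Finset.univ : Finset (Fin n)).offDiag

theorem card_quadIndex (m n : ℕ) : ((quadIndex m n).card : ℝ) =
    ((m : ℝ) * ((m : ℝ) - 1)) * ((n : ℝ) * ((n : ℝ) - 1)) := by
  rw [quadIndex, Finset.card_product, Nat.cast_mul, card_offDiag_fin, card_offDiag_fin]

/-- For fixed `p`, at most a proportion `4 / m` of the `q` share a first-sample index with `p`, and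
at most `4 / n` a second-sample index. With `c` a covariance this is the variance bound; it serves
both the permutation law and the sampling law. -/
theorem sum_quadIndex_le {m n : ℕ} (hm : 2 ≤ m) (hn : 2 ≤ n)
    (c : (Fin m × Fin m) × (Fin n × Fin n) → (Fin m × Fin m) × (Fin n × Fin n) → ℝ)
    (h1 : ∀ p q, c p q ≤ 1)
    (h0 : ∀ p ∈ quadIndex m n, ∀ q ∈ quadIndex m n, IndexDisjoint p q → c p q = 0) :
    ∑ p ∈ quadIndex m n, ∑ q ∈ quadIndex m n, c p q ≤
      (4 / m + 4 / n) * ((quadIndex m n).card : ℝ) ^ 2 := by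
  have hm' : (2 : ℝ) ≤ m := by exact_mod_cast hm
  have hn' : (2 : ℝ) ≤ n := by exact_mod_cast hn
  have hbound : ∀ p ∈ quadIndex m n, ∀ q ∈ quadIndex m n,
      c p q ≤ sharing p.1 q.1 + sharing p.2 q.2 := by
    intro p hp q hq
    by_cases hd : IndexDisjoint p q
    · rw [h0 p hp q hq hd]
      exact add_nonneg (sharing_nonneg _ _) (sharing_nonneg _ _)
    · rw [IndexDisjoint, not_and_or] at hd
      rcases hd with hd | hd
      · linarith [h1 p q, one_le_sharing hd, sharing_nonneg p.2 q.2]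
      · linarith [h1 p q, one_le_sharing hd, sharing_nonneg p.1 q.1]
  have hinner : ∀ p : (Fin m × Fin m) × (Fin n × Fin n),
      ∑ q ∈ quadIndex m n, (sharing p.1 q.1 + sharing p.2 q.2) ≤
        4 * ((m : ℝ) - 1) * (n * (n - 1)) + 4 * ((n : ℝ) - 1) * (m * (m - 1)) := by
    intro p
    rw [Finset.sum_add_distrib, quadIndex, Finset.sum_product, Finset.sum_product_right]
    simp only [Finset.sum_const, nsmul_eq_mul, card_offDiag_fin]
    rw [← Finset.mul_sum, ← Finset.mul_sum]
    have e1 := sum_sharing_le m (by omega) p.1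
    have e2 := sum_sharing_le n (by omega) p.2
    have p1 : 0 ≤ (n : ℝ) * (n - 1) := by nlinarith
    have p2 : 0 ≤ (m : ℝ) * (m - 1) := by nlinarith
    nlinarith [mul_le_mul_of_nonneg_left e1 p1, mul_le_mul_of_nonneg_left e2 p2]
  calc ∑ p ∈ quadIndex m n, ∑ q ∈ quadIndex m n, c p q
      ≤ ∑ p ∈ quadIndex m n, ∑ q ∈ quadIndex m n, (sharing p.1 q.1 + sharing p.2 q.2) :=
        Finset.sum_le_sum fun p hp => Finset.sum_le_sum fun q hq => hbound p hp q hq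
    _ ≤ ∑ p ∈ quadIndex m n,
        (4 * ((m : ℝ) - 1) * (n * (n - 1)) + 4 * ((n : ℝ) - 1) * (m * (m - 1))) :=
        Finset.sum_le_sum fun p _ => hinner p
    _ = (4 / m + 4 / n) * ((quadIndex m n).card : ℝ) ^ 2 := by
        rw [Finset.sum_const, nsmul_eq_mul, card_quadIndex]
        have : (m : ℝ) ≠ 0 := by positivity
        have : (n : ℝ) ≠ 0 := by positivity
        field_simp

end Counting

/-! ### Uncorrelated kernel terms under random permutation -/

section SecondMoments

variable {d : ℕ}

theorem hCvM_mem (x₁ x₂ y₁ y₂ : Eucl d) :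
    -(2 / 3) ≤ hCvM x₁ x₂ y₁ y₂ ∧ hCvM x₁ x₂ y₁ y₂ ≤ 1 / 3 := by
  have h1 := angKer_mem y₁ x₁ x₂
  have h2 := angKer_mem x₁ y₁ y₂
  rw [hCvM_eq]
  constructor <;> linarith

/-- A summand of the statistic evaluated at the pooled sample `z`. -/
noncomputable def quadTerm {m n : ℕ} (z : Fin m ⊕ Fin n → Eucl d) (p : (Fin m × Fin m) × (Fin n × Fin n)) : ℝ :=
  hCvM (z (Sum.inl p.1.1)) (z (Sum.inl p.1.2)) (z (Sum.inr p.2.1)) (z (Sum.inr p.2.2))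

theorem abs_quadTerm_le {m n : ℕ} (z : Fin m ⊕ Fin n → Eucl d)
    (p : (Fin m × Fin m) × (Fin n × Fin n)) : |quadTerm z p| ≤ 1 := by
  have h := hCvM_mem (z (Sum.inl p.1.1)) (z (Sum.inl p.1.2)) (z (Sum.inr p.2.1))
    (z (Sum.inr p.2.2))
  rw [quadTerm, abs_le]
  constructor <;> linarith

theorem UCvM_eq {m n : ℕ} (z : Fin m ⊕ Fin n → Eucl d) :
    UCvM (fun i => z (Sum.inl i)) (fun j => z (Sum.inr j)) =
      1 / ((quadIndex m n).card : ℝ) * ∑ p ∈ quadIndex m n, quadTerm z p := by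
  rw [UCvM, card_quadIndex, quadIndex, Finset.sum_product]
  rfl

/-- Right multiplication by the 3-cycle on `a`, `b`, `c` leaves `r` unchanged and rotates the
arguments of the kernel. The three rotated sums are therefore equal, and they add up to zero because
the angles of a triangle sum to π. -/
theorem sum_perm_angKer_mul {ι : Type*} [Fintype ι] [DecidableEq ι] {z : ι → Eucl d}
    (hz : Function.Injective z) {a b c : ι} (hab : a ≠ b) (hbc : b ≠ c) (hca : c ≠ a)
    (r : Equiv.Perm ι → ℝ)
    (hr : ∀ σ, r (σ * (Equiv.swap a b * Equiv.swap b c)) = r σ) :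
    ∑ σ : Equiv.Perm ι, angKer (z (σ a)) (z (σ b)) (z (σ c)) * r σ = 0 := by
  set τ := Equiv.swap a b * Equiv.swap b c with hτ
  have ta : τ a = b := by
    rw [hτ, Equiv.Perm.mul_apply, Equiv.swap_apply_of_ne_of_ne hab hca.symm, Equiv.swap_apply_left]
  have tb : τ b = c := by
    rw [hτ, Equiv.Perm.mul_apply, Equiv.swap_apply_left, Equiv.swap_apply_of_ne_of_ne hca hbc.symm]
  have tc : τ c = a := by
    rw [hτ, Equiv.Perm.mul_apply, Equiv.swap_apply_right, Equiv.swap_apply_right]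
  have h1 : ∑ σ : Equiv.Perm ι, angKer (z (σ a)) (z (σ b)) (z (σ c)) * r σ =
      ∑ σ : Equiv.Perm ι, angKer (z (σ b)) (z (σ c)) (z (σ a)) * r σ := by
    rw [← Equiv.sum_comp (Equiv.mulRight τ)]
    refine Finset.sum_congr rfl fun σ _ => ?_
    simp only [Equiv.coe_mulRight, Equiv.Perm.mul_apply, ta, tb, tc, hr]
  have h2 : ∑ σ : Equiv.Perm ι, angKer (z (σ b)) (z (σ c)) (z (σ a)) * r σ =
      ∑ σ : Equiv.Perm ι, angKer (z (σ c)) (z (σ a)) (z (σ b)) * r σ := by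
    rw [← Equiv.sum_comp (Equiv.mulRight τ)]
    refine Finset.sum_congr rfl fun σ _ => ?_
    simp only [Equiv.coe_mulRight, Equiv.Perm.mul_apply, ta, tb, tc, hr]
  have h3 : ∑ σ : Equiv.Perm ι, angKer (z (σ a)) (z (σ b)) (z (σ c)) * r σ +
      ∑ σ : Equiv.Perm ι, angKer (z (σ b)) (z (σ c)) (z (σ a)) * r σ +
      ∑ σ : Equiv.Perm ι, angKer (z (σ c)) (z (σ a)) (z (σ b)) * r σ = 0 := by
    rw [← Finset.sum_add_distrib, ← Finset.sum_add_distrib]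
    refine Finset.sum_eq_zero fun σ _ => ?_
    have hne : z (σ b) ≠ z (σ c) := fun h => hbc (σ.injective (hz h))
    have := angKer_cyclic (a := z (σ b)) (b := z (σ c)) (c := z (σ a)) hne
    rw [← add_mul, ← add_mul, this, zero_mul]
  linarith

/-- Each half of the kernel term at `p` lives on a triangle of indices not met by `q`, so the term
at `q` is invariant under the 3-cycle of that triangle. -/
theorem sum_perm_quadTerm_mul {m n : ℕ} {z : Fin m ⊕ Fin n → Eucl d}
    (hz : Function.Injective z) {p q : (Fin m × Fin m) × (Fin n × Fin n)}
    (hp : p ∈ quadIndex m n) (hpq : IndexDisjoint p q) :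
    ∑ σ : Equiv.Perm (Fin m ⊕ Fin n), quadTerm (z ∘ σ) p * quadTerm (z ∘ σ) q = 0 := by
  simp only [quadIndex, Finset.mem_product, Finset.mem_offDiag, Finset.mem_univ, true_and] at hp
  obtain ⟨⟨q1, q2, q3, q4⟩, q5, q6, q7, q8⟩ := hpq
  have hinv : ∀ a b c : Fin m ⊕ Fin n, (∀ s ∈ ({a, b, c} : Set (Fin m ⊕ Fin n)),
      s ≠ Sum.inl q.1.1 ∧ s ≠ Sum.inl q.1.2 ∧ s ≠ Sum.inr q.2.1 ∧ s ≠ Sum.inr q.2.2) →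
      ∀ σ : Equiv.Perm (Fin m ⊕ Fin n),
      quadTerm (z ∘ (σ * (Equiv.swap a b * Equiv.swap b c))) q = quadTerm (z ∘ σ) q := by
    intro a b c h σ
    have ha := h a (by simp)
    have hb := h b (by simp)
    have hc := h c (by simp)
    have hfix : ∀ s, s ≠ a → s ≠ b → s ≠ c →
        (Equiv.swap a b * Equiv.swap b c) s = s := fun s h1 h2 h3 => by
      rw [Equiv.Perm.mul_apply, Equiv.swap_apply_of_ne_of_ne h2 h3,
        Equiv.swap_apply_of_ne_of_ne h1 h2]
    simp only [quadTerm, Function.comp_apply, Equiv.Perm.mul_apply σ]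
    rw [hfix _ ha.1.symm hb.1.symm hc.1.symm, hfix _ ha.2.1.symm hb.2.1.symm hc.2.1.symm,
      hfix _ ha.2.2.1.symm hb.2.2.1.symm hc.2.2.1.symm,
      hfix _ ha.2.2.2.symm hb.2.2.2.symm hc.2.2.2.symm]
  have e1 := sum_perm_angKer_mul hz (a := Sum.inr p.2.1) (b := Sum.inl p.1.1) (c := Sum.inl p.1.2)
    (by simp) (by simpa using hp.1) (by simp) (fun σ => quadTerm (z ∘ σ) q)
    (hinv _ _ _ (by simp [q1.symm, q2.symm, q3.symm, q4.symm, q5.symm, q7.symm]))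
  have e2 := sum_perm_angKer_mul hz (a := Sum.inl p.1.1) (b := Sum.inr p.2.1) (c := Sum.inr p.2.2)
    (by simp) (by simpa using hp.2) (by simp) (fun σ => quadTerm (z ∘ σ) q)
    (hinv _ _ _ (by simp [q1.symm, q3.symm, q5.symm, q6.symm, q7.symm, q8.symm]))
  have e3 := congrArg₂ (· + ·) e1 e2
  simp only [add_zero] at e3
  rw [← e3, ← Finset.sum_add_distrib]
  refine Finset.sum_congr rfl fun σ _ => ?_
  rw [← add_mul, ← hCvM_eq]
  rfl

theorem sq_average_eq {ι : Type*} (s : Finset ι) (f : ι → ℝ) :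
    (1 / (s.card : ℝ) * ∑ p ∈ s, f p) ^ 2 =
      1 / (s.card : ℝ) ^ 2 * ∑ p ∈ s, ∑ q ∈ s, f p * f q := by
  rw [mul_pow, sq (∑ p ∈ s, f p), Finset.sum_mul_sum, div_pow, one_pow]

theorem quadIndex_card_pos {m n : ℕ} (hm : 2 ≤ m) (hn : 2 ≤ n) :
    0 < ((quadIndex m n).card : ℝ) := by
  have hm' : (2 : ℝ) ≤ m := by exact_mod_cast hm
  have hn' : (2 : ℝ) ≤ n := by exact_mod_cast hn
  rw [card_quadIndex]
  have h1 : (0 : ℝ) < m - 1 := by linarith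
  have h2 : (0 : ℝ) < n - 1 := by linarith
  positivity

/-- The second moment of the permutation distribution. -/
theorem sum_perm_UCvM_sq_le {m n : ℕ} (hm : 2 ≤ m) (hn : 2 ≤ n) {z : Fin m ⊕ Fin n → Eucl d}
    (hz : Function.Injective z) :
    ∑ σ : Equiv.Perm (Fin m ⊕ Fin n),
      UCvM (fun i => z (σ (Sum.inl i))) (fun j => z (σ (Sum.inr j))) ^ 2 ≤
      (4 / m + 4 / n) * (Nat.factorial (m + n) : ℝ) := by
  have hM := quadIndex_card_pos hm hn
  have hN : (0 : ℝ) < Nat.factorial (m + n) := by positivity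
  have hcard : (Fintype.card (Equiv.Perm (Fin m ⊕ Fin n)) : ℝ) = Nat.factorial (m + n) := by
    rw [Fintype.card_perm, Fintype.card_sum, Fintype.card_fin, Fintype.card_fin]
  have h := sum_quadIndex_le hm hn (fun p q => 1 / (Nat.factorial (m + n) : ℝ) *
    ∑ σ : Equiv.Perm (Fin m ⊕ Fin n), quadTerm (z ∘ σ) p * quadTerm (z ∘ σ) q) ?_ ?_
  · have : ∀ σ : Equiv.Perm (Fin m ⊕ Fin n),
        UCvM (fun i => z (σ (Sum.inl i))) (fun j => z (σ (Sum.inr j))) ^ 2 =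
          1 / ((quadIndex m n).card : ℝ) ^ 2 *
          ∑ p ∈ quadIndex m n, ∑ q ∈ quadIndex m n, quadTerm (z ∘ σ) p * quadTerm (z ∘ σ) q :=
      fun σ => by rw [← sq_average_eq, ← UCvM_eq]; rfl
    simp_rw [this]
    simp_rw [← Finset.mul_sum] at h
    rw [← Finset.mul_sum, Finset.sum_comm]
    simp_rw [Finset.sum_comm (s := (Finset.univ : Finset (Equiv.Perm (Fin m ⊕ Fin n))))]
    rw [one_div, inv_mul_le_iff₀ (by positivity)]
    rw [one_div, inv_mul_le_iff₀ hN] at h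
    linarith
  · intro p q
    rw [one_div, inv_mul_le_iff₀ hN, mul_one, ← hcard, ← Finset.card_univ]
    refine (Finset.sum_le_card_nsmul _ _ 1 fun σ _ => ?_).trans (by simp)
    have h1 := abs_quadTerm_le (z ∘ σ) p
    have h2 := abs_quadTerm_le (z ∘ σ) q
    refine (le_abs_self _).trans ?_
    rw [abs_mul]
    exact mul_le_one₀ h1 (abs_nonneg _) h2
  · intro p hp q _ hpq
    rw [sum_perm_quadTerm_mul hz hp hpq, mul_zero]

end SecondMoments

/-! ### Mean and variance under the sampling law -/

section Variance

variable {d : ℕ}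

theorem measurable_hCvM : Measurable fun p : Eucl d × Eucl d × Eucl d × Eucl d =>
    hCvM p.1 p.2.1 p.2.2.1 p.2.2.2 := by
  simp_rw [hCvM_eq]
  exact (measurable_angKer.comp (f := fun p : Eucl d × Eucl d × Eucl d × Eucl d =>
      (p.2.2.1, p.1, p.2.1)) (by fun_prop)).add
    (measurable_angKer.comp (f := fun p : Eucl d × Eucl d × Eucl d × Eucl d =>
      (p.1, p.2.2.1, p.2.2.2)) (by fun_prop))

theorem measurable_quadTerm {m n : ℕ} (p : (Fin m × Fin m) × (Fin n × Fin n)) :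
    Measurable fun z : Fin m ⊕ Fin n → Eucl d => quadTerm z p :=
  measurable_hCvM.comp (f := fun z : Fin m ⊕ Fin n → Eucl d => (z (Sum.inl p.1.1),
    z (Sum.inl p.1.2), z (Sum.inr p.2.1), z (Sum.inr p.2.2))) (by fun_prop)

theorem measurable_UCvM {m n : ℕ} : Measurable fun z : Fin m ⊕ Fin n → Eucl d =>
    UCvM (fun i => z (Sum.inl i)) (fun j => z (Sum.inr j)) := by
  simp_rw [UCvM_eq]
  exact (Finset.measurable_sum _ fun p _ => measurable_quadTerm p).const_mul _

/-- The law of the pooled sample. -/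
noncomputable def poolLaw (m n : ℕ) (PX PY : Measure (Eucl d)) :
    Measure (Fin m ⊕ Fin n → Eucl d) :=
  Measure.pi (Sum.elim (fun _ => PX) fun _ => PY)

variable {m n : ℕ} (PX PY : Measure (Eucl d)) [IsProbabilityMeasure PX] [IsProbabilityMeasure PY]

instance (k : Fin m ⊕ Fin n) : IsProbabilityMeasure
    ((Sum.elim (fun _ => PX) fun _ => PY : Fin m ⊕ Fin n → Measure (Eucl d)) k) := by
  cases k <;> simpa

instance : IsProbabilityMeasure (poolLaw m n PX PY) := by
  unfold poolLaw; infer_instance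

theorem iIndepFun_poolLaw : ProbabilityTheory.iIndepFun
    (fun (k : Fin m ⊕ Fin n) (z : Fin m ⊕ Fin n → Eucl d) => z k) (poolLaw m n PX PY) :=
  ProbabilityTheory.iIndepFun_pi (X := fun _ x => x) fun _ => aemeasurable_id

theorem integral_angKer_poolLaw {a b c : Fin m ⊕ Fin n} (hab : a ≠ b) (hac : a ≠ c)
    (hbc : b ≠ c) :
    ∫ z, angKer (z c) (z a) (z b) ∂(poolLaw m n PX PY) =
      meanKer ((Sum.elim (fun _ => PX) fun _ => PY : Fin m ⊕ Fin n → Measure (Eucl d)) a)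
        ((Sum.elim (fun _ => PX) fun _ => PY : Fin m ⊕ Fin n → Measure (Eucl d)) b)
        ((Sum.elim (fun _ => PX) fun _ => PY : Fin m ⊕ Fin n → Measure (Eucl d)) c) := by
  have hI := iIndepFun_poolLaw (m := m) (n := n) PX PY
  have hmap : ∀ k : Fin m ⊕ Fin n, (poolLaw m n PX PY).map (fun z => z k) =
      (Sum.elim (fun _ => PX) fun _ => PY : Fin m ⊕ Fin n → Measure (Eucl d)) k :=
    fun k => (measurePreserving_eval _ k).map_eq
  have h1 := (ProbabilityTheory.indepFun_iff_map_prod_eq_prod_map_map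
    (measurable_pi_apply a).aemeasurable (measurable_pi_apply b).aemeasurable).mp
    (hI.indepFun hab)
  have h2 := (ProbabilityTheory.indepFun_iff_map_prod_eq_prod_map_map
    ((measurable_pi_apply a).prodMk (measurable_pi_apply b)).aemeasurable
    (measurable_pi_apply c).aemeasurable).mp
    (hI.indepFun_prodMk (fun k => measurable_pi_apply k) a b c hac hbc)
  rw [h1] at h2
  simp only [hmap] at h2
  have h3 : (poolLaw m n PX PY).map (fun z => (z c, (z a, z b))) =
      ((Sum.elim (fun _ => PX) fun _ => PY : Fin m ⊕ Fin n → Measure (Eucl d)) c).prod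
        (((Sum.elim (fun _ => PX) fun _ => PY : Fin m ⊕ Fin n → Measure (Eucl d)) a).prod
        ((Sum.elim (fun _ => PX) fun _ => PY : Fin m ⊕ Fin n → Measure (Eucl d)) b)) := by
    rw [show (fun z : Fin m ⊕ Fin n → Eucl d => (z c, (z a, z b))) =
      Prod.swap ∘ fun z => ((z a, z b), z c) from rfl,
      ← Measure.map_map measurable_swap (by fun_prop), h2, Measure.prod_swap]
  rw [meanKer, ← h3, integral_map (by fun_prop) measurable_angKer.aestronglyMeasurable]

theorem integrable_of_abs_le_one {Ω : Type*} [MeasurableSpace Ω] {μ : Measure Ω}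
    [IsFiniteMeasure μ] {f : Ω → ℝ} (hf : Measurable f) (h : ∀ ω, |f ω| ≤ 1) : Integrable f μ :=
  Integrable.of_bound hf.aestronglyMeasurable 1 (ae_of_all _ h)

/-- The mean of the statistic. -/
noncomputable def meanCvM (PX PY : Measure (Eucl d)) : ℝ :=
  meanKer PX PX PY + meanKer PY PY PX

theorem integral_quadTerm {p : (Fin m × Fin m) × (Fin n × Fin n)} (hp : p ∈ quadIndex m n) :
    ∫ z, quadTerm z p ∂(poolLaw m n PX PY) = meanCvM PX PY := by
  simp only [quadIndex, Finset.mem_product, Finset.mem_offDiag, Finset.mem_univ, true_and] at hp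
  have e1 := integral_angKer_poolLaw PX PY (m := m) (n := n) (a := Sum.inl p.1.1)
    (b := Sum.inl p.1.2) (c := Sum.inr p.2.1) (by simpa using hp.1) (by simp) (by simp)
  have e2 := integral_angKer_poolLaw PX PY (m := m) (n := n) (a := Sum.inr p.2.1)
    (b := Sum.inr p.2.2) (c := Sum.inl p.1.1) (by simpa using hp.2) (by simp) (by simp)
  simp only [Sum.elim_inl, Sum.elim_inr] at e1 e2
  rw [meanCvM, ← e1, ← e2, ← integral_add]
  · refine integral_congr_ae (ae_of_all _ fun z => ?_)
    simp only [quadTerm, hCvM_eq]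
  · exact integrable_of_abs_le_one (measurable_angKer.comp
      (f := fun z : Fin m ⊕ Fin n → Eucl d => (z (Sum.inr p.2.1), z (Sum.inl p.1.1),
        z (Sum.inl p.1.2))) (by fun_prop)) fun z => (abs_angKer_le _ _ _).trans (by norm_num)
  · exact integrable_of_abs_le_one (measurable_angKer.comp
      (f := fun z : Fin m ⊕ Fin n → Eucl d => (z (Sum.inl p.1.1), z (Sum.inr p.2.1),
        z (Sum.inr p.2.2))) (by fun_prop)) fun z => (abs_angKer_le _ _ _).trans (by norm_num)

theorem indepFun_quadTerm {p q : (Fin m × Fin m) × (Fin n × Fin n)} (hpq : IndexDisjoint p q) :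
    ProbabilityTheory.IndepFun (fun z : Fin m ⊕ Fin n → Eucl d => quadTerm z p)
      (fun z => quadTerm z q) (poolLaw m n PX PY) := by
  let S : (Fin m × Fin m) × (Fin n × Fin n) → Finset (Fin m ⊕ Fin n) := fun p =>
    {Sum.inl p.1.1, Sum.inl p.1.2, Sum.inr p.2.1, Sum.inr p.2.2}
  have hS : Disjoint (S p) (S q) := by
    obtain ⟨⟨q1, q2, q3, q4⟩, q5, q6, q7, q8⟩ := hpq
    simp only [S, Finset.disjoint_insert_left, Finset.mem_insert, Finset.mem_singleton,
      Finset.disjoint_singleton_left, Sum.inl.injEq, Sum.inr.injEq, reduceCtorEq, or_false,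
      false_or, not_or]
    exact ⟨⟨q1.symm, q3.symm⟩, ⟨q2.symm, q4.symm⟩, ⟨q5.symm, q7.symm⟩, ⟨q6.symm, q8.symm⟩⟩
  have hI := (iIndepFun_poolLaw (m := m) (n := n) PX PY).indepFun_finset (S p) (S q) hS
    fun k => measurable_pi_apply k
  have hm : ∀ p, Measurable fun f : S p → Eucl d =>
      hCvM (f ⟨Sum.inl p.1.1, by simp [S]⟩) (f ⟨Sum.inl p.1.2, by simp [S]⟩)
        (f ⟨Sum.inr p.2.1, by simp [S]⟩) (f ⟨Sum.inr p.2.2, by simp [S]⟩) := fun p =>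
    measurable_hCvM.comp (f := fun f : S p → Eucl d => (f ⟨Sum.inl p.1.1, by simp [S]⟩,
      f ⟨Sum.inl p.1.2, by simp [S]⟩, f ⟨Sum.inr p.2.1, by simp [S]⟩,
      f ⟨Sum.inr p.2.2, by simp [S]⟩)) (by fun_prop)
  exact hI.comp (hm p) (hm q)

theorem integral_sub_mul_sub_eq_zero {p q : (Fin m × Fin m) × (Fin n × Fin n)}
    (hp : p ∈ quadIndex m n) (hpq : IndexDisjoint p q) :
    ∫ z, (quadTerm z p - meanCvM PX PY) * (quadTerm z q - meanCvM PX PY)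
      ∂(poolLaw m n PX PY) = 0 := by
  have hI := (indepFun_quadTerm PX PY hpq).comp (φ := fun x => x - meanCvM PX PY)
    (ψ := fun x => x - meanCvM PX PY) (by fun_prop) (by fun_prop)
  have h := hI.integral_mul_eq_mul_integral
    ((measurable_quadTerm p).sub_const _).aestronglyMeasurable
    ((measurable_quadTerm q).sub_const _).aestronglyMeasurable
  have h0 : ∫ z, (quadTerm z p - meanCvM PX PY) ∂(poolLaw m n PX PY) = 0 := by
    rw [integral_sub (integrable_of_abs_le_one (measurable_quadTerm p) fun z =>
      abs_quadTerm_le z p) (integrable_const _), integral_quadTerm PX PY hp]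
    simp
  have h' : ∫ z, (quadTerm z p - meanCvM PX PY) * (quadTerm z q - meanCvM PX PY)
      ∂(poolLaw m n PX PY) = (∫ z, (quadTerm z p - meanCvM PX PY) ∂(poolLaw m n PX PY)) *
        ∫ z, (quadTerm z q - meanCvM PX PY) ∂(poolLaw m n PX PY) := h
  rw [h', h0, zero_mul]

theorem meanCvM_mem : -(2 / 3) ≤ meanCvM PX PY ∧ meanCvM PX PY ≤ 1 / 3 := by
  have hX : ∀ (P Q : Measure (Eucl d)) [IsProbabilityMeasure P] [IsProbabilityMeasure Q],
      -(1 / 3) ≤ meanKer P P Q ∧ meanKer P P Q ≤ 1 / 6 := by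
    intro P Q _ _
    have hi := integrable_angKer (Q.prod (P.prod P))
    constructor
    · have := integral_mono (integrable_const (-(1 / 3) : ℝ)) hi
        fun p => (angKer_mem p.1 p.2.1 p.2.2).1
      simpa [meanKer] using this
    · have := integral_mono hi (integrable_const (1 / 6 : ℝ))
        fun p => (angKer_mem p.1 p.2.1 p.2.2).2
      simpa [meanKer] using this
  have h1 := hX PX PY
  have h2 := hX PY PX
  unfold meanCvM
  constructor <;> linarith

/-- The variance of the statistic. -/
theorem integral_UCvM_sub_sq_le (hm : 2 ≤ m) (hn : 2 ≤ n) :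
    ∫ z, (UCvM (fun i => z (Sum.inl i)) (fun j => z (Sum.inr j)) - meanCvM PX PY) ^ 2
      ∂(poolLaw m n PX PY) ≤ 4 / m + 4 / n := by
  have hM := quadIndex_card_pos hm hn
  set θ := meanCvM PX PY with hθ
  have hθm := meanCvM_mem PX PY
  -- The kernel and its mean both lie in `[-2/3, 1/3]`, an interval of length one.
  have habs : ∀ (z : Fin m ⊕ Fin n → Eucl d) p, |quadTerm z p - θ| ≤ 1 := by
    intro z p
    have h := hCvM_mem (z (Sum.inl p.1.1)) (z (Sum.inl p.1.2)) (z (Sum.inr p.2.1))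
      (z (Sum.inr p.2.2))
    rw [quadTerm, abs_le]
    constructor <;> linarith
  have habs2 : ∀ (z : Fin m ⊕ Fin n → Eucl d) p q,
      |(quadTerm z p - θ) * (quadTerm z q - θ)| ≤ 1 := fun z p q => by
    rw [abs_mul]; exact mul_le_one₀ (habs z p) (abs_nonneg _) (habs z q)
  have hint : ∀ p q, Integrable (fun z : Fin m ⊕ Fin n → Eucl d =>
      (quadTerm z p - θ) * (quadTerm z q - θ)) (poolLaw m n PX PY) := fun p q =>
    integrable_of_abs_le_one (((measurable_quadTerm p).sub_const _).mul
      ((measurable_quadTerm q).sub_const _)) fun z => habs2 z p q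
  have heq : ∀ z : Fin m ⊕ Fin n → Eucl d,
      (UCvM (fun i => z (Sum.inl i)) (fun j => z (Sum.inr j)) - θ) ^ 2 =
        1 / ((quadIndex m n).card : ℝ) ^ 2 *
          ∑ p ∈ quadIndex m n, ∑ q ∈ quadIndex m n, (quadTerm z p - θ) * (quadTerm z q - θ) := by
    intro z
    rw [← sq_average_eq, UCvM_eq, Finset.sum_sub_distrib, Finset.sum_const, nsmul_eq_mul]
    congr 1
    field_simp
  simp_rw [heq]
  rw [integral_const_mul, integral_finsetSum _ fun p _ => integrable_finsetSum _ fun q _ => hint p q]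
  simp_rw [integral_finsetSum _ fun q _ => hint _ q]
  rw [one_div, inv_mul_le_iff₀ (by positivity), mul_comm]
  refine sum_quadIndex_le hm hn _ (fun p q => ?_) fun p hp q _ hpq =>
    integral_sub_mul_sub_eq_zero PX PY hp hpq
  have := integral_mono (hint p q) (integrable_const (1 : ℝ))
    fun z => (le_abs_self _).trans (habs2 z p q)
  simpa using this

theorem ae_injective_poolLaw [NullSingletonClass PX] [NullSingletonClass PY] :
    ∀ᵐ z ∂(poolLaw m n PX PY), Function.Injective z := by
  have h : ∀ a b : Fin m ⊕ Fin n, a ≠ b → ∀ᵐ z ∂(poolLaw m n PX PY), z a ≠ z b := by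
    intro a b hab
    have hI := iIndepFun_poolLaw (m := m) (n := n) PX PY
    have hmap : ∀ k : Fin m ⊕ Fin n, (poolLaw m n PX PY).map (fun z => z k) =
        (Sum.elim (fun _ => PX) fun _ => PY : Fin m ⊕ Fin n → Measure (Eucl d)) k :=
      fun k => (measurePreserving_eval _ k).map_eq
    have h1 := (ProbabilityTheory.indepFun_iff_map_prod_eq_prod_map_map
      (measurable_pi_apply a).aemeasurable (measurable_pi_apply b).aemeasurable).mp
      (hI.indepFun hab)
    have : NullSingletonClass ((Sum.elim (fun _ => PX) fun _ => PY :
        Fin m ⊕ Fin n → Measure (Eucl d)) b) := by cases b <;> simpa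
    rw [hmap a, hmap b] at h1
    have h2 := ae_fst_ne_snd ((Sum.elim (fun _ => PX) fun _ => PY :
        Fin m ⊕ Fin n → Measure (Eucl d)) a) ((Sum.elim (fun _ => PX) fun _ => PY :
        Fin m ⊕ Fin n → Measure (Eucl d)) b)
    rw [← h1] at h2
    exact ae_of_ae_map (f := fun z : Fin m ⊕ Fin n → Eucl d => (z a, z b))
      (p := fun q => q.1 ≠ q.2) (by fun_prop) h2
  have h' : ∀ᵐ z ∂(poolLaw m n PX PY), ∀ a b : Fin m ⊕ Fin n, a ≠ b → z a ≠ z b := by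
    rw [ae_all_iff]; intro a
    rw [ae_all_iff]; intro b
    by_cases hab : a = b
    · exact ae_of_all _ fun z hne => absurd hab hne
    · filter_upwards [h a b hab] with z hz _ using hz
  filter_upwards [h'] with z hz a b hab
  by_contra hne
  exact hz a b hne hab

theorem measurePreserving_pool : MeasurePreserving
    (fun S : (Fin m → Eucl d) × (Fin n → Eucl d) => (Sum.elim S.1 S.2 : Fin m ⊕ Fin n → Eucl d))
    ((Measure.pi fun _ : Fin m => PX).prod (Measure.pi fun _ : Fin n => PY))
    (poolLaw m n PX PY) := by
  have h := measurePreserving_sumPiEquivProdPi_symm (X := fun _ : Fin m ⊕ Fin n => Eucl d)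
    (Sum.elim (fun _ => PX) fun _ => PY)
  convert! h using 1

end Variance

/-! ### The permutation critical value as a quantile -/

section Quantile

variable {d m n : ℕ} (T : (Fin m → Eucl d) → (Fin n → Eucl d) → ℝ) {α : ℝ}

theorem permCriticalValue_le (hα : α < 1) (X : Fin m → Eucl d) (Y : Fin n → Eucl d) {t : ℝ}
    (ht : ((Finset.univ.filter fun σ : Equiv.Perm (Fin (m + n)) => t < permStat T X Y σ).card : ℝ)
      ≤ α * Nat.factorial (m + n)) : permCriticalValue T α X Y ≤ t := by
  have hN : (0 : ℝ) < Nat.factorial (m + n) := by positivity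
  refine csInf_le ?_ ?_
  -- The infimum is genuine: below every permuted value the proportion is zero, which is less than
  -- `1 - α`.
  · obtain ⟨b, hb⟩ := (Set.finite_range (permStat T X Y)).bddBelow
    refine ⟨b, fun s hs => ?_⟩
    by_contra hsb
    push Not at hsb
    have hzero : ∀ σ ∈ (Finset.univ : Finset (Equiv.Perm (Fin (m + n)))),
        (if permStat T X Y σ ≤ s then (1 : ℝ) else 0) = 0 := fun σ _ =>
      if_neg (not_le.mpr (hsb.trans_le (hb ⟨σ, rfl⟩)))
    have hs' : 1 - α ≤ 1 / (Nat.factorial (m + n) : ℝ) *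
      ∑ σ : Equiv.Perm (Fin (m + n)), if permStat T X Y σ ≤ s then (1 : ℝ) else 0 := hs
    rw [Finset.sum_eq_zero hzero, mul_zero] at hs'
    linarith
  · change 1 - α ≤ 1 / (Nat.factorial (m + n) : ℝ) *
      ∑ σ : Equiv.Perm (Fin (m + n)), if permStat T X Y σ ≤ t then (1 : ℝ) else 0
    have hc := Finset.card_filter_add_card_filter_not (s := (Finset.univ :
      Finset (Equiv.Perm (Fin (m + n))))) (fun σ => permStat T X Y σ ≤ t)
    simp only [not_le] at hc
    rw [Finset.card_univ, Fintype.card_perm, Fintype.card_fin] at hc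
    have hc' : ((Finset.univ.filter fun σ : Equiv.Perm (Fin (m + n)) =>
        permStat T X Y σ ≤ t).card : ℝ) + ((Finset.univ.filter fun σ : Equiv.Perm (Fin (m + n)) =>
        t < permStat T X Y σ).card : ℝ) = Nat.factorial (m + n) := by exact_mod_cast hc
    rw [Finset.sum_boole, one_div, ← div_eq_inv_mul, le_div_iff₀ hN]
    linarith

/-- A rejection means that at least a proportion `1 - α` of the permuted values lie strictly below
the observed one. The strictness lets the comparison survive the approximation of the energy
statistic. -/
theorem le_card_of_permCriticalValue_lt {X : Fin m → Eucl d} {Y : Fin n → Eucl d} {t : ℝ}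
    (hα : 0 ≤ α) (ht : permCriticalValue T α X Y < t) : (1 - α) * Nat.factorial (m + n) ≤
      ((Finset.univ.filter fun σ : Equiv.Perm (Fin (m + n)) => permStat T X Y σ < t).card : ℝ) := by
  have hN : (0 : ℝ) < Nat.factorial (m + n) := by positivity
  obtain ⟨s, hs, hst⟩ := exists_lt_of_csInf_lt (by
    obtain ⟨b, hb⟩ := (Set.finite_range (permStat T X Y)).bddAbove
    refine ⟨b, ?_⟩
    change 1 - α ≤ 1 / (Nat.factorial (m + n) : ℝ) *
      ∑ σ : Equiv.Perm (Fin (m + n)), if permStat T X Y σ ≤ b then (1 : ℝ) else 0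
    simp only [if_pos (hb ⟨_, rfl⟩), Finset.sum_const, Finset.card_univ, Fintype.card_perm,
      Fintype.card_fin, nsmul_eq_mul, mul_one]
    rw [one_div, inv_mul_cancel₀ hN.ne']
    linarith) ht
  change 1 - α ≤ 1 / (Nat.factorial (m + n) : ℝ) *
    ∑ σ : Equiv.Perm (Fin (m + n)), if permStat T X Y σ ≤ s then (1 : ℝ) else 0 at hs
  rw [Finset.sum_boole, one_div, ← div_eq_inv_mul, le_div_iff₀ hN] at hs
  refine hs.trans ?_
  exact_mod_cast Finset.card_le_card fun σ hσ => by
    simp only [Finset.mem_filter, Finset.mem_univ, true_and] at hσ ⊢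
    exact hσ.trans_lt hst

end Quantile

/-! ### Power of the CvM test -/

section Power

variable {d m n : ℕ} (PX PY : Measure (Eucl d)) [IsProbabilityMeasure PX] [IsProbabilityMeasure PY]

theorem permStat_permCongr (T : (Fin m → Eucl d) → (Fin n → Eucl d) → ℝ) (X : Fin m → Eucl d)
    (Y : Fin n → Eucl d) (σ : Equiv.Perm (Fin m ⊕ Fin n)) :
    permStat T X Y (finSumFinEquiv.permCongr σ) =
      T (fun i => Sum.elim X Y (σ (Sum.inl i))) (fun j => Sum.elim X Y (σ (Sum.inr j))) := by
  have h : ∀ k : Fin m ⊕ Fin n, Fin.append X Y (finSumFinEquiv k) = Sum.elim X Y k := by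
    rintro (i | j) <;> simp
  simp only [permStat, Equiv.permCongr_apply, finSumFinEquiv_symm_apply_castAdd,
    finSumFinEquiv_symm_apply_natAdd, h]

theorem sum_permStat_UCvM_sq_le (hm : 2 ≤ m) (hn : 2 ≤ n) {X : Fin m → Eucl d}
    {Y : Fin n → Eucl d} (hz : Function.Injective (Sum.elim X Y)) :
    ∑ σ : Equiv.Perm (Fin (m + n)), permStat UCvM X Y σ ^ 2 ≤
      (4 / m + 4 / n) * (Nat.factorial (m + n) : ℝ) := by
  rw [← Equiv.sum_comp finSumFinEquiv.permCongr]
  simp_rw [permStat_permCongr]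
  exact sum_perm_UCvM_sq_le hm hn hz

theorem permCriticalValue_UCvM_le (hm : 2 ≤ m) (hn : 2 ≤ n) {α : ℝ} (hα : α < 1) {t : ℝ}
    (ht : 0 < t) (hv : (4 / m + 4 / n : ℝ) ≤ α * t ^ 2) {X : Fin m → Eucl d}
    {Y : Fin n → Eucl d} (hz : Function.Injective (Sum.elim X Y)) :
    permCriticalValue UCvM α X Y ≤ t := by
  refine permCriticalValue_le _ hα X Y ?_
  have h := sum_permStat_UCvM_sq_le hm hn hz
  set A := Finset.univ.filter fun σ : Equiv.Perm (Fin (m + n)) => t < permStat UCvM X Y σ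
  -- Markov's inequality for the squared statistic under the permutation distribution.
  have h1 : (A.card : ℝ) * t ^ 2 ≤ ∑ σ : Equiv.Perm (Fin (m + n)), permStat UCvM X Y σ ^ 2 := by
    rw [← nsmul_eq_mul]
    refine (Finset.card_nsmul_le_sum A (fun σ => permStat UCvM X Y σ ^ 2) _ fun σ hσ => ?_).trans
      (Finset.sum_le_univ_sum_of_nonneg fun σ => sq_nonneg _)
    have : t < permStat UCvM X Y σ := (Finset.mem_filter.mp hσ).2
    exact pow_le_pow_left₀ ht.le this.le 2
  have hN : (0 : ℝ) < Nat.factorial (m + n) := by positivity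
  have h2 := mul_le_mul_of_nonneg_right hv hN.le
  have ht2 : 0 < t ^ 2 := by positivity
  have h3 : (A.card : ℝ) * t ^ 2 ≤ (α * Nat.factorial (m + n)) * t ^ 2 := by linarith
  exact le_of_mul_le_mul_right h3 ht2

/-- A nonasymptotic lower bound for the power of the permutation Cramér-von Mises test. -/
theorem one_le_permTestPower_UCvM_add [NullSingletonClass PX] [NullSingletonClass PY]
    (hm : 2 ≤ m) (hn : 2 ≤ n) {α : ℝ} (hα : α < 1) {t : ℝ}
    (ht : 0 < t) (hv : (4 / m + 4 / n : ℝ) ≤ α * t ^ 2) (hmean : 2 * t ≤ meanCvM PX PY) :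
    1 ≤ permTestPower (UCvM (m := m) (n := n)) α PX PY +
      ENNReal.ofReal ((4 / m + 4 / n) / t ^ 2) := by
  have hmp := measurePreserving_pool (m := m) (n := n) PX PY
  set μ := (Measure.pi fun _ : Fin m => PX).prod (Measure.pi fun _ : Fin n => PY)
  set U : (Fin m ⊕ Fin n → Eucl d) → ℝ := fun z =>
    UCvM (fun i => z (Sum.inl i)) (fun j => z (Sum.inr j)) with hU
  have hUm : Measurable U := measurable_UCvM
  have hUb : ∀ z, |(U z - meanCvM PX PY) ^ 2| ≤ (|U z| + |meanCvM PX PY|) ^ 2 := fun z => by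
    rw [abs_pow]; exact pow_le_pow_left₀ (abs_nonneg _) (abs_sub _ _) 2
  have hlow : (poolLaw m n PX PY) {z | U z ≤ t} ≤ ENNReal.ofReal ((4 / m + 4 / n) / t ^ 2) := by
    have hvar := integral_UCvM_sub_sq_le PX PY hm hn
    have hUle : ∀ z, |U z| ≤ 1 := fun z => by
      have hM := quadIndex_card_pos hm hn
      rw [hU]; simp only [UCvM_eq]
      rw [one_div, abs_mul, abs_of_pos (inv_pos.mpr hM), inv_mul_le_iff₀ hM, mul_one]
      refine (Finset.abs_sum_le_sum_abs _ _).trans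
        ((Finset.sum_le_card_nsmul _ _ 1 fun p _ => abs_quadTerm_le z p).trans (by simp))
    have hint : Integrable (fun z => (U z - meanCvM PX PY) ^ 2) (poolLaw m n PX PY) :=
      Integrable.of_bound ((hUm.sub_const _).pow_const 2).aestronglyMeasurable
        ((1 + |meanCvM PX PY|) ^ 2) (ae_of_all _ fun z => (hUb z).trans
          (pow_le_pow_left₀ (by positivity) (by linarith [hUle z]) 2))
    have hmk := mul_meas_ge_le_integral_of_nonneg (ae_of_all _ fun z => sq_nonneg
      (U z - meanCvM PX PY)) hint (t ^ 2)
    -- The mean is at least `2 t`, so `U ≤ t` is a deviation of at least `t`.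
    have hsub : {z | U z ≤ t} ⊆ {z | t ^ 2 ≤ (U z - meanCvM PX PY) ^ 2} := fun z hz => by
      have hz' : U z ≤ t := hz
      change t ^ 2 ≤ (U z - meanCvM PX PY) ^ 2
      nlinarith
    have h1 : (poolLaw m n PX PY).real {z | U z ≤ t} ≤ (4 / m + 4 / n) / t ^ 2 := by
      rw [le_div_iff₀ (by positivity)]
      have := measureReal_mono (μ := poolLaw m n PX PY) hsub
      have ht2 : 0 < t ^ 2 := by positivity
      nlinarith
    rw [← ofReal_measureReal]
    exact ENNReal.ofReal_le_ofReal h1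
  have hinj : μ {S | ¬ Function.Injective (Sum.elim S.1 S.2)} = 0 := by
    have h := ae_injective_poolLaw (m := m) (n := n) PX PY
    have h' := hmp.quasiMeasurePreserving.ae h
    rwa [ae_iff] at h'
  have hlow' : μ {S | UCvM S.1 S.2 ≤ t} ≤ ENNReal.ofReal ((4 / m + 4 / n) / t ^ 2) := by
    rw [← hmp.measure_preimage (measurableSet_le hUm measurable_const).nullMeasurableSet] at hlow
    exact hlow
  -- Covering the whole space and using subadditivity avoids the measurability of the rejection
  -- event.
  have hcover : (Set.univ : Set ((Fin m → Eucl d) × (Fin n → Eucl d))) ⊆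
      ({S | permCriticalValue UCvM α S.1 S.2 < UCvM S.1 S.2} ∪ {S | UCvM S.1 S.2 ≤ t}) ∪
        {S | ¬ Function.Injective (Sum.elim S.1 S.2)} := by
    intro S _
    by_cases h1 : Function.Injective (Sum.elim S.1 S.2)
    · left
      by_cases h2 : UCvM S.1 S.2 ≤ t
      · exact Or.inr h2
      · exact Or.inl ((permCriticalValue_UCvM_le hm hn hα ht hv h1).trans_lt (not_le.mp h2))
    · exact Or.inr h1
  calc (1 : ℝ≥0∞) = μ Set.univ := measure_univ.symm
    _ ≤ _ := measure_mono hcover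
    _ ≤ _ := measure_union_le _ _
    _ = μ ({S | permCriticalValue UCvM α S.1 S.2 < UCvM S.1 S.2} ∪ {S | UCvM S.1 S.2 ≤ t}) := by
        rw [hinj, add_zero]
    _ ≤ _ := measure_union_le _ _
    _ ≤ _ := by
        gcongr
        exact le_rfl

/-- The permutation Cramér-von Mises test is powerful uniformly over contaminations. -/
theorem tendsto_iInf_cvmPower (hd : 1 ≤ d) {α ε : ℝ} (hα : α ∈ Set.Ioo (0 : ℝ) 1)
    (hε : ε ∈ Set.Ioo (0 : ℝ) 1) (QX QY : Measure (Eucl d))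
    [IsProbabilityMeasure QX] [IsProbabilityMeasure QY] (hQ : QX ≠ QY)
    (hXc : ProjContinuous QX) (hYc : ProjContinuous QY) :
    Tendsto (fun p : ℕ × ℕ =>
        ⨅ (G : ProbabilityMeasure (Eucl d)) (_ : ProjContinuous (G : Measure (Eucl d))),
          cvmPower α ε QX QY G p.1 p.2)
      (atTop ×ˢ atTop) (𝓝 1) := by
  have := hXc.nullSingletonClass hd
  have := hYc.nullSingletonClass hd
  set δ := (1 - ε) ^ 3 * ((sqGap QX QY QX + sqGap QX QY QY) / 2) with hδ
  have hδ0 : 0 < δ := mul_pos (pow_pos (by linarith [hε.2]) 3) (sqGap_pos hQ)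
  -- Half the uniform lower bound on the mean: the critical value stays below `t`, the statistic
  -- above it.
  set t := δ / 2 with ht
  have ht0 : 0 < t := by positivity
  have hv : Tendsto (fun p : ℕ × ℕ => (4 / p.1 + 4 / p.2 : ℝ)) (atTop ×ˢ atTop) (𝓝 0) := by
    have h1 := (tendsto_const_div_atTop_nhds_zero_nat (4 : ℝ)).comp
      (tendsto_fst (f := (atTop : Filter ℕ)) (g := (atTop : Filter ℕ)))
    have h2 := (tendsto_const_div_atTop_nhds_zero_nat (4 : ℝ)).comp
      (tendsto_snd (f := (atTop : Filter ℕ)) (g := (atTop : Filter ℕ)))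
    simpa using h1.add h2
  have hev : ∀ᶠ p : ℕ × ℕ in atTop ×ˢ atTop, 1 - ENNReal.ofReal ((4 / p.1 + 4 / p.2) / t ^ 2) ≤
      ⨅ (G : ProbabilityMeasure (Eucl d)) (_ : ProjContinuous (G : Measure (Eucl d))),
          cvmPower α ε QX QY G p.1 p.2 := by
    have hsmall : ∀ᶠ p : ℕ × ℕ in atTop ×ˢ atTop, (4 / p.1 + 4 / p.2 : ℝ) ≤ α * t ^ 2 :=
      (hv.eventually_lt_const (mul_pos hα.1 (by positivity))).mono fun _ h => h.le
    filter_upwards [hsmall, (eventually_ge_atTop 2).prod_mk (eventually_ge_atTop 2)]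
      with p hp h2
    refine le_iInf₂ fun G hG => ?_
    have := hG.nullSingletonClass hd
    have := isProbabilityMeasure_contaminate hε QX (G : Measure (Eucl d))
    have := isProbabilityMeasure_contaminate hε QY (G : Measure (Eucl d))
    have := nullSingletonClass_contaminate (ε := ε) QX (G : Measure (Eucl d))
    have := nullSingletonClass_contaminate (ε := ε) QY (G : Measure (Eucl d))
    rw [tsub_le_iff_right]
    refine one_le_permTestPower_UCvM_add _ _ h2.1 h2.2 hα.2 ht0 hp ?_
    rw [ht, mul_div_cancel₀ _ two_ne_zero]
    exact mean_contaminate_ge hε QX QY G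
  have hlim : Tendsto (fun p : ℕ × ℕ => 1 - ENNReal.ofReal ((4 / p.1 + 4 / p.2) / t ^ 2))
      (atTop ×ˢ atTop) (𝓝 1) := by
    have h1 : Tendsto (fun p : ℕ × ℕ => ENNReal.ofReal ((4 / p.1 + 4 / p.2) / t ^ 2))
        (atTop ×ˢ atTop) (𝓝 (ENNReal.ofReal (0 / t ^ 2))) :=
      ENNReal.tendsto_ofReal (hv.div_const _)
    rw [zero_div, ENNReal.ofReal_zero] at h1
    have h2 := ENNReal.Tendsto.sub (tendsto_const_nhds (x := (1 : ℝ≥0∞))) h1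
      (Or.inl ENNReal.one_ne_top)
    simpa using h2
  refine tendsto_of_tendsto_of_tendsto_of_le_of_le' hlim tendsto_const_nhds hev ?_
  refine Eventually.of_forall fun p => ?_
  -- An admissible law is needed for the upper bound, since an empty infimum would be infinite; `QX`
  -- itself serves.
  let G : ProbabilityMeasure (Eucl d) := ⟨QX, inferInstance⟩
  have := isProbabilityMeasure_contaminate hε QX (G : Measure (Eucl d))
  have := isProbabilityMeasure_contaminate hε QY (G : Measure (Eucl d))
  exact (iInf₂_le G hXc).trans prob_le_one

end Power

/-! ### Anticoncentration of the hypergeometric distribution -/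

section Hypergeometric

/-- A sequence with the hypergeometric recursion is flat to the right of a point where it does not
decrease much. -/
theorem hypergeometric_flat_right {c η : ℝ} (hc : 0 < c) (hη : 0 < η) :
    ∃ N₀ : ℕ, ∀ (m n K a : ℕ) (H : ℕ → ℝ) (F : ℝ), N₀ ≤ m + n → c * ((m : ℝ) + n) ≤ m →
      c * ((m : ℝ) + n) ≤ n → c * ((m : ℝ) + n) ≤ K → c * ((m : ℝ) + n) ≤ (m : ℝ) + n - K →
      (∀ i, 0 ≤ H i) →
      (∀ i : ℕ, ((i : ℝ) + 1) * ((n : ℝ) - K + i + 1) * H (i + 1) =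
        ((m : ℝ) - i) * ((K : ℝ) - i) * H i) →
      (∀ J, ∑ j ∈ Finset.range J, H (a + j) ≤ F) → a ≤ m → a ≤ K → K ≤ n + a →
      ((a : ℝ) + 1) * ((n : ℝ) - K + a + 1) - 5 * ((m : ℝ) + n) ≤
        ((m : ℝ) - a) * ((K : ℝ) - a) → H a ≤ η * F := by
  -- The aim is that `J` consecutive values from `a` on are all at least `H a / 2`; then `J * H a /
  -- 2 ≤ F`, and `J ≥ 2 / η` suffices.
  obtain ⟨J, hJ⟩ := exists_nat_ge (max 1 (2 / η))
  have hJ1 : (1 : ℝ) ≤ J := (le_max_left _ _).trans hJ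
  have hJ2 : 2 / η ≤ J := (le_max_right _ _).trans hJ
  -- Over `J` steps the two factors of the recursion drift apart by at most `C * N`: 5 is the
  -- initial slack, `4 * J` comes from the linear changes of both factors, and `J ^ 2` from the
  -- quadratic change of the denominator.
  set C : ℝ := 5 + 4 * J + J ^ 2 with hC
  set κ : ℝ := c ^ 4 / 16 with hκ
  have hκ0 : 0 < κ := by positivity
  obtain ⟨N₀, hN₀⟩ := exists_nat_ge (max 2 (max (10 / c ^ 2) ((2 * J * C + 2 * J) / κ)))
  refine ⟨N₀, fun m n K a H F hN hm hn hK hK' hH hrec hF ham haK hKn hcond => ?_⟩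
  have hN' : (N₀ : ℝ) ≤ (m : ℝ) + n := by exact_mod_cast hN
  have ham' : (a : ℝ) ≤ m := by exact_mod_cast ham
  have haK' : (a : ℝ) ≤ K := by exact_mod_cast haK
  have hKn' : (K : ℝ) ≤ n + a := by exact_mod_cast hKn
  have ha0 : (0 : ℝ) ≤ a := Nat.cast_nonneg a
  have hn0 : (0 : ℝ) ≤ n := Nat.cast_nonneg n
  have haN : (a : ℝ) * ((m : ℝ) + n + 2) ≤ m * K + K - n - 1 + 5 * ((m : ℝ) + n) := by
    linear_combination hcond
  set N : ℝ := (m : ℝ) + n with hNdef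
  clear_value N κ
  have hN2 : 2 ≤ N := ((le_max_left _ _).trans hN₀).trans hN'
  have hN3 : 10 ≤ c ^ 2 * N := by
    have := ((le_max_left _ _).trans ((le_max_right _ _).trans hN₀)).trans hN'
    rw [div_le_iff₀ (by positivity)] at this; linarith
  have hN4 : 2 * J * C + 2 * J ≤ κ * N := by
    have := ((le_max_right _ _).trans ((le_max_right _ _).trans hN₀)).trans hN'
    rw [div_le_iff₀ hκ0] at this; linarith
  have hcN : 0 ≤ c * N := by positivity
  have hmK : c ^ 2 * N ^ 2 ≤ m * (N - K) := by
    calc c ^ 2 * N ^ 2 = (c * N) * (c * N) := by ring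
      _ ≤ m * (N - K) := mul_le_mul hm hK' hcN (Nat.cast_nonneg m)
  have hnK : c ^ 2 * N ^ 2 ≤ K * n := by
    calc c ^ 2 * N ^ 2 = (c * N) * (c * N) := by ring
      _ ≤ K * n := mul_le_mul hK hn hcN (Nat.cast_nonneg K)
  have hhalf : 5 * N ≤ c ^ 2 * N ^ 2 / 2 := by
    linarith [mul_le_mul_of_nonneg_right hN3 (show 0 ≤ N by linarith)]
  have hKN : (K : ℝ) ≤ N := by linarith
  -- The slack condition keeps `a` at most slightly above the mode, so `m - a` and `K - a` are of
  -- order `N`. Their product, of order `N ^ 2`, swamps the drift `C * N`.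
  have h1 : c ^ 2 * N / 4 ≤ m - a := by
    have : c ^ 2 * N ^ 2 / 2 ≤ (m - a) * (N + 2) := by linarith
    have h3 : ((m : ℝ) - a) * (N + 2) ≤ (m - a) * (2 * N) :=
      mul_le_mul_of_nonneg_left (by linarith) (by linarith)
    have h4 : (c ^ 2 * N / 4) * (2 * N) ≤ (m - a) * (2 * N) := by linarith
    exact le_of_mul_le_mul_right h4 (by linarith)
  have h2 : c ^ 2 * N / 4 ≤ K - a := by
    have : c ^ 2 * N ^ 2 / 2 ≤ (K - a) * (N + 2) := by
      have hKN2 : (K : ℝ) * N = K * m + K * n := by rw [hNdef]; ring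
      linarith
    have h3 : ((K : ℝ) - a) * (N + 2) ≤ (K - a) * (2 * N) :=
      mul_le_mul_of_nonneg_left (by linarith) (by linarith)
    have h4 : (c ^ 2 * N / 4) * (2 * N) ≤ (K - a) * (2 * N) := by linarith
    exact le_of_mul_le_mul_right h4 (by linarith)
  have hA0 : κ * N ^ 2 ≤ (m - a) * (K - a) := by
    calc κ * N ^ 2 = (c ^ 2 * N / 4) * (c ^ 2 * N / 4) := by rw [hκ]; ring
      _ ≤ _ := mul_le_mul h1 h2 (by positivity) (by linarith)
  have hstep : ∀ j : ℕ, j ≤ J → (1 - 1 / (2 * J)) * H (a + j) ≤ H (a + j + 1) := by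
    intro j hj
    have hj' : (j : ℝ) ≤ J := by exact_mod_cast hj
    have hj0 : (0 : ℝ) ≤ j := Nat.cast_nonneg j
    have hr := hrec (a + j)
    push_cast at hr
    set A : ℝ := ((m : ℝ) - (a + j)) * (K - (a + j)) with hA
    set B : ℝ := ((a : ℝ) + j + 1) * (n - K + (a + j) + 1) with hB
    have hB0 : 0 < B := mul_pos (by linarith) (by linarith)
    have hAj : (m - a) * (K - a) - 2 * J * N ≤ A := by
      have : A = (m - a) * (K - a) - j * ((m - a) + (K - a)) + j ^ 2 := by rw [hA]; ring
      have h5 : (j : ℝ) * ((m - a) + (K - a)) ≤ J * (2 * N) :=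
        mul_le_mul hj' (by linarith) (by linarith) (by linarith)
      linarith [sq_nonneg (j : ℝ)]
    have hBj : B ≤ ((a : ℝ) + 1) * (n - K + a + 1) + 2 * J * N + J ^ 2 * N := by
      have : B = ((a : ℝ) + 1) * (n - K + a + 1) + j * (a + 1 + (n - K + a + 1)) + j ^ 2 := by
        rw [hB]; ring
      have h5 : (j : ℝ) * (a + 1 + (n - K + a + 1)) ≤ J * (2 * N) :=
        mul_le_mul hj' (by linarith) (by linarith) (by linarith)
      have h6 : (j : ℝ) ^ 2 ≤ J ^ 2 := pow_le_pow_left₀ hj0 hj' 2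
      have h7 : (J : ℝ) ^ 2 ≤ J ^ 2 * N := le_mul_of_one_le_right (by positivity) (by linarith)
      linarith
    have hAB : B - C * N ≤ A := by rw [hC]; linarith
    have hJ0 : (0 : ℝ) < 2 * J := by linarith
    -- `A / B` is the ratio of consecutive values. If `B` exceeds `A`, it is itself of order `N ^
    -- 2`, and the drift costs at most a fraction `1 / (2 * J)`.
    have hratio : (1 - 1 / (2 * J)) * B ≤ A := by
      rcases le_total B A with hle | hle
      · have : 0 ≤ 1 / (2 * (J : ℝ)) * B := by positivity
        linarith
      · have h8 : 2 * J * C * N ≤ B := by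
          have : κ * N ^ 2 - 2 * J * N ≤ B := by linarith
          linarith [mul_le_mul_of_nonneg_right hN4 (show 0 ≤ N by linarith)]
        have h9 : C * N ≤ 1 / (2 * J) * B := by
          rw [one_div, inv_mul_eq_div, le_div_iff₀ hJ0]; linarith
        linarith
    have h10 : B * ((1 - 1 / (2 * J)) * H (a + j)) ≤ B * H (a + j + 1) := by
      rw [hr]
      calc B * ((1 - 1 / (2 * J)) * H (a + j)) = ((1 - 1 / (2 * J)) * B) * H (a + j) := by ring
        _ ≤ A * H (a + j) := mul_le_mul_of_nonneg_right hratio (hH _)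
    exact le_of_mul_le_mul_left h10 hB0
  have hx1 : 1 / (2 * (J : ℝ)) ≤ 1 / 2 := by
    rw [div_le_div_iff₀ (by linarith) (by norm_num)]; linarith
  have hx0 : 0 ≤ 1 / (2 * (J : ℝ)) := by positivity
  have hlow : ∀ j : ℕ, j ≤ J → (1 - j * (1 / (2 * J))) * H a ≤ H (a + j) := by
    intro j
    induction j with
    | zero => intro _; simp
    | succ j ih =>
      intro hj
      have e1 := ih (by omega)
      have e2 := hstep j (by omega)
      have e3 : (1 - 1 / (2 * (J : ℝ))) * ((1 - j * (1 / (2 * J))) * H a) ≤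
          (1 - 1 / (2 * J)) * H (a + j) := mul_le_mul_of_nonneg_left e1 (by linarith)
      have e4 : (0 : ℝ) ≤ j * (1 / (2 * J)) * (1 / (2 * J)) * H a :=
        mul_nonneg (by positivity) (hH a)
      rw [← add_assoc]
      push_cast
      linarith
  have hhalfH : ∀ j ∈ Finset.range J, H a / 2 ≤ H (a + j) := by
    intro j hj
    have hj' : (j : ℝ) ≤ J := by exact_mod_cast (Finset.mem_range.mp hj).le
    have e1 := hlow j (Finset.mem_range.mp hj).le
    have e2 : (j : ℝ) * (1 / (2 * J)) ≤ 1 / 2 := by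
      rw [mul_one_div, div_le_div_iff₀ (by linarith) (by norm_num)]; linarith
    linarith [mul_le_mul_of_nonneg_right e2 (hH a)]
  have hsum := (Finset.card_nsmul_le_sum _ _ _ hhalfH).trans (hF J)
  rw [Finset.card_range, nsmul_eq_mul] at hsum
  rw [div_le_iff₀ hη] at hJ2
  linarith [mul_le_mul_of_nonneg_left hsum hη.le, mul_le_mul_of_nonneg_right hJ2 (hH a)]

/-- The hypergeometric distribution does not concentrate. -/
theorem hypergeometric_anticoncentration {c η : ℝ} (hc : 0 < c) (hη : 0 < η) :
    ∃ N₀ : ℕ, ∀ (m n K a : ℕ) (H : ℕ → ℝ) (F : ℝ), N₀ ≤ m + n → c * ((m : ℝ) + n) ≤ m →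
      c * ((m : ℝ) + n) ≤ n → c * ((m : ℝ) + n) ≤ K → c * ((m : ℝ) + n) ≤ (m : ℝ) + n - K →
      (∀ i, 0 ≤ H i) →
      (∀ i : ℕ, ((i : ℝ) + 1) * ((n : ℝ) - K + i + 1) * H (i + 1) =
        ((m : ℝ) - i) * ((K : ℝ) - i) * H i) →
      (∀ s : Finset ℕ, ∑ j ∈ s, H j ≤ F) → a ≤ m → a ≤ K → K ≤ n + a → H a ≤ η * F := by
  obtain ⟨N₀, hN₀⟩ := hypergeometric_flat_right hc hη
  refine ⟨max N₀ 1, fun m n K a H F hN hm hn hK hK' hH hrec hF ham haK hKn => ?_⟩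
  have hN1 : (1 : ℝ) ≤ (m : ℝ) + n := by exact_mod_cast (le_max_right _ _).trans hN
  have ham' : (a : ℝ) ≤ m := by exact_mod_cast ham
  have haK' : (a : ℝ) ≤ K := by exact_mod_cast haK
  have hKn' : (K : ℝ) ≤ n + a := by exact_mod_cast hKn
  have hn0 : (0 : ℝ) ≤ n := Nat.cast_nonneg n
  have ha0 : (0 : ℝ) ≤ a := Nat.cast_nonneg a
  have hKN : K ≤ m + n := by omega
  by_cases hcond : ((a : ℝ) + 1) * ((n : ℝ) - K + a + 1) - 5 * ((m : ℝ) + n) ≤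
        ((m : ℝ) - a) * ((K : ℝ) - a)
  · refine hN₀ m n K a H F ((le_max_left _ _).trans hN) hm hn hK hK' hH hrec (fun J => ?_) ham haK
      hKn hcond
    have := hF ((Finset.range J).map (addLeftEmbedding a))
    rwa [Finset.sum_map] at this
  · push Not at hcond
    -- Past the mode, count failures instead of successes: the reflected sequence satisfies the same
    -- recursion with `K` replaced by `m + n - K`. The slack `5 (m + n)` ensures that the flatness
    -- condition holds in at least one of the two orientations.
    have key := hN₀ m n (m + n - K) (m - a) (fun i => if i ≤ m then H (m - i) else 0) F
      ((le_max_left _ _).trans hN) hm hn (by rw [Nat.cast_sub hKN]; push_cast; exact hK')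
      (by rw [Nat.cast_sub hKN]; push_cast; linarith) (fun i => by split_ifs <;> simp [hH])
      (fun i => ?_) (fun J => ?_) (Nat.sub_le _ _) (by omega) (by omega) ?_
    · simpa [Nat.sub_sub_self ham] using key
    · rw [Nat.cast_sub hKN]
      push_cast
      rcases lt_trichotomy i m with hi | hi | hi
      · have := hrec (m - (i + 1))
        rw [show m - (i + 1) + 1 = m - i by omega] at this
        rw [Nat.cast_sub hi] at this
        rw [if_pos (Nat.succ_le_of_lt hi), if_pos hi.le]
        push_cast at this
        linear_combination (-1 : ℝ) * this
      · subst hi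
        simp
      · rw [if_neg (by omega), if_neg (by omega)]; simp
    · rw [← Finset.sum_filter]
      have := hF (((Finset.range J).filter fun j => m - a + j ≤ m).image fun j => m - (m - a + j))
      rwa [Finset.sum_image] at this
      intro x hx y hy hxy
      simp only [Finset.coe_filter, Set.mem_ofPred_eq] at hx hy hxy
      omega
    · rw [Nat.cast_sub hKN, Nat.cast_sub ham]
      push_cast
      linarith

/-- The number of successes in the first sample. -/
def leftCount {m n : ℕ} (w : Fin m ⊕ Fin n → Bool) : ℕ :=
  (Finset.univ.filter fun i : Fin m => w (Sum.inl i) = true).card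

/-- The number of successes in the second sample. -/
def rightCount {m n : ℕ} (w : Fin m ⊕ Fin n → Bool) : ℕ :=
  (Finset.univ.filter fun j : Fin n => w (Sum.inr j) = true).card

/-- The number of successes in the pooled sample. -/
def poolCount {m n : ℕ} (w : Fin m ⊕ Fin n → Bool) : ℕ :=
  (Finset.univ.filter fun k : Fin m ⊕ Fin n => w k = true).card

theorem leftCount_add_rightCount {m n : ℕ} (w : Fin m ⊕ Fin n → Bool) :
    leftCount w + rightCount w = poolCount w := by
  simp only [leftCount, rightCount, poolCount, Finset.card_filter, Fintype.sum_sum_type]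

theorem poolCount_comp {m n : ℕ} (w : Fin m ⊕ Fin n → Bool) (σ : Equiv.Perm (Fin m ⊕ Fin n)) :
    poolCount (w ∘ σ) = poolCount w := by
  simp only [poolCount, Finset.card_filter, Function.comp_apply]
  exact Equiv.sum_comp σ fun k => if w k = true then 1 else 0

theorem leftCount_le {m n : ℕ} (w : Fin m ⊕ Fin n → Bool) : leftCount w ≤ m :=
  (Finset.card_filter_le _ _).trans (by simp)

theorem rightCount_le {m n : ℕ} (w : Fin m ⊕ Fin n → Bool) : rightCount w ≤ n :=
  (Finset.card_filter_le _ _).trans (by simp)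

theorem leftCount_comp_swap {m n : ℕ} {w : Fin m ⊕ Fin n → Bool} {i : Fin m} {j : Fin n}
    (hi : w (Sum.inl i) = false) (hj : w (Sum.inr j) = true) :
    leftCount (w ∘ Equiv.swap (Sum.inl i) (Sum.inr j)) = leftCount w + 1 := by
  have h : (Finset.univ.filter fun k : Fin m =>
      (w ∘ Equiv.swap (Sum.inl i) (Sum.inr j)) (Sum.inl k) = true) =
      insert i (Finset.univ.filter fun k : Fin m => w (Sum.inl k) = true) := by
    ext k
    by_cases hk : k = i
    · subst hk; simp [hj]
    · simp [hk, Equiv.swap_apply_of_ne_of_ne (a := (Sum.inl i : Fin m ⊕ Fin n))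
        (b := Sum.inr j) (x := Sum.inl k) (by simpa using hk) (by simp)]
  rw [leftCount, h, Finset.card_insert_of_notMem (by simp [hi]), leftCount]

/-- The number of permutations with `a` successes in the first sample. -/
def permLevel {m n : ℕ} (w : Fin m ⊕ Fin n → Bool) (a : ℕ) : ℕ :=
  (Finset.univ.filter fun σ : Equiv.Perm (Fin m ⊕ Fin n) => leftCount (w ∘ σ) = a).card

theorem sum_ite_pairs {m n : ℕ} (w : Fin m ⊕ Fin n → Bool) (x y : Bool) :
    ∑ i : Fin m, ∑ j : Fin n, (if w (Sum.inl i) = x ∧ w (Sum.inr j) = y then (1 : ℝ) else 0) =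
      (Finset.univ.filter fun i : Fin m => w (Sum.inl i) = x).card *
        (Finset.univ.filter fun j : Fin n => w (Sum.inr j) = y).card := by
  rw [Finset.card_filter, Finset.card_filter]
  push_cast
  rw [Finset.sum_mul_sum]
  refine Finset.sum_congr rfl fun i _ => Finset.sum_congr rfl fun j _ => ?_
  by_cases h1 : w (Sum.inl i) = x <;> by_cases h2 : w (Sum.inr j) = y <;> simp [h1, h2]

theorem card_left_false {m n : ℕ} (w : Fin m ⊕ Fin n → Bool) :
    ((Finset.univ.filter fun i : Fin m => w (Sum.inl i) = false).card : ℝ) = m - leftCount w := by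
  have h := Finset.card_filter_add_card_filter_not (s := (Finset.univ : Finset (Fin m)))
    (fun i => w (Sum.inl i) = true)
  simp only [Bool.not_eq_true, Finset.card_univ, Fintype.card_fin] at h
  rw [leftCount, eq_sub_iff_add_eq, add_comm]
  exact_mod_cast h

theorem card_right_false {m n : ℕ} (w : Fin m ⊕ Fin n → Bool) :
    ((Finset.univ.filter fun j : Fin n => w (Sum.inr j) = false).card : ℝ) =
      n - rightCount w := by
  have h := Finset.card_filter_add_card_filter_not (s := (Finset.univ : Finset (Fin n)))
    (fun i => w (Sum.inr i) = true)
  simp only [Bool.not_eq_true, Finset.card_univ, Fintype.card_fin] at h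
  rw [rightCount, eq_sub_iff_add_eq, add_comm]
  exact_mod_cast h

/-- Double counting. Exchanging a success in the first sample with a failure in the second is a
bijection between level `a + 1` and level `a`, each with a marked pair; the coefficients count the
available pairs. -/
theorem permLevel_recursion {m n : ℕ} (w : Fin m ⊕ Fin n → Bool) (a : ℕ) :
    ((a : ℝ) + 1) * ((n : ℝ) - poolCount w + a + 1) * permLevel w (a + 1) =
      ((m : ℝ) - a) * ((poolCount w : ℝ) - a) * permLevel w a := by
  have hkey : ∑ σ : Equiv.Perm (Fin m ⊕ Fin n), ∑ i : Fin m, ∑ j : Fin n,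
      (if leftCount (w ∘ σ) = a + 1 ∧ (w ∘ σ) (Sum.inl i) = true ∧ (w ∘ σ) (Sum.inr j) = false
        then (1 : ℝ) else 0) =
      ∑ σ : Equiv.Perm (Fin m ⊕ Fin n), ∑ i : Fin m, ∑ j : Fin n,
      (if leftCount (w ∘ σ) = a ∧ (w ∘ σ) (Sum.inl i) = false ∧ (w ∘ σ) (Sum.inr j) = true
        then (1 : ℝ) else 0) := by
    rw [Finset.sum_comm]
    conv_rhs => rw [Finset.sum_comm]
    refine Finset.sum_congr rfl fun i _ => ?_
    rw [Finset.sum_comm]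
    conv_rhs => rw [Finset.sum_comm]
    refine Finset.sum_congr rfl fun j _ => ?_
    rw [← Equiv.sum_comp (Equiv.mulRight (Equiv.swap (Sum.inl i) (Sum.inr j)))]
    refine Finset.sum_congr rfl fun σ _ => ?_
    have hc : w ∘ (σ * Equiv.swap (Sum.inl i) (Sum.inr j) : Equiv.Perm (Fin m ⊕ Fin n)) =
        (w ∘ σ) ∘ Equiv.swap (Sum.inl i) (Sum.inr j) := rfl
    rw [Equiv.coe_mulRight, hc]
    congr 1
    rw [Function.comp_apply (f := w ∘ σ), Function.comp_apply (f := w ∘ σ), Equiv.swap_apply_left,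
      Equiv.swap_apply_right]
    refine propext ⟨fun ⟨h1, h2, h3⟩ => ?_, fun ⟨h1, h2, h3⟩ => ?_⟩
    · rw [leftCount_comp_swap h3 h2] at h1
      exact ⟨by omega, h3, h2⟩
    · rw [leftCount_comp_swap h2 h3]
      exact ⟨by omega, h3, h2⟩
  have hsplit : ∀ (b : ℕ) (x y : Bool) (σ : Equiv.Perm (Fin m ⊕ Fin n)),
      ∑ i : Fin m, ∑ j : Fin n, (if leftCount (w ∘ σ) = b ∧ (w ∘ σ) (Sum.inl i) = x ∧
        (w ∘ σ) (Sum.inr j) = y then (1 : ℝ) else 0) = if leftCount (w ∘ σ) = b then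
          ((Finset.univ.filter fun i : Fin m => (w ∘ σ) (Sum.inl i) = x).card *
          (Finset.univ.filter fun j : Fin n => (w ∘ σ) (Sum.inr j) = y).card : ℝ) else 0 := by
    intro b x y σ
    split_ifs with h
    · rw [← sum_ite_pairs]; simp [h]
    · simp [h]
  simp only [hsplit] at hkey
  have hcount : ∀ σ : Equiv.Perm (Fin m ⊕ Fin n),
      (leftCount (w ∘ σ) : ℝ) + rightCount (w ∘ σ) = poolCount w := fun σ => by
    rw [← poolCount_comp w σ, ← leftCount_add_rightCount]; push_cast; ring
  have hL : ∀ σ : Equiv.Perm (Fin m ⊕ Fin n), (if leftCount (w ∘ σ) = a + 1 then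
      ((Finset.univ.filter fun i : Fin m => (w ∘ σ) (Sum.inl i) = true).card *
      (Finset.univ.filter fun j : Fin n => (w ∘ σ) (Sum.inr j) = false).card : ℝ) else 0) =
      ((a : ℝ) + 1) * ((n : ℝ) - poolCount w + a + 1) *
        (if leftCount (w ∘ σ) = a + 1 then 1 else 0) := by
    intro σ
    split_ifs with h
    · rw [card_right_false]
      change (leftCount (w ∘ σ) : ℝ) * _ = _
      have := hcount σ
      rw [h] at this ⊢
      push_cast at this ⊢
      rw [← this]; ring
    · simp
  have hR : ∀ σ : Equiv.Perm (Fin m ⊕ Fin n), (if leftCount (w ∘ σ) = a then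
      ((Finset.univ.filter fun i : Fin m => (w ∘ σ) (Sum.inl i) = false).card *
      (Finset.univ.filter fun j : Fin n => (w ∘ σ) (Sum.inr j) = true).card : ℝ) else 0) =
      ((m : ℝ) - a) * ((poolCount w : ℝ) - a) * (if leftCount (w ∘ σ) = a then 1 else 0) := by
    intro σ
    split_ifs with h
    · rw [card_left_false]
      change _ * (rightCount (w ∘ σ) : ℝ) = _
      have := hcount σ
      rw [h] at this ⊢
      rw [← this]; ring
    · simp
  simp only [hL, hR] at hkey
  rw [← Finset.mul_sum, ← Finset.mul_sum, Finset.sum_boole, Finset.sum_boole] at hkey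
  exact hkey

theorem permLevel_anticoncentration {c η : ℝ} (hc : 0 < c) (hη : 0 < η) :
    ∃ N₀ : ℕ, ∀ (m n : ℕ) (w : Fin m ⊕ Fin n → Bool) (a : ℕ), N₀ ≤ m + n →
      c * ((m : ℝ) + n) ≤ m → c * ((m : ℝ) + n) ≤ n → c * ((m : ℝ) + n) ≤ poolCount w →
      c * ((m : ℝ) + n) ≤ (m : ℝ) + n - poolCount w →
      (permLevel w a : ℝ) ≤ η * Nat.factorial (m + n) := by
  obtain ⟨N₀, hN₀⟩ := hypergeometric_anticoncentration hc hη
  refine ⟨N₀, fun m n w a hN hm hn hK hK' => ?_⟩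
  by_cases hne : ∃ σ : Equiv.Perm (Fin m ⊕ Fin n), leftCount (w ∘ σ) = a
  · obtain ⟨σ, hσ⟩ := hne
    have h1 := leftCount_add_rightCount (w ∘ σ)
    rw [poolCount_comp, hσ] at h1
    have h2 := rightCount_le (w ∘ σ)
    have h3 := leftCount_le (w ∘ σ)
    refine hN₀ m n (poolCount w) a (fun i => (permLevel w i : ℝ)) _ hN hm hn hK hK'
      (fun i => Nat.cast_nonneg _) (permLevel_recursion w) (fun s => ?_) (by omega) (by omega)
      (by omega)
    rw [← Nat.cast_sum, Nat.cast_le]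
    have hcard : Fintype.card (Equiv.Perm (Fin m ⊕ Fin n)) = Nat.factorial (m + n) := by
      rw [Fintype.card_perm, Fintype.card_sum, Fintype.card_fin, Fintype.card_fin]
    rw [← hcard]
    unfold permLevel
    rw [← Finset.card_biUnion]
    · exact Finset.card_le_univ _
    · intro x _ y _ hxy
      rw [Function.onFun, Finset.disjoint_left]
      intro τ hτ hτ'
      simp only [Finset.mem_filter] at hτ hτ'
      exact hxy (hτ.2.symm.trans hτ'.2)
  · have : permLevel w a = 0 := by
      rw [permLevel, Finset.card_eq_zero, Finset.filter_eq_empty_iff]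
      exact fun σ _ h => hne ⟨σ, h⟩
    rw [this, Nat.cast_zero]
    positivity

end Hypergeometric

/-! ### The energy statistic of a two-point configuration -/

section PairEnergy

variable {m n : ℕ}

/-- The energy statistic for a general dissimilarity `ρ`. -/
noncomputable def pairEnergy {γ : Type*} (ρ : γ → γ → ℝ) (z : Fin m ⊕ Fin n → γ) : ℝ :=
  2 / ((m : ℝ) * (n : ℝ)) * ∑ i : Fin m, ∑ j : Fin n, ρ (z (Sum.inl i)) (z (Sum.inr j))
    - 1 / ((m : ℝ) * ((m : ℝ) - 1)) *
        ∑ i ∈ (Finset.univ : Finset (Fin m)).offDiag, ρ (z (Sum.inl i.1)) (z (Sum.inl i.2))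
    - 1 / ((n : ℝ) * ((n : ℝ) - 1)) *
        ∑ j ∈ (Finset.univ : Finset (Fin n)).offDiag, ρ (z (Sum.inr j.1)) (z (Sum.inr j.2))

theorem abs_sum_sub_mul_sum_le {ι : Type*} (s : Finset ι) (f g : ι → ℝ) (R B : ℝ)
    (h : ∀ i ∈ s, |f i - R * g i| ≤ B) : |∑ i ∈ s, f i - R * ∑ i ∈ s, g i| ≤ s.card * B := by
  rw [Finset.mul_sum, ← Finset.sum_sub_distrib, ← nsmul_eq_mul]
  exact (Finset.abs_sum_le_sum_abs _ _).trans (Finset.sum_le_card_nsmul _ _ _ h)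

/-- The energy is a combination of averages with weights 2, -1, -1, so a uniform error `B` in the
dissimilarities costs at most `4 * B`. -/
theorem abs_pairEnergy_sub_le {γ γ' : Type*} {ρ : γ → γ → ℝ} {ρ' : γ' → γ' → ℝ}
    {z : Fin m ⊕ Fin n → γ} {w : Fin m ⊕ Fin n → γ'} {R B : ℝ} (hm : 2 ≤ m) (hn : 2 ≤ n)
    (h : ∀ k l, |ρ (z k) (z l) - R * ρ' (w k) (w l)| ≤ B) :
    |pairEnergy ρ z - R * pairEnergy ρ' w| ≤ 4 * B := by
  have hm' : (2 : ℝ) ≤ m := by exact_mod_cast hm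
  have hn' : (2 : ℝ) ≤ n := by exact_mod_cast hn
  have e1 := abs_sum_sub_mul_sum_le (Finset.univ ×ˢ Finset.univ : Finset (Fin m × Fin n))
    (fun p => ρ (z (Sum.inl p.1)) (z (Sum.inr p.2)))
    (fun p => ρ' (w (Sum.inl p.1)) (w (Sum.inr p.2))) R B fun p _ => h _ _
  have e2 := abs_sum_sub_mul_sum_le (Finset.univ : Finset (Fin m)).offDiag
    (fun p => ρ (z (Sum.inl p.1)) (z (Sum.inl p.2)))
    (fun p => ρ' (w (Sum.inl p.1)) (w (Sum.inl p.2))) R B fun p _ => h _ _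
  have e3 := abs_sum_sub_mul_sum_le (Finset.univ : Finset (Fin n)).offDiag
    (fun p => ρ (z (Sum.inr p.1)) (z (Sum.inr p.2)))
    (fun p => ρ' (w (Sum.inr p.1)) (w (Sum.inr p.2))) R B fun p _ => h _ _
  rw [Finset.sum_product, Finset.sum_product, Finset.card_product, Finset.card_univ,
    Finset.card_univ, Fintype.card_fin, Fintype.card_fin, Nat.cast_mul] at e1
  rw [card_offDiag_fin] at e2 e3
  unfold pairEnergy
  set S1 := ∑ i : Fin m, ∑ j : Fin n, ρ (z (Sum.inl i)) (z (Sum.inr j))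
  set S1' := ∑ i : Fin m, ∑ j : Fin n, ρ' (w (Sum.inl i)) (w (Sum.inr j))
  set S2 := ∑ i ∈ (Finset.univ : Finset (Fin m)).offDiag, ρ (z (Sum.inl i.1)) (z (Sum.inl i.2))
  set S2' := ∑ i ∈ (Finset.univ : Finset (Fin m)).offDiag, ρ' (w (Sum.inl i.1)) (w (Sum.inl i.2))
  set S3 := ∑ i ∈ (Finset.univ : Finset (Fin n)).offDiag, ρ (z (Sum.inr i.1)) (z (Sum.inr i.2))
  set S3' := ∑ i ∈ (Finset.univ : Finset (Fin n)).offDiag, ρ' (w (Sum.inr i.1)) (w (Sum.inr i.2))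
  have hc1 : (0 : ℝ) < (m : ℝ) * n := by positivity
  have hc2 : (0 : ℝ) < (m : ℝ) * (m - 1) := by nlinarith
  have hc3 : (0 : ℝ) < (n : ℝ) * (n - 1) := by nlinarith
  have hb : ∀ c x y : ℝ, 0 < c → |x| ≤ c * y → |1 / c * x| ≤ y := fun c x y hc hx => by
    rw [abs_mul, abs_of_pos (by positivity), one_div, inv_mul_le_iff₀ hc]; exact hx
  have f1 := abs_le.mp (hb _ _ _ hc1 e1)
  have f2 := abs_le.mp (hb _ _ _ hc2 e2)
  have f3 := abs_le.mp (hb _ _ _ hc3 e3)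
  have hexp : 2 / ((m : ℝ) * n) * S1 - 1 / ((m : ℝ) * (m - 1)) * S2 - 1 / ((n : ℝ) * (n - 1)) * S3 -
      R * (2 / ((m : ℝ) * n) * S1' - 1 / ((m : ℝ) * (m - 1)) * S2' -
        1 / ((n : ℝ) * (n - 1)) * S3') =
      2 * (1 / ((m : ℝ) * n) * (S1 - R * S1')) - 1 / ((m : ℝ) * (m - 1)) * (S2 - R * S2') -
        1 / ((n : ℝ) * (n - 1)) * (S3 - R * S3') := by ring
  rw [hexp, abs_le]
  constructor <;> linarith [f1.1, f1.2, f2.1, f2.2, f3.1, f3.2]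

/-- The discrete metric on `Bool`, with real values. -/
def boolDist (x y : Bool) : ℝ := if x = y then 0 else 1

/-- The energy statistic of a two-point configuration in terms of the numbers of successes. -/
noncomputable def countEnergy (m n : ℕ) (a b : ℝ) : ℝ :=
  2 / ((m : ℝ) * n) * (a * (n - b) + b * (m - a)) - 2 / ((m : ℝ) * (m - 1)) * (a * (m - a)) -
    2 / ((n : ℝ) * (n - 1)) * (b * (n - b))

theorem boolDist_eq (x y : Bool) : boolDist x y =
    (if x = true then 1 else 0) * (1 - if y = true then 1 else 0) +
      (if y = true then 1 else 0) * (1 - if x = true then 1 else 0) := by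
  cases x <;> cases y <;> simp [boolDist]

theorem sum_sum_boolDist {ι κ : Type*} [Fintype ι] [Fintype κ] (x : ι → Bool) (y : κ → Bool) :
    ∑ i, ∑ j, boolDist (x i) (y j) =
      ((Finset.univ.filter fun i => x i = true).card : ℝ) *
        (Fintype.card κ - (Finset.univ.filter fun j => y j = true).card) +
      ((Finset.univ.filter fun j => y j = true).card : ℝ) *
        (Fintype.card ι - (Finset.univ.filter fun i => x i = true).card) := by
  simp_rw [boolDist_eq, Finset.card_filter]
  push_cast
  simp only [Finset.sum_add_distrib, ← Finset.mul_sum, ← Finset.sum_mul, Finset.sum_sub_distrib,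
    Finset.sum_const, Finset.card_univ, nsmul_eq_mul, mul_one]

theorem sum_offDiag_boolDist {ι : Type*} [Fintype ι] [DecidableEq ι] (x : ι → Bool) :
    ∑ p ∈ (Finset.univ : Finset ι).offDiag, boolDist (x p.1) (x p.2) =
      2 * (((Finset.univ.filter fun i => x i = true).card : ℝ) *
        (Fintype.card ι - (Finset.univ.filter fun i => x i = true).card)) := by
  have h := sum_sum_boolDist x x
  rw [← Finset.sum_product', ← Finset.diag_union_offDiag,
    Finset.sum_union (Finset.disjoint_diag_offDiag _), Finset.sum_diag] at h
  simp only [boolDist, if_true, Finset.sum_const_zero, zero_add] at h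
  simp only [boolDist]
  rw [h]; ring

theorem pairEnergy_boolDist (w : Fin m ⊕ Fin n → Bool) :
    pairEnergy boolDist w = countEnergy m n (leftCount w) (rightCount w) := by
  unfold pairEnergy
  rw [sum_sum_boolDist (fun i : Fin m => w (Sum.inl i)) fun j : Fin n => w (Sum.inr j),
    sum_offDiag_boolDist fun i : Fin m => w (Sum.inl i),
    sum_offDiag_boolDist fun i : Fin n => w (Sum.inr i)]
  simp only [Fintype.card_fin, countEnergy, leftCount, rightCount]
  ring

/-- At most two numbers of successes in the first sample yield a given value. -/
theorem countEnergy_eq_of_eq (hm : 2 ≤ m) (hn : 2 ≤ n) {K a a' a'' : ℝ} (h : a ≠ a')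
    (h' : a ≠ a'') (e : countEnergy m n a' (K - a') = countEnergy m n a (K - a))
    (e' : countEnergy m n a'' (K - a'') = countEnergy m n a (K - a)) : a' = a'' := by
  have hm' : (2 : ℝ) ≤ m := by exact_mod_cast hm
  have hn' : (2 : ℝ) ≤ n := by exact_mod_cast hn
  have hc1 : (0 : ℝ) < (m : ℝ) * n := by positivity
  have hc2 : (0 : ℝ) < (m : ℝ) * (m - 1) := by nlinarith
  have hc3 : (0 : ℝ) < (n : ℝ) * (n - 1) := by nlinarith
  unfold countEnergy at e e'
  set c1 := 2 / ((m : ℝ) * n)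
  set c2 := 2 / ((m : ℝ) * (m - 1))
  set c3 := 2 / ((n : ℝ) * (n - 1))
  have hp1 : 0 < c1 := by positivity
  have hp2 : 0 < c2 := by positivity
  have hp3 : 0 < c3 := by positivity
  -- The value is quadratic in the first-sample count with leading coefficient `2 c1 + c2 + c3 > 0`.
  -- Cancelling the factor `a - x` leaves a linear equation for the other root.
  have g : ∀ x : ℝ, a ≠ x → c1 * (x * (n - (K - x)) + (K - x) * (m - x)) - c2 * (x * (m - x)) -
      c3 * ((K - x) * (n - (K - x))) = c1 * (a * (n - (K - a)) + (K - a) * (m - a)) -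
      c2 * (a * (m - a)) - c3 * ((K - a) * (n - (K - a))) →
      (2 * c1 + c2 + c3) * x =
        -((2 * c1 + c2 + c3) * a + (c1 * (n - K - K - m) - c2 * m + c3 * (n - 2 * K))) := by
    intro x hx hxe
    have : (a - x) * ((2 * c1 + c2 + c3) * (a + x) + (c1 * (n - K - K - m) - c2 * m +
        c3 * (n - 2 * K))) = 0 := by linear_combination (-1 : ℝ) * hxe
    rcases mul_eq_zero.mp this with h0 | h0
    · exact absurd (sub_eq_zero.mp h0) hx
    · linear_combination h0
  have h1 := g a' h e
  have h2 := g a'' h' e'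
  rw [← h2] at h1
  exact mul_left_cancel₀ (by positivity) h1

/-- Values of the two-point energy statistic are multiples of a common unit. -/
theorem countEnergy_integral (hm : 2 ≤ m) (hn : 2 ≤ n) (a b : ℕ) :
    ∃ k : ℤ, ((m : ℝ) * (m - 1)) * ((n : ℝ) * (n - 1)) * countEnergy m n a b = k := by
  have hm' : (2 : ℝ) ≤ m := by exact_mod_cast hm
  have hn' : (2 : ℝ) ≤ n := by exact_mod_cast hn
  have hm1 : (m : ℝ) - 1 ≠ 0 := by linarith
  have hn1 : (n : ℝ) - 1 ≠ 0 := by linarith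
  have hm0 : (m : ℝ) ≠ 0 := by linarith
  have hn0 : (n : ℝ) ≠ 0 := by linarith
  refine ⟨2 * (m - 1) * (n - 1) * (a * (n - b) + b * (m - a)) - 2 * (n * (n - 1)) * (a * (m - a)) -
    2 * (m * (m - 1)) * (b * (n - b)), ?_⟩
  push_cast
  unfold countEnergy
  field_simp

theorem card_perm_pairEnergy_le {η : ℝ} (hm : 2 ≤ m) (hn : 2 ≤ n) (w : Fin m ⊕ Fin n → Bool)
    (hη : ∀ a, (permLevel w a : ℝ) ≤ η) (hη0 : 0 ≤ η) (v : ℝ) :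
    ((Finset.univ.filter fun σ : Equiv.Perm (Fin m ⊕ Fin n) =>
      pairEnergy boolDist (w ∘ σ) = v).card : ℝ) ≤ 2 * η := by
  have hval : ∀ σ : Equiv.Perm (Fin m ⊕ Fin n), pairEnergy boolDist (w ∘ σ) =
      countEnergy m n (leftCount (w ∘ σ)) ((poolCount w : ℝ) - leftCount (w ∘ σ)) := fun σ => by
    rw [pairEnergy_boolDist, ← poolCount_comp w σ, ← leftCount_add_rightCount]
    push_cast
    rw [add_sub_cancel_left]
  by_cases h1 : ∃ σ₀ : Equiv.Perm (Fin m ⊕ Fin n), pairEnergy boolDist (w ∘ σ₀) = v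
  swap
  · rw [Finset.filter_eq_empty_iff.mpr fun σ _ h => h1 ⟨σ, h⟩]
    simpa using hη0
  obtain ⟨σ₀, h0⟩ := h1
  obtain ⟨a₁, ha₁⟩ : ∃ a₁, ∀ σ : Equiv.Perm (Fin m ⊕ Fin n), pairEnergy boolDist (w ∘ σ) = v →
      leftCount (w ∘ σ) = leftCount (w ∘ σ₀) ∨ leftCount (w ∘ σ) = a₁ := by
    by_cases h2 : ∃ σ₁ : Equiv.Perm (Fin m ⊕ Fin n), pairEnergy boolDist (w ∘ σ₁) = v ∧
        leftCount (w ∘ σ₁) ≠ leftCount (w ∘ σ₀)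
    · obtain ⟨σ₁, hv, hne⟩ := h2
      refine ⟨leftCount (w ∘ σ₁), fun σ hσ => ?_⟩
      by_contra hcon
      push Not at hcon
      rw [← h0, hval, hval] at hσ hv
      have := countEnergy_eq_of_eq hm hn (by exact_mod_cast hcon.1.symm)
        (by exact_mod_cast hne.symm) hσ hv
      exact hcon.2 (by exact_mod_cast this)
    · push Not at h2
      -- If only one level attains `v`, the second level is arbitrary.
      exact ⟨0, fun σ hσ => Or.inl (h2 σ hσ)⟩
  have hsub : (Finset.univ.filter fun σ : Equiv.Perm (Fin m ⊕ Fin n) =>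
      pairEnergy boolDist (w ∘ σ) = v) ⊆
      (Finset.univ.filter fun σ : Equiv.Perm (Fin m ⊕ Fin n) =>
        leftCount (w ∘ σ) = leftCount (w ∘ σ₀)) ∪
      (Finset.univ.filter fun σ : Equiv.Perm (Fin m ⊕ Fin n) => leftCount (w ∘ σ) = a₁) := by
    intro σ hσ
    have := ha₁ σ (Finset.mem_filter.mp hσ).2
    simpa using this
  have hc := (Finset.card_le_card hsub).trans (Finset.card_union_le _ _)
  have hc' : ((Finset.univ.filter fun σ : Equiv.Perm (Fin m ⊕ Fin n) =>
      pairEnergy boolDist (w ∘ σ) = v).card : ℝ) ≤ permLevel w (leftCount (w ∘ σ₀)) +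
        permLevel w a₁ := by exact_mod_cast hc
  linarith [hη (leftCount (w ∘ σ₀)), hη a₁]

/-- A randomization test has level `α` up to ties. -/
theorem card_filter_rank_le {ι : Type*} [Fintype ι] (f : ι → ℝ) {α τ : ℝ} (hα : 0 ≤ α)
    (hτ0 : 0 ≤ τ) (hτ : ∀ v, ((Finset.univ.filter fun σ => f σ = v).card : ℝ) ≤ τ) :
    ((Finset.univ.filter fun ρ => (1 - α) * Fintype.card ι ≤
      ((Finset.univ.filter fun σ => f σ ≤ f ρ).card : ℝ)).card : ℝ) ≤
      α * Fintype.card ι + τ := by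
  classical
  set S := Finset.univ.filter fun ρ => (1 - α) * Fintype.card ι ≤
      ((Finset.univ.filter fun σ => f σ ≤ f ρ).card : ℝ) with hS
  rcases S.eq_empty_or_nonempty with h | h
  · rw [h, Finset.card_empty, Nat.cast_zero]; positivity
  -- Every high-ranking index has value at least `f ρ₀`. Those strictly above number at most a
  -- proportion `α`, by the rank of `ρ₀`; the rest tie with it.
  obtain ⟨ρ₀, hρ₀, hmin⟩ := S.exists_min_image f h
  have hsub : S ⊆ (Finset.univ.filter fun σ => ¬ f σ ≤ f ρ₀) ∪
      Finset.univ.filter fun σ => f σ = f ρ₀ := by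
    intro σ hσ
    simp only [Finset.mem_union, Finset.mem_filter, Finset.mem_univ, true_and, not_le]
    exact (hmin σ hσ).lt_or_eq.imp id Eq.symm
  have hc := (Finset.card_le_card hsub).trans (Finset.card_union_le _ _)
  have hc' : (S.card : ℝ) ≤ ((Finset.univ.filter fun σ => ¬ f σ ≤ f ρ₀).card : ℝ) +
    ((Finset.univ.filter fun σ => f σ = f ρ₀).card : ℝ) := by exact_mod_cast hc
  have hsum := Finset.card_filter_add_card_filter_not (s := (Finset.univ : Finset ι))
    (fun σ => f σ ≤ f ρ₀)
  have hsum' : ((Finset.univ.filter fun σ => f σ ≤ f ρ₀).card : ℝ) +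
      ((Finset.univ.filter fun σ => ¬ f σ ≤ f ρ₀).card : ℝ) = Fintype.card ι := by
    exact_mod_cast hsum
  have hρ : (1 - α) * Fintype.card ι ≤ ((Finset.univ.filter fun σ => f σ ≤ f ρ₀).card : ℝ) :=
    (Finset.mem_filter.mp hρ₀).2
  linarith [hτ (f ρ₀)]

end PairEnergy

/-! ### The energy test against a distant contamination -/

section BitLaw

/-- The Bernoulli distribution. -/
noncomputable def bernLaw (ε : ℝ) : Measure Bool :=
  ENNReal.ofReal (1 - ε) • Measure.dirac false + ENNReal.ofReal ε • Measure.dirac true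

variable {ε : ℝ} {m n : ℕ}

theorem isProbabilityMeasure_bernLaw (hε : ε ∈ Set.Ioo (0 : ℝ) 1) :
    IsProbabilityMeasure (bernLaw ε) := by
  constructor
  simp only [bernLaw, Measure.coe_add, Measure.coe_smul, Pi.add_apply, Pi.smul_apply,
    measure_univ, smul_eq_mul, mul_one]
  rw [← ENNReal.ofReal_add (by linarith [hε.2]) hε.1.le]
  simp

/-- The joint law of the contamination indicators. -/
noncomputable def bitsLaw (m n : ℕ) (ε : ℝ) : Measure (Fin m ⊕ Fin n → Bool) :=
  Measure.pi fun _ => bernLaw ε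

theorem isProbabilityMeasure_bitsLaw (hε : ε ∈ Set.Ioo (0 : ℝ) 1) :
    IsProbabilityMeasure (bitsLaw m n ε) := by
  have := isProbabilityMeasure_bernLaw hε
  unfold bitsLaw; infer_instance

theorem measurePreserving_bitsLaw_comp (hε : ε ∈ Set.Ioo (0 : ℝ) 1)
    (σ : Equiv.Perm (Fin m ⊕ Fin n)) :
    MeasurePreserving (fun w : Fin m ⊕ Fin n → Bool => w ∘ σ) (bitsLaw m n ε)
      (bitsLaw m n ε) := by
  have := isProbabilityMeasure_bernLaw hε
  have h := measurePreserving_arrowCongr' (fun _ : Fin m ⊕ Fin n => bernLaw ε)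
    (fun _ : Fin m ⊕ Fin n => bernLaw ε) σ.symm (MeasurableEquiv.refl Bool)
    (fun _ => MeasurePreserving.id _)
  exact h

theorem integral_bernLaw (hε : ε ∈ Set.Ioo (0 : ℝ) 1) :
    ∫ b, (if b = true then (1 : ℝ) else 0) ∂(bernLaw ε) = ε := by
  unfold bernLaw
  rw [integral_add_measure (Integrable.of_finite.smul_measure ENNReal.ofReal_ne_top)
    (Integrable.of_finite.smul_measure ENNReal.ofReal_ne_top), integral_smul_measure,
    integral_smul_measure, integral_dirac, integral_dirac, ENNReal.toReal_ofReal hε.1.le]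
  simp

/-- The numbers of successes and failures are of the order of the sample size. -/
theorem bitsLaw_poolCount_le (hε : ε ∈ Set.Ioo (0 : ℝ) 1) {c : ℝ} (hc : 0 < c)
    (hc1 : 2 * c ≤ ε) (hc2 : 2 * c ≤ 1 - ε) (hN : 0 < m + n) :
    (bitsLaw m n ε) {w | ¬ (c * ((m : ℝ) + n) ≤ poolCount w ∧
      c * ((m : ℝ) + n) ≤ (m : ℝ) + n - poolCount w)} ≤
      ENNReal.ofReal (1 / (c ^ 2 * ((m : ℝ) + n))) := by
  have := isProbabilityMeasure_bernLaw hε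
  have := isProbabilityMeasure_bitsLaw (m := m) (n := n) hε
  have hN' : (0 : ℝ) < (m : ℝ) + n := by exact_mod_cast hN
  let f : Bool → ℝ := fun b => if b = true then 1 else 0
  let X : Fin m ⊕ Fin n → (Fin m ⊕ Fin n → Bool) → ℝ := fun k w => f (w k)
  have hLp : ∀ k, MemLp (X k) 2 (bitsLaw m n ε) := fun k =>
    MemLp.of_bound (measurable_of_finite _).aestronglyMeasurable 1 (ae_of_all _ fun w => by
      simp only [X, f]; split_ifs <;> simp)
  have hind : ProbabilityTheory.iIndepFun X (bitsLaw m n ε) :=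
    ProbabilityTheory.iIndepFun_pi (X := fun _ => f) fun _ =>
      (measurable_of_finite f).aemeasurable
  have hvar1 : ∀ k, ProbabilityTheory.variance (X k) (bitsLaw m n ε) ≤ 1 := fun k => by
    refine (ProbabilityTheory.variance_le_sq_of_bounded (a := 0) (b := 1) (ae_of_all _ fun w => ?_)
      (measurable_of_finite _).aemeasurable).trans (by norm_num)
    simp only [X, f]; split_ifs <;> simp
  have hvar : ProbabilityTheory.variance (∑ k, X k) (bitsLaw m n ε) ≤ (m : ℝ) + n := by
    rw [ProbabilityTheory.IndepFun.variance_sum (fun k _ => hLp k)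
      (fun i _ j _ hij => hind.indepFun hij)]
    refine (Finset.sum_le_card_nsmul _ _ 1 fun k _ => hvar1 k).trans (le_of_eq ?_)
    simp [Fintype.card_sum]
  have hmean : ∀ k, ∫ w, X k w ∂(bitsLaw m n ε) = ε := fun k => by
    have h := measurePreserving_eval (fun _ : Fin m ⊕ Fin n => bernLaw ε) k
    have h2 := integral_map (μ := Measure.pi fun _ : Fin m ⊕ Fin n => bernLaw ε)
      (measurable_pi_apply k).aemeasurable (measurable_of_finite f).aestronglyMeasurable
    exact h2.symm.trans ((congrArg (fun ρ => ∫ b, f b ∂ρ) h.map_eq).trans (integral_bernLaw hε))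
  have hsum : ∫ w, (∑ k, X k) w ∂(bitsLaw m n ε) = ((m : ℝ) + n) * ε := by
    simp only [Finset.sum_apply]
    rw [integral_finsetSum _ fun k _ => Integrable.of_finite]
    simp [hmean, Fintype.card_sum]
  have hcheb := ProbabilityTheory.meas_ge_le_variance_div_sq (c := c * ((m : ℝ) + n))
    (memLp_finsetSum' Finset.univ fun k _ => hLp k) (by positivity)
  rw [hsum] at hcheb
  refine (measure_mono fun w hw => ?_).trans (hcheb.trans (ENNReal.ofReal_le_ofReal ?_))
  · have hS : (∑ k, X k) w = poolCount w := by
      simp only [Finset.sum_apply, X, f, poolCount, Finset.sum_boole]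
    change c * ((m : ℝ) + n) ≤ |(∑ k, X k) w - ((m : ℝ) + n) * ε|
    rw [hS]
    by_contra hcon
    push Not at hcon
    rw [abs_lt] at hcon
    refine hw ⟨?_, ?_⟩ <;> nlinarith [hcon.1, hcon.2]
  · rw [div_le_div_iff₀ (by positivity) (by positivity)]
    calc _ ≤ ((m : ℝ) + n) * (c ^ 2 * ((m : ℝ) + n)) := by gcongr
      _ = _ := by ring

/-- The configurations whose two-point energy has a high rank among all permutations. -/
def highRank (α : ℝ) (m n : ℕ) : Set (Fin m ⊕ Fin n → Bool) :=
  {w | (1 - α) * Nat.factorial (m + n) ≤ ((Finset.univ.filter fun σ : Equiv.Perm (Fin m ⊕ Fin n) =>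
    pairEnergy boolDist (w ∘ σ) ≤ pairEnergy boolDist w).card : ℝ)}

theorem card_perm_sum (m n : ℕ) :
    Fintype.card (Equiv.Perm (Fin m ⊕ Fin n)) = Nat.factorial (m + n) := by
  rw [Fintype.card_perm, Fintype.card_sum, Fintype.card_fin, Fintype.card_fin]

-- The permutations of `w ∘ τ` are those of `w`, so along the orbit of `w` high rank becomes the
-- rank condition of `card_filter_rank_le`.
open Classical in
theorem card_comp_mem_highRank_le {α η : ℝ} (hα : 0 ≤ α) (hη : 0 ≤ η) (hm : 2 ≤ m) (hn : 2 ≤ n)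
    (w : Fin m ⊕ Fin n → Bool) (hw : ∀ a, (permLevel w a : ℝ) ≤ η * Nat.factorial (m + n)) :
    ((Finset.univ.filter fun τ : Equiv.Perm (Fin m ⊕ Fin n) =>
      w ∘ τ ∈ highRank α m n).card : ℝ) ≤ (α + 2 * η) * Nat.factorial (m + n) := by
  have h := card_filter_rank_le (fun σ : Equiv.Perm (Fin m ⊕ Fin n) =>
    pairEnergy boolDist (w ∘ σ)) hα (by positivity)
    (card_perm_pairEnergy_le hm hn w hw (by positivity))
  rw [card_perm_sum] at h
  refine le_trans (le_of_eq ?_) (h.trans (le_of_eq (by ring)))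
  refine Nat.cast_inj.mpr (congrArg Finset.card ?_)
  ext τ
  rw [Finset.mem_filter, Finset.mem_filter, highRank, Set.mem_ofPred_eq]
  have : (Finset.univ.filter fun σ : Equiv.Perm (Fin m ⊕ Fin n) =>
      pairEnergy boolDist ((w ∘ τ) ∘ σ) ≤ pairEnergy boolDist (w ∘ τ)).card =
      (Finset.univ.filter fun σ : Equiv.Perm (Fin m ⊕ Fin n) =>
      pairEnergy boolDist (w ∘ σ) ≤ pairEnergy boolDist (w ∘ τ)).card := by
    rw [Finset.card_filter, Finset.card_filter]
    exact Equiv.sum_comp (Equiv.mulLeft τ) fun σ : Equiv.Perm (Fin m ⊕ Fin n) =>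
      if pairEnergy boolDist (w ∘ σ) ≤ pairEnergy boolDist (w ∘ τ) then 1 else 0
  rw [this]

/-- The indicators are exchangeable, so the probability of a high rank is the mean proportion of
high-ranking configurations in an orbit. The exceptional set `S` collects configurations whose ties
are not controlled. -/
theorem bitsLaw_highRank_le (hε : ε ∈ Set.Ioo (0 : ℝ) 1) {α η : ℝ} (hα : 0 ≤ α) (hη : 0 ≤ η)
    (hm : 2 ≤ m) (hn : 2 ≤ n) (S : Set (Fin m ⊕ Fin n → Bool))
    (hS : ∀ w ∉ S, ∀ a, (permLevel w a : ℝ) ≤ η * Nat.factorial (m + n)) :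
    (bitsLaw m n ε) (highRank α m n) ≤ ENNReal.ofReal (α + 2 * η) + (bitsLaw m n ε) S := by
  classical
  have := isProbabilityMeasure_bitsLaw (m := m) (n := n) hε
  set P := bitsLaw m n ε
  set F : ℝ := ((Nat.factorial (m + n) : ℕ) : ℝ) with hF
  have hF0 : 0 < F := Nat.cast_pos.mpr (Nat.factorial_pos _)
  have hmeas : ∀ A : Set (Fin m ⊕ Fin n → Bool), MeasurableSet A := fun A =>
    A.toFinite.measurableSet
  have h1 : F * P.real (highRank α m n) =
      ∫ w, ((Finset.univ.filter fun τ : Equiv.Perm (Fin m ⊕ Fin n) =>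
        w ∘ τ ∈ highRank α m n).card : ℝ) ∂P := by
    simp_rw [← Finset.sum_boole]
    rw [integral_finsetSum _ fun τ _ => Integrable.of_finite]
    have : ∀ τ : Equiv.Perm (Fin m ⊕ Fin n),
        ∫ w, (if w ∘ τ ∈ highRank α m n then (1 : ℝ) else 0) ∂P = P.real (highRank α m n) := by
      intro τ
      rw [← (measurePreserving_bitsLaw_comp hε τ).measureReal_preimage
        (hmeas (highRank α m n)).nullMeasurableSet, ← integral_indicator_one (hmeas _)]
      rfl
    simp only [this, Finset.sum_const, Finset.card_univ, card_perm_sum, nsmul_eq_mul, hF]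
  have h2 : ∫ w, ((Finset.univ.filter fun τ : Equiv.Perm (Fin m ⊕ Fin n) =>
        w ∘ τ ∈ highRank α m n).card : ℝ) ∂P ≤ ∫ w, ((α + 2 * η) * F + F * S.indicator 1 w) ∂P := by
    refine integral_mono Integrable.of_finite Integrable.of_finite fun w => ?_
    by_cases hw : w ∈ S
    · have hcard : ((Finset.univ.filter fun τ : Equiv.Perm (Fin m ⊕ Fin n) =>
          w ∘ τ ∈ highRank α m n).card : ℝ) ≤ F := by
        rw [hF, ← card_perm_sum]
        exact_mod_cast Finset.card_le_univ _
      have : 0 ≤ (α + 2 * η) * F := by positivity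
      simp only [Set.indicator_of_mem hw, Pi.one_apply, mul_one]
      linarith
    · simp only [Set.indicator_of_notMem hw, mul_zero, add_zero]
      exact card_comp_mem_highRank_le hα hη hm hn w (hS w hw)
  rw [integral_add Integrable.of_finite Integrable.of_finite, integral_const_mul F,
    integral_indicator_one (hmeas S), ← h1] at h2
  simp only [integral_const, probReal_univ, smul_eq_mul, one_mul] at h2
  have h3 : P.real (highRank α m n) ≤ (α + 2 * η) + P.real S := by
    have : F * P.real (highRank α m n) ≤ F * ((α + 2 * η) + P.real S) := by linarith
    exact le_of_mul_le_mul_left this hF0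
  rw [← ofReal_measureReal (μ := P) (s := highRank α m n), ← ofReal_measureReal (μ := P) (s := S),
    ← ENNReal.ofReal_add (by positivity) measureReal_nonneg]
  exact ENNReal.ofReal_le_ofReal h3

end BitLaw

/-! ### The contaminating laws and a latent mixture representation -/

section FarContamination

variable {d : ℕ}

theorem projContinuous_of_absolutelyContinuous {P : Measure (Eucl d)} [IsProbabilityMeasure P]
    (hP : P ≪ volume) : ProjContinuous P := by
  refine ae_of_all _ fun β => ?_
  have hm : Measurable fun x : Eucl d => inner ℝ (β : Eucl d) x := by fun_prop
  have hβ : (β : Eucl d) ≠ 0 := ne_zero_of_mem_unit_sphere β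
  have := Measure.isProbabilityMeasure_map (μ := P) hm.aemeasurable
  have : NullSingletonClass (P.map fun x => inner ℝ (β : Eucl d) x) := ⟨fun t => by
    rw [Measure.map_apply hm (measurableSet_singleton t)]
    exact hP (volume_inner_eq hβ t)⟩
  have h := continuous_measureReal_Iic (P.map fun x => inner ℝ (β : Eucl d) x)
  convert h using 2 with t
  rw [map_measureReal_apply hm measurableSet_Iic]
  rfl

/-- The uniform distribution on the unit ball with centre `c`. -/
noncomputable def ballProbAt (c : Eucl d) : Measure (Eucl d) := (ballProb d).map (· + c)

instance (c : Eucl d) : IsProbabilityMeasure (ballProbAt c) :=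
  Measure.isProbabilityMeasure_map (by fun_prop)

theorem projContinuous_ballProbAt (c : Eucl d) : ProjContinuous (ballProbAt c) := by
  refine projContinuous_of_absolutelyContinuous ?_
  have h := (ballProb_absolutelyContinuous d).map (f := (· + c)) (by fun_prop)
  rwa [map_add_right_eq_self (volume : Measure (Eucl d)) c] at h

theorem ballProbAt_compl (c : Eucl d) : ballProbAt c {x | 1 < ‖x - c‖} = 0 := by
  rw [ballProbAt, Measure.map_apply (by fun_prop)
    (measurableSet_lt measurable_const (by fun_prop))]
  simp only [Set.preimage_ofPred_eq, add_sub_cancel_right]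
  rw [ballProb, Measure.smul_apply, Measure.restrict_apply
    (measurableSet_lt measurable_const (by fun_prop)), smul_eq_mul]
  have hempty : {x : Eucl d | 1 < ‖x‖} ∩ Metric.ball 0 1 = ∅ := by
    ext x
    simp only [Set.mem_inter_iff, Set.mem_ofPred_eq, mem_ball_zero_iff, Set.mem_empty_iff_false,
      iff_false, not_and, not_lt]
    exact fun h => h.le
  rw [hempty, measure_empty, mul_zero]

/-- The observation built from a contamination indicator, a clean and a contaminating draw. -/
def mixObs (ω : Bool × Eucl d × Eucl d) : Eucl d := if ω.1 = true then ω.2.2 else ω.2.1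

theorem measurable_mixObs : Measurable (mixObs (d := d)) :=
  Measurable.ite (measurable_fst (measurableSet_singleton true)) (by fun_prop) (by fun_prop)

/-- The law of a contamination indicator with a clean and a contaminating draw. -/
noncomputable def latentLaw (ε : ℝ) (Q G : Measure (Eucl d)) : Measure (Bool × Eucl d × Eucl d) :=
  (bernLaw ε).prod (Q.prod G)

variable {ε : ℝ} (Q G : Measure (Eucl d)) [IsProbabilityMeasure Q] [IsProbabilityMeasure G]

theorem measurePreserving_mixObs :
    MeasurePreserving mixObs (latentLaw ε Q G) (contaminate ε Q G) := by
  refine ⟨measurable_mixObs, ?_⟩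
  have h1 : Measurable fun y : Eucl d × Eucl d => (false, y) := measurable_prodMk_left
  have h2 : Measurable fun y : Eucl d × Eucl d => (true, y) := measurable_prodMk_left
  rw [latentLaw, bernLaw, Measure.add_prod, Measure.prod_smul_left, Measure.prod_smul_left,
    Measure.dirac_prod, Measure.dirac_prod, Measure.map_add _ _ measurable_mixObs,
    Measure.map_smul, Measure.map_smul, Measure.map_map measurable_mixObs h1,
    Measure.map_map measurable_mixObs h2, contaminate]
  have e1 : mixObs ∘ (fun y : Eucl d × Eucl d => (false, y)) = Prod.fst := by
    ext1 y; simp [mixObs]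
  have e2 : mixObs ∘ (fun y : Eucl d × Eucl d => (true, y)) = Prod.snd := by
    ext1 y; simp [mixObs]
  change _ • Measure.map (mixObs ∘ fun y : Eucl d × Eucl d => (false, y)) _ +
    _ • Measure.map (mixObs ∘ fun y : Eucl d × Eucl d => (true, y)) _ = _
  rw [e1, e2, measurePreserving_fst.map_eq, measurePreserving_snd.map_eq]

/-- The event that a clean draw is large or a contaminating draw is away from `c`. -/
def badDraw (M : ℝ) (c : Eucl d) : Set (Bool × Eucl d × Eucl d) :=
  {ω | M < ‖ω.2.1‖ ∨ 1 < ‖ω.2.2 - c‖}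

theorem measurableSet_badDraw (M : ℝ) (c : Eucl d) : MeasurableSet (badDraw M c) :=
  (measurableSet_lt (g := fun ω : Bool × Eucl d × Eucl d => ‖ω.2.1‖) measurable_const
    (by fun_prop)).union
  (measurableSet_lt (g := fun ω : Bool × Eucl d × Eucl d => ‖ω.2.2 - c‖) measurable_const
    (by fun_prop))

theorem latentLaw_badDraw_le (hε : ε ∈ Set.Ioo (0 : ℝ) 1) {M : ℝ} {c : Eucl d} {δ : ℝ≥0∞}
    (hQ : Q {x | M < ‖x‖} ≤ δ) (hG : G {x | 1 < ‖x - c‖} = 0) :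
    latentLaw ε Q G (badDraw M c) ≤ δ := by
  have := isProbabilityMeasure_bernLaw hε
  have hsub : badDraw M c ⊆ (Set.univ ×ˢ ({x | M < ‖x‖} ×ˢ Set.univ)) ∪
      (Set.univ ×ˢ (Set.univ ×ˢ {x | 1 < ‖x - c‖})) := by
    rintro ω (h | h)
    · left; simpa using h
    · right; simpa using h
  refine (measure_mono hsub).trans ((measure_union_le _ _).trans ?_)
  rw [latentLaw, Measure.prod_prod, Measure.prod_prod, Measure.prod_prod, Measure.prod_prod, hG]
  simp only [measure_univ, one_mul, mul_one, mul_zero, add_zero]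
  exact hQ

end FarContamination

/-! ### Reduction of the energy test to the contamination indicators -/

section EnergyTest

variable {d m n : ℕ}

/-- The samples whose energy statistic has a high rank among all permutations. -/
def highRankEnergy (α : ℝ) (m n d : ℕ) : Set (Fin m ⊕ Fin n → Eucl d) :=
  {z | (1 - α) * Nat.factorial (m + n) ≤ ((Finset.univ.filter fun σ : Equiv.Perm (Fin m ⊕ Fin n) =>
    pairEnergy (fun x y => ‖x - y‖) (z ∘ σ) < pairEnergy (fun x y => ‖x - y‖) z).card : ℝ)}

theorem measurable_pairEnergy_norm :
    Measurable fun z : Fin m ⊕ Fin n → Eucl d => pairEnergy (fun x y => ‖x - y‖) z := by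
  unfold pairEnergy
  fun_prop

theorem measurableSet_highRankEnergy (α : ℝ) : MeasurableSet (highRankEnergy α m n d) := by
  unfold highRankEnergy
  simp_rw [← Finset.sum_boole]
  refine measurableSet_le measurable_const (Finset.measurable_sum _ fun σ _ => ?_)
  refine Measurable.ite (measurableSet_lt ?_ measurable_pairEnergy_norm) measurable_const
    measurable_const
  exact measurable_pairEnergy_norm.comp (f := fun z : Fin m ⊕ Fin n → Eucl d => z ∘ σ)
    (measurable_pi_lambda _ fun k => measurable_pi_apply _)

theorem mem_highRankEnergy_of_reject {α : ℝ} (hα : 0 ≤ α) {X : Fin m → Eucl d}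
    {Y : Fin n → Eucl d} (h : permCriticalValue UEnergy α X Y < UEnergy X Y) :
    Sum.elim X Y ∈ highRankEnergy α m n d := by
  have h1 := le_card_of_permCriticalValue_lt UEnergy hα h
  refine h1.trans (le_of_eq ?_)
  rw [Finset.card_filter, Finset.card_filter, ← Equiv.sum_comp finSumFinEquiv.permCongr]
  simp only [permStat_permCongr]
  rfl

/-- Far contaminations make the rank of the energy statistic depend on the contamination
indicators only. -/
theorem pairEnergy_le_of_lt {z : Fin m ⊕ Fin n → Eucl d} {w : Fin m ⊕ Fin n → Bool} {M R : ℝ}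
    {c : Eucl d} (hm : 2 ≤ m) (hn : 2 ≤ n) (hR : ‖c‖ = R)
    (hMR : 16 * (M + 1) * ((m : ℝ) * (m - 1) * (n * (n - 1))) ≤ R)
    (hz : ∀ k, ‖z k - if w k = true then c else 0‖ ≤ M + 1) (σ : Equiv.Perm (Fin m ⊕ Fin n))
    (h : pairEnergy (fun x y => ‖x - y‖) (z ∘ σ) < pairEnergy (fun x y => ‖x - y‖) z) :
    pairEnergy boolDist (w ∘ σ) ≤ pairEnergy boolDist w := by
  have hm' : (2 : ℝ) ≤ m := by exact_mod_cast hm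
  have hn' : (2 : ℝ) ≤ n := by exact_mod_cast hn
  -- Every point is within `M + 1` of its centre, 0 or `c`, so distances are `R` times the discrete
  -- distance up to `2 (M + 1)`, and each energy is off by at most `8 (M + 1)`.
  have hclose : ∀ k l, |‖z k - z l‖ - R * boolDist (w k) (w l)| ≤ 2 * (M + 1) := by
    intro k l
    have e : R * boolDist (w k) (w l) =
        ‖(if w k = true then c else 0) - (if w l = true then c else 0)‖ := by
      cases w k <;> cases w l <;> simp [boolDist, hR]
    rw [e]
    refine (abs_norm_sub_norm_le _ _).trans ?_
    rw [sub_sub_sub_comm]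
    refine (norm_sub_le _ _).trans ?_
    linarith [hz k, hz l]
  have e1 := abs_le.mp (abs_pairEnergy_sub_le (ρ := fun x y : Eucl d => ‖x - y‖) (z := z) hm hn
    hclose)
  have e2 := abs_le.mp (abs_pairEnergy_sub_le (ρ := fun x y : Eucl d => ‖x - y‖) (z := z ∘ σ)
    (w := w ∘ σ) hm hn fun k l => hclose (σ k) (σ l))
  by_contra hcon
  push Not at hcon
  obtain ⟨k1, hk1⟩ := countEnergy_integral hm hn (leftCount w) (rightCount w)
  obtain ⟨k2, hk2⟩ := countEnergy_integral hm hn (leftCount (w ∘ σ)) (rightCount (w ∘ σ))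
  rw [← pairEnergy_boolDist] at hk1 hk2
  set D := (m : ℝ) * (m - 1) * (n * (n - 1)) with hD
  have hD0 : 0 < D := by
    have : (0 : ℝ) < m - 1 := by linarith
    have : (0 : ℝ) < n - 1 := by linarith
    positivity
  have hk : k1 < k2 := by
    have : (k1 : ℝ) < k2 := by
      rw [← hk1, ← hk2]; exact mul_lt_mul_of_pos_left hcon hD0
    exact_mod_cast this
  -- Distinct two-point energies differ by at least `1 / D`. Multiplied by `R` this gap is at least
  -- `16 (M + 1)`, twice the error of a single energy, so the order cannot be reversed.
  have hgap : 1 ≤ D * (pairEnergy boolDist (w ∘ σ) - pairEnergy boolDist w) := by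
    rw [mul_sub, hk1, hk2]
    have : (k1 : ℝ) + 1 ≤ k2 := by exact_mod_cast hk
    linarith
  have hM : 0 ≤ M + 1 := by
    have hne : 0 < m := by omega
    exact (norm_nonneg _).trans (hz (Sum.inl ⟨0, hne⟩))
  have h3 : 16 * (M + 1) ≤ R * (pairEnergy boolDist (w ∘ σ) - pairEnergy boolDist w) := by
    calc 16 * (M + 1) = 16 * (M + 1) * 1 := by ring
      _ ≤ 16 * (M + 1) * (D * (pairEnergy boolDist (w ∘ σ) - pairEnergy boolDist w)) := by gcongr
      _ = (16 * (M + 1) * D) * (pairEnergy boolDist (w ∘ σ) - pairEnergy boolDist w) := by ring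
      _ ≤ _ := mul_le_mul_of_nonneg_right hMR (by linarith)
  linarith [e1.1, e1.2, e2.1, e2.2]

variable {ε : ℝ} (QX QY : Measure (Eucl d)) [IsProbabilityMeasure QX] [IsProbabilityMeasure QY]

/-- The power of the energy test against a far contamination. -/
theorem energyPower_le (hε : ε ∈ Set.Ioo (0 : ℝ) 1) {α M R : ℝ} (hα : 0 ≤ α) {c : Eucl d}
    {δ : ℝ≥0∞} (hm : 2 ≤ m) (hn : 2 ≤ n) (hR : ‖c‖ = R) (hM0 : 0 ≤ M)
    (hMR : 16 * (M + 1) * ((m : ℝ) * (m - 1) * (n * (n - 1))) ≤ R)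
    (hX : QX {x | M < ‖x‖} ≤ δ) (hY : QY {x | M < ‖x‖} ≤ δ) :
    energyPower α ε QX QY (ballProbAt c) m n ≤
      (bitsLaw m n ε) (highRank α m n) + ((m + n : ℕ) : ℝ≥0∞) * δ := by
  have := isProbabilityMeasure_bernLaw hε
  set G := ballProbAt c with hG
  have := isProbabilityMeasure_contaminate hε QX G
  have := isProbabilityMeasure_contaminate hε QY G
  have hpX : IsProbabilityMeasure (latentLaw ε QX G) := by unfold latentLaw; infer_instance
  have hpY : IsProbabilityMeasure (latentLaw ε QY G) := by unfold latentLaw; infer_instance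
  let L : Fin m ⊕ Fin n → Measure (Bool × Eucl d × Eucl d) :=
    Sum.elim (fun _ => latentLaw ε QX G) fun _ => latentLaw ε QY G
  have hL : ∀ k, IsProbabilityMeasure (L k) := by
    rintro (i | j)
    · exact hpX
    · exact hpY
  -- One latent product law drives both the observations and the indicators. The indicators have the
  -- same Bernoulli marginals in both samples, although the clean laws differ.
  have hmix : MeasurePreserving
      (fun (ω : Fin m ⊕ Fin n → Bool × Eucl d × Eucl d) k => mixObs (ω k)) (Measure.pi L)
      (poolLaw m n (contaminate ε QX G) (contaminate ε QY G)) := by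
    refine measurePreserving_pi (f := fun _ => mixObs) _ _ ?_
    rintro (i | j)
    · exact measurePreserving_mixObs QX G
    · exact measurePreserving_mixObs QY G
  have hbits : MeasurePreserving
      (fun (ω : Fin m ⊕ Fin n → Bool × Eucl d × Eucl d) k => (ω k).1) (Measure.pi L)
      (bitsLaw m n ε) := by
    refine measurePreserving_pi (f := fun _ => Prod.fst) _ _ ?_
    rintro (i | j)
    · exact measurePreserving_fst
    · exact measurePreserving_fst
  have hbad : ∀ k, Measure.pi L {ω | ω k ∈ badDraw M c} ≤ δ := by
    intro k
    refine (le_of_eq ?_).trans (show L k (badDraw M c) ≤ δ from ?_)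
    · refine (measurePreserving_eval L k).measure_preimage ?_
      exact (measurableSet_badDraw M c).nullMeasurableSet
    · rcases k with i | j
      · exact latentLaw_badDraw_le QX G hε hX (ballProbAt_compl c)
      · exact latentLaw_badDraw_le QY G hε hY (ballProbAt_compl c)
  have hpool := measurePreserving_pool (m := m) (n := n) (contaminate ε QX G) (contaminate ε QY G)
  have hHR := measurableSet_highRankEnergy (m := m) (n := n) (d := d) α
  calc energyPower α ε QX QY G m n
      ≤ ((Measure.pi fun _ : Fin m => contaminate ε QX G).prod
          (Measure.pi fun _ : Fin n => contaminate ε QY G))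
          ((fun S : (Fin m → Eucl d) × (Fin n → Eucl d) =>
            (Sum.elim S.1 S.2 : Fin m ⊕ Fin n → Eucl d)) ⁻¹' highRankEnergy α m n d) :=
        measure_mono fun S hS => mem_highRankEnergy_of_reject hα hS
    _ = poolLaw m n (contaminate ε QX G) (contaminate ε QY G) (highRankEnergy α m n d) :=
        hpool.measure_preimage hHR.nullMeasurableSet
    _ = Measure.pi L ((fun (ω : Fin m ⊕ Fin n → Bool × Eucl d × Eucl d) k => mixObs (ω k)) ⁻¹'
          highRankEnergy α m n d) := (hmix.measure_preimage hHR.nullMeasurableSet).symm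
    _ ≤ Measure.pi L (((fun (ω : Fin m ⊕ Fin n → Bool × Eucl d × Eucl d) k => (ω k).1) ⁻¹'
          highRank α m n) ∪ ⋃ k, {ω | ω k ∈ badDraw M c}) := by
        refine measure_mono fun ω hω => ?_
        by_cases hb : ∃ k, ω k ∈ badDraw M c
        · exact Or.inr (Set.mem_iUnion.mpr hb)
        · left
          push Not at hb
          refine le_trans (show (1 - α) * _ ≤ _ from hω) ?_
          refine Nat.cast_le.mpr (Finset.card_le_card fun σ hσ => ?_)
          simp only [Finset.mem_filter, Finset.mem_univ, true_and] at hσ ⊢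
          refine pairEnergy_le_of_lt hm hn hR hMR (fun k => ?_) σ hσ
          have hk := hb k
          simp only [badDraw, Set.mem_ofPred_eq, not_or, not_lt] at hk
          simp only [mixObs]
          split_ifs
          · linarith [hk.2]
          · rw [sub_zero]; linarith [hk.1]
    _ ≤ _ := measure_union_le _ _
    _ ≤ _ := by
        refine add_le_add (le_of_eq (hbits.measure_preimage
          (Set.toFinite _).measurableSet.nullMeasurableSet)) ?_
        refine (measure_iUnion_fintype_le _ _).trans
          ((Finset.sum_le_card_nsmul _ _ δ fun k _ => hbad k).trans (le_of_eq ?_))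
        simp [Fintype.card_sum]

end EnergyTest

/-! ### Choice of the contaminating sequence and conclusion -/

section Main

variable {d : ℕ}

theorem measure_norm_gt_le (Q : Measure (Eucl d)) [IsProbabilityMeasure Q]
    (hQ : Integrable (fun x => ‖x‖ ^ 2) Q) {S : ℝ} (hS : ∫ x, ‖x‖ ^ 2 ∂Q ≤ S) (hS0 : 0 < S)
    {r : ℝ} (hr : 0 < r) : Q {x | r * √S < ‖x‖} ≤ ENNReal.ofReal (1 / r ^ 2) := by
  have h := mul_meas_ge_le_integral_of_nonneg (ae_of_all _ fun x => sq_nonneg ‖x‖) hQ (r ^ 2 * S)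
  have hsub : {x : Eucl d | r * √S < ‖x‖} ⊆ {x | r ^ 2 * S ≤ ‖x‖ ^ 2} := fun x hx => by
    have hx' : r * √S < ‖x‖ := hx
    have := pow_le_pow_left₀ (by positivity) hx'.le 2
    rwa [mul_pow, Real.sq_sqrt hS0.le] at this
  rw [← ofReal_measureReal]
  refine ENNReal.ofReal_le_ofReal ((measureReal_mono hsub).trans ?_)
  rw [le_div_iff₀ (by positivity)]
  have : (Q.real {x | r ^ 2 * S ≤ ‖x‖ ^ 2} * r ^ 2) * S ≤ 1 * S := by
    rw [one_mul]; linarith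
  exact le_of_mul_le_mul_right this hS0

theorem le_mul_add_one_sq {x η : ℝ} (hx : 0 ≤ x) (hη : 0 ≤ η) (h : 1 ≤ x * η) :
    x ≤ η * (x + 1) ^ 2 := by
  have h1 := mul_le_mul_of_nonneg_left h hx
  have h2 := mul_nonneg hη hx
  linarith

theorem mul_sub_one_mul_le {x y : ℝ} (hx : 1 ≤ x) (hy : 1 ≤ y) :
    x * (x - 1) * (y * (y - 1)) ≤ (x + y) ^ 4 := by
  have e1 : x * (x - 1) ≤ (x + y) ^ 2 := by nlinarith
  have e2 : y * (y - 1) ≤ (x + y) ^ 2 := by nlinarith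
  calc x * (x - 1) * (y * (y - 1)) ≤ (x + y) ^ 2 * (x + y) ^ 2 :=
        mul_le_mul e1 e2 (mul_nonneg (by linarith) (by linarith)) (by positivity)
    _ = _ := by ring

/-- The contaminations at growing distances defeat the energy test. -/
theorem exists_far_contamination (hd : 1 ≤ d) {α ε : ℝ} (hα : 0 ≤ α)
    (hε : ε ∈ Set.Ioo (0 : ℝ) 1) (QX QY : Measure (Eucl d)) [IsProbabilityMeasure QX]
    [IsProbabilityMeasure QY] (hX2 : Integrable (fun x => ‖x‖ ^ 2) QX)
    (hY2 : Integrable (fun y => ‖y‖ ^ 2) QY) :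
    ∃ G : ℕ → ProbabilityMeasure (Eucl d),
      (∀ N, ProjContinuous (G N : Measure (Eucl d))) ∧
      ∀ c η : ℝ, 0 < c → 0 < η → ∃ N₀ : ℕ, ∀ m n : ℕ, N₀ ≤ m + n → c * ((m : ℝ) + n) ≤ m →
        c * ((m : ℝ) + n) ≤ n →
        energyPower α ε QX QY (G (m + n)) m n ≤ ENNReal.ofReal (α + 4 * η) := by
  -- A common bound on both second moments; the added 1 makes it positive.
  set S : ℝ := ∫ x, ‖x‖ ^ 2 ∂QX + ∫ x, ‖x‖ ^ 2 ∂QY + 1 with hS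
  have hIX : 0 ≤ ∫ x, ‖x‖ ^ 2 ∂QX := integral_nonneg fun _ => sq_nonneg _
  have hIY : 0 ≤ ∫ x, ‖x‖ ^ 2 ∂QY := integral_nonneg fun _ => sq_nonneg _
  have hS0 : 0 < S := by linarith
  -- By Chebyshev a clean draw exceeds `M N` with probability at most `1 / (N + 1) ^ 2`, so the
  -- union bound over `N` draws still vanishes.
  let M : ℕ → ℝ := fun N => ((N : ℝ) + 1) * √S
  have hM0 : ∀ N, 0 ≤ M N := fun N => by positivity
  -- The lattice unit satisfies `m (m - 1) n (n - 1) ≤ N ^ 4`, which makes the distance depend on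
  -- `N` alone.
  let R : ℕ → ℝ := fun N => 16 * (M N + 1) * (N : ℝ) ^ 4
  have hR0 : ∀ N, 0 ≤ R N := fun N => by have := hM0 N; positivity
  let v : Eucl d := EuclideanSpace.single (⟨0, hd⟩ : Fin d) (1 : ℝ)
  have hv : ‖v‖ = 1 := by simp [v]
  refine ⟨fun N => ⟨ballProbAt (R N • v), inferInstance⟩, fun N => projContinuous_ballProbAt _, ?_⟩
  intro c η hc hη
  set c' : ℝ := min c (min (ε / 2) ((1 - ε) / 2)) with hc'
  have hc'0 : 0 < c' := lt_min hc (lt_min (by linarith [hε.1]) (by linarith [hε.2]))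
  have hc'c : c' ≤ c := min_le_left _ _
  have hc'1 : 2 * c' ≤ ε := by
    linarith [(min_le_right c (min (ε / 2) ((1 - ε) / 2))).trans (min_le_left _ _)]
  have hc'2 : 2 * c' ≤ 1 - ε := by
    linarith [(min_le_right c (min (ε / 2) ((1 - ε) / 2))).trans (min_le_right _ _)]
  obtain ⟨N₁, hN₁⟩ := permLevel_anticoncentration hc'0 hη
  obtain ⟨N₂, hN₂⟩ := exists_nat_ge (max (2 / c) (max (1 / (c' ^ 2 * η)) (1 / η)))
  refine ⟨max (max N₁ N₂) 1, fun m n hN hm hn => ?_⟩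
  have hN1 : N₁ ≤ m + n := ((le_max_left _ _).trans (le_max_left _ _)).trans hN
  have hN2 : (N₂ : ℝ) ≤ (m : ℝ) + n := by
    exact_mod_cast ((le_max_right _ _).trans (le_max_left _ _)).trans hN
  have hN3 : 1 ≤ m + n := (le_max_right _ _).trans hN
  have hNpos : (0 : ℝ) < (m : ℝ) + n := by exact_mod_cast hN3
  have h2c : 2 ≤ c * ((m : ℝ) + n) := by
    have := ((le_max_left _ _).trans hN₂).trans hN2
    rw [div_le_iff₀ hc] at this; linarith
  have hc1 : 1 / (c' ^ 2 * ((m : ℝ) + n)) ≤ η := by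
    have := ((le_max_left _ _).trans ((le_max_right _ _).trans hN₂)).trans hN2
    rw [div_le_iff₀ (by positivity)] at this ⊢; linarith
  have hc2 : ((m : ℝ) + n) * (1 / (((m : ℝ) + n) + 1) ^ 2) ≤ η := by
    have := ((le_max_right _ _).trans ((le_max_right _ _).trans hN₂)).trans hN2
    rw [div_le_iff₀ hη] at this
    rw [mul_one_div, div_le_iff₀ (by positivity)]
    exact le_mul_add_one_sq hNpos.le hη.le this
  have hm2 : 2 ≤ m := by exact_mod_cast h2c.trans hm
  have hn2 : 2 ≤ n := by exact_mod_cast h2c.trans hn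
  have hcN : c' * ((m : ℝ) + n) ≤ c * ((m : ℝ) + n) := mul_le_mul_of_nonneg_right hc'c hNpos.le
  have hnorm : ‖R (m + n) • v‖ = R (m + n) := by
    rw [norm_smul, hv, mul_one, Real.norm_of_nonneg (hR0 _)]
  have hMR : 16 * (M (m + n) + 1) * ((m : ℝ) * (m - 1) * (n * (n - 1))) ≤ R (m + n) := by
    have h0 := hM0 (m + n)
    have hm' : (2 : ℝ) ≤ m := by exact_mod_cast hm2
    have hn' : (2 : ℝ) ≤ n := by exact_mod_cast hn2
    have hR : R (m + n) = 16 * (M (m + n) + 1) * ((m : ℝ) + n) ^ 4 := by simp only [R, Nat.cast_add]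
    rw [hR]
    exact mul_le_mul_of_nonneg_left (mul_sub_one_mul_le (by linarith) (by linarith))
      (mul_nonneg (by norm_num) (add_nonneg h0 zero_le_one))
  have hpow := energyPower_le QX QY hε hα hm2 hn2 hnorm (hM0 _) hMR
    (measure_norm_gt_le QX hX2 (by linarith) hS0 (by positivity))
    (measure_norm_gt_le QY hY2 (by linarith) hS0 (by positivity))
  have hrank := bitsLaw_highRank_le hε hα hη.le hm2 hn2 {w | ¬ (c' * ((m : ℝ) + n) ≤ poolCount w ∧
      c' * ((m : ℝ) + n) ≤ (m : ℝ) + n - poolCount w)} fun w hw a => by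
    have hw' := not_not.mp hw
    exact hN₁ m n w a hN1 (hcN.trans hm) (hcN.trans hn) hw'.1 hw'.2
  have hK := bitsLaw_poolCount_le (m := m) (n := n) hε hc'0 hc'1 hc'2 hN3
  refine hpow.trans ?_
  -- The excess `4 * η` is `2 * η` for ties, `η` for an atypical number of contaminated points and
  -- `η` for large clean draws.
  calc (bitsLaw m n ε) (highRank α m n) +
        ((m + n : ℕ) : ℝ≥0∞) * ENNReal.ofReal (1 / (((m + n : ℕ) : ℝ) + 1) ^ 2)
      ≤ (ENNReal.ofReal (α + 2 * η) + ENNReal.ofReal η) + ENNReal.ofReal η := by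
        refine add_le_add (hrank.trans (add_le_add le_rfl
          (hK.trans (ENNReal.ofReal_le_ofReal hc1)))) ?_
        rw [← ENNReal.ofReal_natCast, ← ENNReal.ofReal_mul (Nat.cast_nonneg _)]
        push_cast
        exact ENNReal.ofReal_le_ofReal hc2
    _ = ENNReal.ofReal (α + 4 * η) := by
        rw [← ENNReal.ofReal_add (by positivity) hη.le, ← ENNReal.ofReal_add (by positivity) hη.le]
        congr 1; ring

theorem limsup_le_of_regime {α : ℝ} (hα : 0 ≤ α) {f : ℕ → ℕ → ℝ≥0∞}
    (hf : ∀ c η : ℝ, 0 < c → 0 < η → ∃ N₀ : ℕ, ∀ m n : ℕ, N₀ ≤ m + n → c * ((m : ℝ) + n) ≤ m →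
      c * ((m : ℝ) + n) ≤ n → f m n ≤ ENNReal.ofReal (α + 4 * η)) {m n : ℕ → ℕ}
    (h : ConventionalRegime m n) :
    limsup (fun k => f (m k) (n k)) atTop ≤ ENNReal.ofReal α := by
  obtain ⟨ϑX, hX, ϑY, hY, hN, hmN, hnN⟩ := h
  refine ENNReal.le_of_forall_pos_le_add fun e he _ => ?_
  -- Half the smaller limiting proportion is eventually a lower bound for both sample fractions.
  set c : ℝ := min (ϑX / 2) (ϑY / 2) with hc
  have hc0 : 0 < c := lt_min (by linarith [hX.1]) (by linarith [hY.1])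
  obtain ⟨N₀, hN₀⟩ := hf c (e / 4) hc0 (by positivity)
  have hev : ∀ᶠ k in atTop, f (m k) (n k) ≤ ENNReal.ofReal (α + 4 * (e / 4)) := by
    have hcX : c < ϑX := (min_le_left _ _).trans_lt (by linarith [hX.1])
    have hcY : c < ϑY := (min_le_right _ _).trans_lt (by linarith [hY.1])
    filter_upwards [hN.eventually_ge_atTop (max N₀ 1), hmN.eventually_const_lt hcX,
      hnN.eventually_const_lt hcY] with k h1 h2 h3
    have hpos : (0 : ℝ) < (m k : ℝ) + n k := by exact_mod_cast (le_max_right _ _).trans h1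
    rw [lt_div_iff₀ hpos] at h2 h3
    exact hN₀ _ _ ((le_max_left _ _).trans h1) h2.le h3.le
  refine (limsup_le_of_le (h := hev)).trans ?_
  rw [show α + 4 * ((e : ℝ) / 4) = α + e by ring, ENNReal.ofReal_add hα e.coe_nonneg,
    ENNReal.ofReal_coe_nnreal]

end Main

theorem mainTheorem5 {d : ℕ} (hd : 1 ≤ d) (α ε : ℝ) (hα : α ∈ Set.Ioo (0 : ℝ) 1)
    (hε : ε ∈ Set.Ioo (0 : ℝ) 1)
    (QX QY : Measure (EuclideanSpace ℝ (Fin d)))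
    [IsProbabilityMeasure QX] [IsProbabilityMeasure QY]
    (hQ : QX ≠ QY)
    (hX2 : Integrable (fun x => ‖x‖ ^ 2) QX) (hY2 : Integrable (fun y => ‖y‖ ^ 2) QY)
    (hXc : ProjContinuous QX) (hYc : ProjContinuous QY) :
    (∃ G : ℕ → ProbabilityMeasure (EuclideanSpace ℝ (Fin d)),
      (∀ N, ProjContinuous (G N : Measure (EuclideanSpace ℝ (Fin d)))) ∧
      ∀ m n : ℕ → ℕ, ConventionalRegime m n →
        limsup (fun k => energyPower α ε QX QY (G (m k + n k)) (m k) (n k)) atTop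
          ≤ ENNReal.ofReal α) ∧
    (∀ m n : ℕ → ℕ, ConventionalRegime m n →
      limsup (fun k =>
          ⨅ (G : ProbabilityMeasure (EuclideanSpace ℝ (Fin d)))
            (_ : ProjContinuous (G : Measure (EuclideanSpace ℝ (Fin d)))),
            energyPower α ε QX QY G (m k) (n k)) atTop
        ≤ ENNReal.ofReal α) ∧
    Tendsto (fun p : ℕ × ℕ =>
        ⨅ (G : ProbabilityMeasure (EuclideanSpace ℝ (Fin d)))
          (_ : ProjContinuous (G : Measure (EuclideanSpace ℝ (Fin d)))),
          cvmPower α ε QX QY G p.1 p.2)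
      (atTop ×ˢ atTop) (𝓝 1) := by
  obtain ⟨G, hG, hpow⟩ := exists_far_contamination hd hα.1.le hε QX QY hX2 hY2
  have hlim : ∀ m n : ℕ → ℕ, ConventionalRegime m n →
      limsup (fun k => energyPower α ε QX QY (G (m k + n k)) (m k) (n k)) atTop
        ≤ ENNReal.ofReal α := fun m n h =>
    limsup_le_of_regime (f := fun m n => energyPower α ε QX QY (G (m + n)) m n) hα.1.le hpow h
  refine ⟨⟨G, hG, hlim⟩, fun m n h => (limsup_le_limsup ?_).trans (hlim m n h),
    tendsto_iInf_cvmPower hd hα hε QX QY hQ hXc hYc⟩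
  exact Eventually.of_forall fun k => iInf₂_le (G (m k + n k)) (hG _)
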